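/- Let $(M,\omega)$ be a symplectic manifold and $\mathcal{T}$ a smooth manifold (both finite-dimensional, Hausdorff, second countable, without boundary). Write $C^\infty(M)$ for the complex valued smooth functions on $M$. A \emph{natural star product} on $M$ is an associative $\mathbb{C}[[h]]$-bilinear product $f\star g=\sum_k c^k(f,g)h^k$ on $C^\infty(M)[[h]]$ with unit $1$ such that $c^0(f,g)=fg$, $c^1(f,g)-c^1(g,f)=i\{f,g\}$, and $c^k$ is a differential operator of order at most $k$ in each argument. Let $\{\star_\sigma\}_{\sigma\in\mathcal{T}}$ be a smooth family of natural star products on $M$. A \emph{formal connection} is an operator $$D_Vf=V[f]+A(V)(f)$$ for smooth vector fields $V$ on $\mathcal{T}$ and smooth sections $f$ of $\mathcal{T}\times C^\infty(M)[[h]]\to\mathcal{T}$, where $A=\sum_{k\ge1}A^kh^k$ is a smooth $1$-form on $\mathcal{T}$ with values in formal differential operators on $M$ that vanish modulo $h$, with $A^k$ of order at most $k$. It is \emph{compatible} with the family if $D_V(f\star_\sigma g)=D_V(f)\star_\sigma g+f\star_\sigma D_V(g)$ for all $V$ and all smooth sections $f,g$. Let $\mathcal{F}(M,\star_\sigma)$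 be the set of compatible formal connections. Let $\mathrm{Der}_0(M,\star_\sigma)$ be the space of $\mathbb{C}[[h]]$-linear derivations of $\star_\sigma$ that vanish modulo $h$, let $\Gamma_{\mathrm{sym}}(M)$ be the space of smooth complex vector fields $Y$ on $M$ for which $\iota_Y\omega$ is closed, and let $\tilde C^\infty_h(M)=C^\infty(M)[[h]]/\mathbb{C}[[h]]$. Denote by $X_b$ the Hamiltonian vector field of $b$, $X_b(f)=\{b,f\}$. (1) For every $D_0\in\mathcal{F}(M,\star_\sigma)$, $$\mathcal{F}(M,\star_\sigma)=D_0+\Omega^1(\mathcal{T},\mathrm{Der}_0(M,\star_\sigma)),$$ that is, the map $\beta\mapsto D_0+\beta$ is a bijection from the smooth $1$-forms $\beta$ on $\mathcal{T}$ with $\beta_\sigma(v)\in\mathrm{Der}_0(M,\star_\sigma)$ onto $\mathcal{F}(M,\star_\sigma)$. (2) For every $\sigma$ there is a linear isomorphism $\varphi_\sigma\colon h\Gamma_{\mathrm{sym}}(M)[[h]]\to\mathrm{Der}_0(M,\star_\sigma)$ such that, whenever $b=\sum_k b_kh^k$ is a formal function with $Y_k=X_{b_k}$ for all $k$ on an open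 set $U\subset M$, the derivation $B=\varphi_\sigma(\sum_kY_kh^k)$ satisfies $B(f)|_U=\frac1h(b\star_\sigma f-f\star_\sigma b)|_U$ for all $f$; every point of $M$ has a neighbourhood on which there is such a $b$. Applied pointwise, these isomorphisms induce a linear isomorphism $\Omega^1(\mathcal{T},h\Gamma_{\mathrm{sym}}(M)[[h]])\cong\Omega^1(\mathcal{T},\mathrm{Der}_0(M,\star_\sigma))$, and through it, for every $D_0\in\mathcal{F}(M,\star_\sigma)$, $$\mathcal{F}(M,\star_\sigma)=D_0+\Omega^1(\mathcal{T},h\Gamma_{\mathrm{sym}}(M)[[h]]),$$ each connection being obtained from exactly one $1$-form. (3) If moreover $M$ is connected and $H^1(M;\mathbb{R})=0$, then for every $\sigma$ the map $[b]\mapsto\frac1h(b\star_\sigma\cdot-\cdot\star_\sigma b)$ is a linear isomorphism $h\tilde C^\infty_h(M)\to\mathrm{Der}_0(M,\star_\sigma)$. These isomorphisms induce a linear isomorphism $\Omega^1(\mathcal{T},h\tilde C^\infty_h(M))\cong\Omega^1(\mathcal{T},\mathrm{Der}_0(M,\star_\sigma))$, and through it, for every $D_0\in\mathcal{F}(M,\star_\sigma)$,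 $$\mathcal{F}(M,\star_\sigma)=D_0+\Omega^1(\mathcal{T},h\tilde C^\infty_h(M)),$$ each connection being obtained from exactly one $1$-form. -/

import Mathlib

open scoped Manifold ContDiff TensorProduct PowerSeries

noncomputable section

namespace FormalConnections

/-! ## Smooth functions, differential forms, first de Rham cohomology

Manifolds are finite-dimensional, without boundary, modelled on a normed space `E`. -/

section Manifold

variable (E : Type*) [NormedAddCommGroup E] [NormedSpace ℝ E]
  (M : Type*) [TopologicalSpace M] [ChartedSpace E M]

/-- The algebra `C^∞(M)` of complex valued smooth functions on `M`. -/
def SmoothFn : Subalgebra ℂ (M → ℂ) where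
  carrier := {f | ContMDiff 𝓘(ℝ, E) 𝓘(ℝ, ℂ) ∞ f}
  mul_mem' {f g} hf hg := by
    have h : ContDiff ℝ ∞ (fun p : ℂ × ℂ => p.1 * p.2) := contDiff_mul
    exact h.comp_contMDiff (hf.prodMk_space hg)
  add_mem' {f g} hf hg := ContMDiff.add hf hg
  algebraMap_mem' _ := contMDiff_const

/-- Differential `k`-forms on `M` with values in `G`, without regularity. -/
abbrev Form (G : Type*) [NormedAddCommGroup G] [NormedSpace ℝ G] (k : ℕ) : Type _ :=
  (x : M) → TangentSpace 𝓘(ℝ, E) x [⋀^Fin k]→L[ℝ] G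

variable {E M} {G : Type*} [NormedAddCommGroup G] [NormedSpace ℝ G] {k : ℕ}

/-- The expression of a form in the preferred chart at `x₀`: its pullback under the inverse of the
chart. It is meaningful on the target of the chart. -/
def Form.inChart (α : Form E M G k) (x₀ : M) (y : E) : E [⋀^Fin k]→L[ℝ] G :=
  (α ((extChartAt 𝓘(ℝ, E) x₀).symm y)).compContinuousLinearMap
    (mfderiv 𝓘(ℝ, E) 𝓘(ℝ, E) (extChartAt 𝓘(ℝ, E) x₀).symm y)

/-- A form is smooth if it is smooth in every chart. -/
def Form.IsSmooth (α : Form E M G k) : Prop :=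
  ∀ x₀ : M, ContDiffOn ℝ ∞ (α.inChart x₀) (extChartAt 𝓘(ℝ, E) x₀).target

/-- A form is closed if its exterior derivative vanishes in every chart. -/
def Form.IsClosed (α : Form E M G k) : Prop :=
  ∀ x₀ : M, ∀ y ∈ (extChartAt 𝓘(ℝ, E) x₀).target, extDeriv (α.inChart x₀) y = 0

/-- A linear functional on every tangent space, seen as a `1`-form. -/
def oneForm (α : (x : M) → TangentSpace 𝓘(ℝ, E) x →L[ℝ] G) : Form E M G 1 :=
  fun x => ContinuousAlternatingMap.ofSubsingleton ℝ (TangentSpace 𝓘(ℝ, E) x) G (0 : Fin 1) (α x)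

/-- The differential `df` of a function, as a `1`-form. -/
def differential (f : M → G) : Form E M G 1 :=
  oneForm fun x => mfderiv 𝓘(ℝ, E) 𝓘(ℝ, G) f x

theorem Form.IsSmooth.differentiableAt {α : Form E M G k} (h : α.IsSmooth) {x₀ : M} {y : E}
    (hy : y ∈ (extChartAt 𝓘(ℝ, E) x₀).target) : DifferentiableAt ℝ (α.inChart x₀) y :=
  ((h x₀).contDiffAt ((isOpen_extChartAt_target (I := 𝓘(ℝ, E)) x₀).mem_nhds hy)).differentiableAt
    (by simp)

theorem Form.zero_mem : (0 : Form E M G k).IsSmooth ∧ (0 : Form E M G k).IsClosed := by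
  have h (x₀ : M) : (0 : Form E M G k).inChart x₀ = (0 : ℝ) • fun _ : E => 0 := by
    funext y
    ext v
    simp only [Form.inChart, zero_smul]
    rfl
  refine ⟨fun x₀ => ?_, fun x₀ y _ => ?_⟩
  · rw [h, zero_smul]
    exact contDiffOn_const
  · rw [h, extDeriv_smul, zero_smul]

theorem Form.add_mem {α β : Form E M G k} (hα : α.IsSmooth ∧ α.IsClosed)
    (hβ : β.IsSmooth ∧ β.IsClosed) : (α + β).IsSmooth ∧ (α + β).IsClosed := by
  have h (x₀ : M) : (α + β).inChart x₀ = α.inChart x₀ + β.inChart x₀ := rfl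
  refine ⟨fun x₀ => ?_, fun x₀ y hy => ?_⟩
  · rw [h]
    exact (hα.1 x₀).add (hβ.1 x₀)
  · rw [h, extDeriv_add (hα.1.differentiableAt hy) (hβ.1.differentiableAt hy), hα.2 x₀ y hy,
      hβ.2 x₀ y hy, add_zero]

theorem Form.smul_mem {𝕜 : Type*} [NormedField 𝕜] [NormedSpace 𝕜 G] [SMulCommClass ℝ 𝕜 G] (c : 𝕜)
    {α : Form E M G k} (hα : α.IsSmooth ∧ α.IsClosed) : (c • α).IsSmooth ∧ (c • α).IsClosed := by
  have h (x₀ : M) : (c • α).inChart x₀ = c • α.inChart x₀ := rfl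
  refine ⟨fun x₀ => ?_, fun x₀ y hy => ?_⟩
  · rw [h]
    exact (hα.1 x₀).const_smul c
  · have h' := hα.2 x₀ y hy
    simp only [extDeriv] at h' ⊢
    rw [h, fderiv_const_smul (hα.1.differentiableAt hy),
      ContinuousAlternatingMap.alternatizeUncurryFin_smul, h', smul_zero]

variable (E M)

/-- The space `Z¹(M)` of smooth closed real `1`-forms. -/
def closedOneForms : Submodule ℝ (Form E M ℝ 1) where
  carrier := {α | α.IsSmooth ∧ α.IsClosed}
  zero_mem' := Form.zero_mem
  add_mem' := Form.add_mem
  smul_mem' := Form.smul_mem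

/-- The space `B¹(M)` of differentials of smooth real functions. -/
def exactOneForms : Submodule ℝ (Form E M ℝ 1) where
  carrier := {α | ∃ f : M → ℝ, ContMDiff 𝓘(ℝ, E) 𝓘(ℝ, ℝ) ∞ f ∧ differential f = α}
  zero_mem' := ⟨fun _ => 0, contMDiff_const, by
    funext x; simp [differential, oneForm, mfderiv_const]; rfl⟩
  add_mem' := by
    rintro _ _ ⟨f, hf, rfl⟩ ⟨g, hg, rfl⟩
    refine ⟨f + g, hf.add hg, ?_⟩
    funext x
    simp only [differential, oneForm, Pi.add_apply]
    rw [mfderiv_add (hf.mdifferentiable (by simp) x) (hg.mdifferentiable (by simp) x)]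
    rfl
  smul_mem' := by
    rintro c _ ⟨f, hf, rfl⟩
    refine ⟨c • f, (contDiff_const_smul c).comp_contMDiff hf, ?_⟩
    funext x
    simp only [differential, oneForm, Pi.smul_apply]
    rw [const_smul_mfderiv (hf.mdifferentiable (by simp) x)]
    rfl

/-- The first de Rham cohomology `H¹(M; ℝ)`. -/
abbrev DeRhamH1 : Type _ := closedOneForms E M ⧸ (exactOneForms E M).submoduleOf (closedOneForms E M)

end Manifold

/-! ## Symplectic forms, complex vector fields, Poisson bracket -/

section Symplectic

variable (E : Type*) [NormedAddCommGroup E] [NormedSpace ℝ E]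
  (M : Type*) [TopologicalSpace M] [ChartedSpace E M]

variable {E} in
/-- The linear map `v ↦ α(v, ·)` of an alternating bilinear form `α`. -/
def interior (α : E [⋀^Fin 2]→L[ℝ] ℝ) : E →ₗ[ℝ] (E →L[ℝ] ℝ) where
  toFun v := (ContinuousAlternatingMap.ofSubsingleton ℝ E ℝ (0 : Fin 1)).symm (α.curryLeft v)
  map_add' v w := by rw [map_add]; rfl
  map_smul' c v := by rw [map_smul]; rfl

/-- A symplectic form on `M`: a smooth, closed, nondegenerate real `2`-form. -/
structure SymplecticForm where
  toForm : Form E M ℝ 2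
  smooth : toForm.IsSmooth
  closed : toForm.IsClosed
  nondegenerate : ∀ (x : M) (v : TangentSpace 𝓘(ℝ, E) x),
    (∀ w : TangentSpace 𝓘(ℝ, E) x, toForm x ![v, w] = 0) → v = 0

/-- Complex tangent vectors at `x`: the complexification of the tangent space. -/
abbrev ComplexTangent {M : Type*} [TopologicalSpace M] [ChartedSpace E M] (x : M) : Type _ :=
  ℂ ⊗[ℝ] TangentSpace 𝓘(ℝ, E) x

variable {E M}

/-- The derivative `Y(f)` of a complex valued function along a complex tangent vector `Y` at `x`,
that is, the complex linear extension of `df` evaluated at `Y`. -/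
def ComplexTangent.deriv {x : M} (Y : ComplexTangent E x) (f : M → ℂ) : ℂ :=
  let df : TangentSpace 𝓘(ℝ, E) x →L[ℝ] ℂ := mfderiv 𝓘(ℝ, E) 𝓘(ℝ, ℂ) f x
  df.toLinearMap.liftBaseChange ℂ Y

namespace SymplecticForm

variable (Ω : SymplecticForm E M)

/-- The map `v ↦ Ω(v, ·)` from tangent vectors to cotangent vectors. -/
def flat (x : M) : TangentSpace 𝓘(ℝ, E) x →ₗ[ℝ] (TangentSpace 𝓘(ℝ, E) x →L[ℝ] ℝ) :=
  interior (E := E) (Ω.toForm x)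

theorem flat_apply (x : M) (v w : TangentSpace 𝓘(ℝ, E) x) :
    Ω.flat x v w = Ω.toForm x ![v, w] := by
  change Ω.toForm x _ = _
  congr 1
  funext i
  fin_cases i <;> rfl

theorem flat_injective (x : M) : Function.Injective (Ω.flat x) := by
  rw [← LinearMap.ker_eq_bot, LinearMap.ker_eq_bot']
  intro v hv
  refine Ω.nondegenerate x v fun w => ?_
  rw [← Ω.flat_apply, hv]
  rfl

/-- The complex linear extension of `v ↦ Ω(v, ·)`. -/
def flatComplex (x : M) : ComplexTangent E x →ₗ[ℂ] (TangentSpace 𝓘(ℝ, E) x →L[ℝ] ℂ) :=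
  LinearMap.liftBaseChange ℂ
    ({ toFun := fun v => Complex.ofRealCLM.comp (Ω.flat x v)
       map_add' := fun v w => by rw [map_add]; exact ContinuousLinearMap.comp_add _ _ _
       map_smul' := fun c v => by rw [map_smul]; exact ContinuousLinearMap.comp_smul _ _ _ } :
      TangentSpace 𝓘(ℝ, E) x →ₗ[ℝ] (TangentSpace 𝓘(ℝ, E) x →L[ℝ] ℂ))

/-- The contraction `ι_Y Ω` of `Ω` with a complex vector field. -/
def contract (Y : (x : M) → ComplexTangent E x) : Form E M ℂ 1 :=
  oneForm fun x => Ω.flatComplex x (Y x)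

/-- Smooth complex symplectic vector fields: smooth vector fields `Y` (they map smooth functions to
smooth functions) such that `ι_Y Ω` is a closed `1`-form. -/
def symplecticFields : Submodule ℂ ((x : M) → ComplexTangent E x) where
  carrier := {Y | (∀ f ∈ SmoothFn E M, (fun x => (Y x).deriv f) ∈ SmoothFn E M) ∧
    (Ω.contract Y).IsSmooth ∧ (Ω.contract Y).IsClosed}
  zero_mem' := by
    have h : Ω.contract 0 = 0 := by
      funext x
      simp only [contract, oneForm, Pi.zero_apply, map_zero]
      rfl
    rw [Set.mem_ofPred_eq, h]
    refine ⟨fun f _ => ?_, Form.zero_mem⟩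
    convert (SmoothFn E M).zero_mem using 1
    funext x
    simp [ComplexTangent.deriv]
  add_mem' {Y Z} hY hZ := by
    have h : Ω.contract (Y + Z) = Ω.contract Y + Ω.contract Z := by
      funext x
      simp only [contract, oneForm, Pi.add_apply, map_add]
      rfl
    rw [Set.mem_ofPred_eq, h]
    refine ⟨fun f hf => ?_, Form.add_mem hY.2 hZ.2⟩
    convert (SmoothFn E M).add_mem (hY.1 f hf) (hZ.1 f hf) using 1
    funext x
    simp [ComplexTangent.deriv]
  smul_mem' c Y hY := by
    have h : Ω.contract (c • Y) = c • Ω.contract Y := by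
      funext x
      simp only [contract, oneForm, Pi.smul_apply, map_smul]
      rfl
    rw [Set.mem_ofPred_eq, h]
    refine ⟨fun f hf => ?_, Form.smul_mem c hY.2⟩
    convert (SmoothFn E M).smul_mem (hY.1 f hf) c using 1
    funext x
    simp [ComplexTangent.deriv]

variable [FiniteDimensional ℝ E]

/-- The isomorphism `v ↦ Ω(v, ·)` between tangent and cotangent vectors. -/
def flatEquiv (x : M) : TangentSpace 𝓘(ℝ, E) x ≃ₗ[ℝ] (TangentSpace 𝓘(ℝ, E) x →L[ℝ] ℝ) :=
  LinearEquiv.ofBijective (Ω.flat x) <| by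
    have e : E ≃ₗ[ℝ] (E →L[ℝ] ℝ) := LinearEquiv.ofFinrankEq _ _ <| by
      rw [← (LinearMap.toContinuousLinearMap (𝕜 := ℝ) (E := E) (F' := ℝ)).finrank_eq]
      exact Subspace.dual_finrank_eq.symm
    have h : Function.Injective (interior (E := E) (Ω.toForm x)) := Ω.flat_injective x
    exact (LinearMap.linearEquivOfInjective _ h e.finrank_eq).bijective

/-- The Hamiltonian vector field `X_f` of a complex valued function, determined by
`ι_{X_f} Ω = df`. -/
def hamiltonianField (f : M → ℂ) (x : M) : ComplexTangent E x :=
  let df : TangentSpace 𝓘(ℝ, E) x →L[ℝ] ℂ := mfderiv 𝓘(ℝ, E) 𝓘(ℝ, ℂ) f x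
  (1 : ℂ) ⊗ₜ[ℝ] (Ω.flatEquiv x).symm (Complex.reCLM.comp df) +
    Complex.I ⊗ₜ[ℝ] (Ω.flatEquiv x).symm (Complex.imCLM.comp df)

theorem flatComplex_hamiltonianField (f : M → ℂ) (x : M) :
    Ω.flatComplex x (Ω.hamiltonianField f x) = mfderiv 𝓘(ℝ, E) 𝓘(ℝ, ℂ) f x := by
  have h (α : TangentSpace 𝓘(ℝ, E) x →L[ℝ] ℝ) : Ω.flat x ((Ω.flatEquiv x).symm α) = α :=
    (Ω.flatEquiv x).apply_symm_apply α
  simp only [hamiltonianField, flatComplex, map_add, LinearMap.liftBaseChange_tmul,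
    LinearMap.coe_mk, AddHom.coe_mk, h, one_smul]
  apply ContinuousLinearMap.ext
  intro v
  exact (congrArg _ (mul_comm _ _)).trans (Complex.re_add_im _)

/-- The Poisson bracket `{f, g} = X_f(g)`. -/
def poisson (f g : M → ℂ) (x : M) : ℂ := (Ω.hamiltonianField f x).deriv g

end SymplecticForm

end Symplectic

/-! ## Formal functions, formal differential operators, star products -/

section Star

variable (E : Type*) [NormedAddCommGroup E] [NormedSpace ℝ E]
  (M : Type*) [TopologicalSpace M] [ChartedSpace E M]

/-- Formal functions: the `ℂ⟦h⟧`-algebra `C^∞(M)⟦h⟧`. The formal parameter `h` is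
`PowerSeries.X`. -/
abbrev FormalFn : Type _ := (SmoothFn E M)⟦X⟧

instance : IsScalarTower ℂ ℂ⟦X⟧ (FormalFn E M) where
  smul_assoc a p f := by
    have h : PowerSeries.map (algebraMap ℂ (SmoothFn E M)) (a • p)
        = a • PowerSeries.map (algebraMap ℂ (SmoothFn E M)) p := by
      ext n : 1
      rw [PowerSeries.coeff_map, PowerSeries.coeff_smul, PowerSeries.coeff_smul,
        PowerSeries.coeff_map, smul_eq_mul, map_mul, Algebra.smul_def]
    change PowerSeries.map (algebraMap ℂ (SmoothFn E M)) (a • p) * f =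
      a • (PowerSeries.map (algebraMap ℂ (SmoothFn E M)) p * f)
    rw [h, smul_mul_assoc]

instance : IsScalarTower ℝ ℂ⟦X⟧ (FormalFn E M) where
  smul_assoc a p f := by
    have h (q : FormalFn E M) : a • q = (a : ℂ) • q := by
      ext n x
      rw [PowerSeries.coeff_smul, PowerSeries.coeff_smul]
      exact Complex.real_smul
    have h' : a • p = (a : ℂ) • p := by
      ext n
      rw [PowerSeries.coeff_smul, PowerSeries.coeff_smul]
      exact Complex.real_smul
    rw [h, h', smul_assoc]

/-- `ℂ⟦h⟧`-linear operators on formal functions. -/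
abbrev FormalOp : Type _ := FormalFn E M →ₗ[ℂ⟦X⟧] FormalFn E M

variable {E M}

/-- The `h^k`-coefficient `B_k : C^∞(M) → C^∞(M)` of a formal operator `B = ∑ B_k h^k`. -/
def FormalOp.coeff (B : FormalOp E M) (k : ℕ) : SmoothFn E M →ₗ[ℂ] SmoothFn E M where
  toFun f := PowerSeries.coeff k (B (PowerSeries.C f))
  map_add' f g := by rw [map_add, map_add, map_add]
  map_smul' c f := by
    have h : (PowerSeries.C (c • f) : FormalFn E M) = (c • (1 : ℂ⟦X⟧)) • PowerSeries.C f := by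
      rw [smul_assoc, one_smul]
      ext n : 1
      rw [PowerSeries.coeff_smul, PowerSeries.coeff_C, PowerSeries.coeff_C]
      split_ifs <;> simp
    rw [h, map_smul, smul_assoc, one_smul, PowerSeries.coeff_smul, RingHom.id_apply]

/-- The commutator of an operator with the multiplication by `g`. -/
def commutatorMul (P : SmoothFn E M →ₗ[ℂ] SmoothFn E M) (g : SmoothFn E M) :
    SmoothFn E M →ₗ[ℂ] SmoothFn E M :=
  P ∘ₗ LinearMap.mulLeft ℂ g - LinearMap.mulLeft ℂ g ∘ₗ P

/-- `P` is a (linear) differential operator on `M` of order at most `k`: all `(k+1)`-fold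
commutators with multiplications by smooth functions vanish. -/
def IsDiffOp : ℕ → (SmoothFn E M →ₗ[ℂ] SmoothFn E M) → Prop
  | 0, P => ∀ g, commutatorMul P g = 0
  | k + 1, P => ∀ g, IsDiffOp k (commutatorMul P g)

/-- Natural formal differential operators: `B_k` is a differential operator of order at most `k`. -/
def FormalOp.IsNatural (B : FormalOp E M) : Prop := ∀ k, IsDiffOp k (B.coeff k)

/-- `B = 0` modulo `h`. -/
def FormalOp.VanishesModH (B : FormalOp E M) : Prop := ∀ f, PowerSeries.coeff 0 (B f) = 0

variable [FiniteDimensional ℝ E] (Ω : SymplecticForm E M)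

/-- Natural star products on the symplectic manifold `(M, Ω)`. -/
structure StarProduct where
  mul : FormalFn E M →ₗ[ℂ⟦X⟧] FormalFn E M →ₗ[ℂ⟦X⟧] FormalFn E M
  mul_assoc : ∀ f g k, mul (mul f g) k = mul f (mul g k)
  one_mul : ∀ f, mul 1 f = f
  mul_one : ∀ f, mul f 1 = f
  coeff_zero : ∀ f g : SmoothFn E M,
    PowerSeries.coeff 0 (mul (PowerSeries.C f) (PowerSeries.C g)) = f * g
  coeff_one : ∀ (f g : SmoothFn E M) (x : M),
    (PowerSeries.coeff 1 (mul (PowerSeries.C f) (PowerSeries.C g)) -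
      PowerSeries.coeff 1 (mul (PowerSeries.C g) (PowerSeries.C f)) : SmoothFn E M).1 x
      = Complex.I * Ω.poisson f g x
  natural : ∀ f : SmoothFn E M, FormalOp.IsNatural (mul (PowerSeries.C f)) ∧
    FormalOp.IsNatural (mul.flip (PowerSeries.C f))

variable {Ω}

/-- `Der₀(M, ⋆)`: the (`ℂ⟦h⟧`-linear) derivations of a star product that vanish modulo `h`. -/
def StarProduct.derivations (S : StarProduct Ω) : Submodule ℂ (FormalOp E M) where
  carrier := {B | (∀ f g, B (S.mul f g) = S.mul (B f) g + S.mul f (B g)) ∧ B.VanishesModH}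
  zero_mem' := ⟨fun f g => by simp, fun f => by simp⟩
  add_mem' {A B} hA hB := ⟨fun f g => by
    simp only [LinearMap.add_apply, hA.1, hB.1, map_add]
    abel, fun f => by
    rw [LinearMap.add_apply, map_add, hA.2, hB.2, add_zero]⟩
  smul_mem' c A hA := ⟨fun f g => by
    have h (p : FormalFn E M) : c • p = (c • (1 : ℂ⟦X⟧)) • p := by rw [smul_assoc, one_smul]
    simp only [LinearMap.smul_apply, hA.1, h, map_smul, smul_add], fun f => by
    rw [LinearMap.smul_apply, PowerSeries.coeff_smul, hA.2, smul_zero]⟩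

instance (S : StarProduct Ω) : AddCommGroup S.derivations :=
  @Submodule.addCommGroup ℂ (FormalOp E M) _ _ _ S.derivations

variable (Ω)

/-- `h Γ_sym(M)⟦h⟧`: formal symplectic vector fields `∑ Y_k h^k` with `Y_0 = 0`. -/
def formalSymplecticFields : Submodule ℂ (ℕ → Ω.symplecticFields) where
  carrier := {Y | Y 0 = 0}
  zero_mem' := rfl
  add_mem' {Y Z} hY hZ := by
    rw [Set.mem_ofPred_eq] at hY hZ ⊢
    rw [Pi.add_apply, hY, hZ, add_zero]
  smul_mem' c Y hY := by
    rw [Set.mem_ofPred_eq] at hY ⊢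
    rw [Pi.smul_apply, hY, smul_zero]

variable {Ω}

/-- On `U`, the formal vector field `Y` is the Hamiltonian vector field of the formal
function `b`. -/
def IsHamiltonianOn (Y : ℕ → Ω.symplecticFields) (b : FormalFn E M) (U : Set M) : Prop :=
  ∀ k, ∀ x ∈ U, (Y k).1 x = Ω.hamiltonianField (PowerSeries.coeff k b : SmoothFn E M).1 x

/-- The operator `B` corresponds to the formal symplectic vector field `Y`: wherever
`Y = X_b`, one has `B(f) = h⁻¹ (b ⋆ f - f ⋆ b)`; and locally there are such `b`. -/
def StarProduct.Corresponds (S : StarProduct Ω) (B : FormalOp E M)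
    (Y : ℕ → Ω.symplecticFields) : Prop :=
  (∀ x : M, ∃ U : Set M, IsOpen U ∧ x ∈ U ∧ ∃ b, IsHamiltonianOn Y b U) ∧
  ∀ (U : Set M) (b : FormalFn E M), IsOpen U → IsHamiltonianOn Y b U →
    ∀ (f : FormalFn E M) (k : ℕ), ∀ x ∈ U,
      (PowerSeries.coeff k (PowerSeries.X * B f) : SmoothFn E M).1 x =
        (PowerSeries.coeff k (S.mul b f - S.mul f b) : SmoothFn E M).1 x

variable (E M)

/-- Formal functions modulo constants, `C^∞(M)⟦h⟧ / ℂ⟦h⟧`. -/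
abbrev FormalFnModConst : Type _ :=
  FormalFn E M ⧸ LinearMap.range (Algebra.linearMap ℂ⟦X⟧ (FormalFn E M))

/-- The multiples of `h` among the formal functions modulo constants. -/
abbrev hFormalFnModConst : Submodule ℂ⟦X⟧ (FormalFnModConst E M) :=
  LinearMap.range (LinearMap.lsmul ℂ⟦X⟧ (FormalFnModConst E M) PowerSeries.X)

end Star

/-! ## Families of star products, formal connections, one-forms on the parameter space -/

section Connections

variable (E : Type*) [NormedAddCommGroup E] [NormedSpace ℝ E]
  (M : Type*) [TopologicalSpace M] [ChartedSpace E M]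
  (F : Type*) [NormedAddCommGroup F] [NormedSpace ℝ F]
  (T : Type*) [TopologicalSpace T] [ChartedSpace F T]

/-- Smooth sections of the trivial bundle `T × C^∞(M)⟦h⟧ → T`: families of formal functions whose
coefficients are smooth on `T × M`. -/
def Sections : Submodule ℂ (T → FormalFn E M) where
  carrier := {f | ∀ k, ContMDiff (𝓘(ℝ, F).prod 𝓘(ℝ, E)) 𝓘(ℝ, ℂ) ∞
    (fun p : T × M => (PowerSeries.coeff k (f p.1) : SmoothFn E M).1 p.2)}
  zero_mem' _ := contMDiff_const
  add_mem' hf hg k := (hf k).add (hg k)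
  smul_mem' c _ hf k := (contDiff_const_smul c).comp_contMDiff (hf k)

variable [IsManifold 𝓘(ℝ, E) ∞ M] [IsManifold 𝓘(ℝ, F) ∞ T]

/-- Smooth vector fields on `T`. -/
abbrev VectorFields : Type _ := Cₛ^∞⟮𝓘(ℝ, F); F, (TangentSpace 𝓘(ℝ, F) : T → Type _)⟯

/-- Pointwise linear `1`-forms on `T` with values in the vector spaces `N σ`, without regularity. -/
abbrev RawOneForm (N : T → Type*) [∀ σ, AddCommMonoid (N σ)] [∀ σ, Module ℝ (N σ)] : Type _ :=
  (σ : T) → TangentSpace 𝓘(ℝ, F) σ →ₗ[ℝ] N σ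

variable {E M F T}

theorem contMDiff_alongDeriv (V : VectorFields F T) {g : T × M → ℂ}
    (hg : ContMDiff (𝓘(ℝ, F).prod 𝓘(ℝ, E)) 𝓘(ℝ, ℂ) ∞ g) :
    ContMDiff (𝓘(ℝ, F).prod 𝓘(ℝ, E)) 𝓘(ℝ, ℂ) ∞
      (fun p : T × M => (mfderiv 𝓘(ℝ, F) 𝓘(ℝ, ℂ) (fun τ => g (τ, p.2)) p.1 (V p.1) : ℂ)) := by
  have hV : ContMDiff (𝓘(ℝ, F).prod 𝓘(ℝ, E)) (𝓘(ℝ, F).prod 𝓘(ℝ, E)).tangent ∞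
      (fun p : T × M => (equivTangentBundleProd 𝓘(ℝ, F) T 𝓘(ℝ, E) M).symm
        ((⟨p.1, V p.1⟩ : TangentBundle 𝓘(ℝ, F) T),
          Bundle.zeroSection E (TangentSpace 𝓘(ℝ, E) : M → Type _) p.2)) :=
    contMDiff_equivTangentBundleProd_symm.comp
      ((V.contMDiff.comp contMDiff_fst).prodMk
        ((Bundle.contMDiff_zeroSection ℝ (TangentSpace 𝓘(ℝ, E) : M → Type _)).comp contMDiff_snd))
  have h := (contMDiff_snd_tangentBundle_modelSpace ℂ 𝓘(ℝ, ℂ) (n := ∞)).comp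
    ((hg.contMDiff_tangentMap (m := ∞) (by simp)).comp hV)
  refine h.congr fun p => ?_
  have h1 : mfderiv 𝓘(ℝ, F) 𝓘(ℝ, ℂ) (fun τ => g (τ, p.2)) p.1 =
      (mfderiv (𝓘(ℝ, F).prod 𝓘(ℝ, E)) 𝓘(ℝ, ℂ) g p).comp
        (mfderiv 𝓘(ℝ, F) (𝓘(ℝ, F).prod 𝓘(ℝ, E)) (fun τ => (τ, p.2)) p.1) :=
    mfderiv_comp (I' := 𝓘(ℝ, F).prod 𝓘(ℝ, E)) p.1 (g := g) (f := fun τ => (τ, p.2))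
      (hg.mdifferentiable (by simp) _)
      (mdifferentiableAt_id.prodMk mdifferentiableAt_const)
  rw [h1, mfderiv_prod_left]
  rfl

/-- The derivative `V[f]` of a section along a vector field on `T`, coefficient by coefficient and
at each point of `M`. -/
def alongDeriv (V : VectorFields F T) (f : Sections E M F T) : Sections E M F T :=
  ⟨fun σ => PowerSeries.mk fun k =>
    ⟨fun x => mfderiv 𝓘(ℝ, F) 𝓘(ℝ, ℂ)
      (fun τ : T => (PowerSeries.coeff k (f.1 τ) : SmoothFn E M).1 x) σ (V σ),
      (contMDiff_alongDeriv V (f.2 k)).comp (contMDiff_const.prodMk contMDiff_id)⟩,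
    fun k => by
      simp only [PowerSeries.coeff_mk]
      exact contMDiff_alongDeriv V (f.2 k)⟩

/-- A `1`-form on `T` with values in formal operators is smooth if it maps smooth vector fields and
smooth sections to smooth sections. -/
def IsSmoothOperatorForm (A : RawOneForm F T fun _ => FormalOp E M) : Prop :=
  ∀ (V : VectorFields F T) (f : Sections E M F T), (fun σ => A σ (V σ) (f.1 σ)) ∈ Sections E M F T

/-- Operators `(V, f) ↦ D_V f` from vector fields and sections to sections. -/
abbrev CovariantOp (E M F T : Type*) [NormedAddCommGroup E] [NormedSpace ℝ E]
    [TopologicalSpace M] [ChartedSpace E M] [NormedAddCommGroup F] [NormedSpace ℝ F]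
    [TopologicalSpace T] [ChartedSpace F T] [IsManifold 𝓘(ℝ, F) ∞ T] : Type _ :=
  VectorFields F T → Sections E M F T → Sections E M F T

/-- The operator `(V, f) ↦ A(V)(f)` of a smooth operator valued `1`-form. -/
def IsSmoothOperatorForm.toOp {A : RawOneForm F T fun _ => FormalOp E M}
    (hA : IsSmoothOperatorForm A) : CovariantOp E M F T :=
  fun V f => ⟨fun σ => A σ (V σ) (f.1 σ), hA V f⟩

/-- Formal connections `D_V f = V[f] + A(V)(f)`, with `A` a smooth `1`-form on `T` with values in
natural formal differential operators and `A = 0` modulo `h`. -/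
def IsFormalConnection (D : CovariantOp E M F T) : Prop :=
  ∃ (A : RawOneForm F T fun _ => FormalOp E M) (hA : IsSmoothOperatorForm A),
    (∀ σ v, FormalOp.IsNatural (A σ v) ∧ FormalOp.VanishesModH (A σ v)) ∧
    ∀ V f, D V f = alongDeriv V f + hA.toOp V f

variable [FiniteDimensional ℝ E]

variable (F T) in
/-- Smooth families of natural star products on `(M, Ω)` parametrized by `T`: the product of smooth
sections is a smooth section. -/
structure StarFamily (Ω : SymplecticForm E M) where
  star : T → StarProduct Ω
  smooth : ∀ f g : Sections E M F T, (fun σ => (star σ).mul (f.1 σ) (g.1 σ)) ∈ Sections E M F T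

namespace StarFamily

variable {Ω : SymplecticForm E M} (S : StarFamily F T Ω)

/-- The product `f ⋆ g` of sections. -/
def mul (f g : Sections E M F T) : Sections E M F T := ⟨_, S.smooth f g⟩

/-- The space `ℱ(M, ⋆_σ)` of formal connections that are compatible with the family. -/
def compatibleConnections : Set (CovariantOp E M F T) :=
  {D | IsFormalConnection D ∧
    ∀ V f g, D V (S.mul f g) = S.mul (D V f) g + S.mul f (D V g)}

/-- `Ω¹(T, Der₀(M, ⋆_σ))`: smooth `1`-forms on `T` with values at `σ` in the derivations of `⋆_σ`
that vanish modulo `h`. -/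
def derivationForms : Submodule ℂ (RawOneForm F T fun σ => (S.star σ).derivations) where
  carrier := {β | IsSmoothOperatorForm fun σ => ((S.star σ).derivations.subtype.restrictScalars ℝ) ∘ₗ β σ}
  zero_mem' _ _ := (Sections E M F T).zero_mem
  add_mem' hα hβ V f := (Sections E M F T).add_mem (hα V f) (hβ V f)
  smul_mem' c _ hα V f := (Sections E M F T).smul_mem c (hα V f)

/-- The operator `(V, f) ↦ β(V)(f)` of a `1`-form with values in derivations. -/
def toOp (β : S.derivationForms) : CovariantOp E M F T :=
  IsSmoothOperatorForm.toOp β.2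

end StarFamily

variable (F T) in
/-- `Ω¹(T, h Γ_sym(M)⟦h⟧)`: smooth `1`-forms on `T` with values in the formal symplectic vector
fields that vanish modulo `h`. Smoothness means that the coefficients of `Y(V)` map smooth functions
on `M` to smooth functions on `T × M`, for every smooth vector field `V`. -/
def symplecticForms (Ω : SymplecticForm E M) :
    Submodule ℂ (RawOneForm F T fun _ => formalSymplecticFields Ω) where
  carrier := {Y | ∀ (V : VectorFields F T) (f : SmoothFn E M) (k : ℕ),
    ContMDiff (𝓘(ℝ, F).prod 𝓘(ℝ, E)) 𝓘(ℝ, ℂ) ∞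
      (fun p : T × M => (((Y p.1 (V p.1)).1 k).1 p.2).deriv f.1)}
  zero_mem' V f k := by
    convert (contMDiff_const (c := (0 : ℂ))) using 1
    funext p
    exact map_zero (LinearMap.liftBaseChange ℂ _)
  add_mem' {Y Z} hY hZ V f k := by
    convert (hY V f k).add (hZ V f k) using 1
    funext p
    exact map_add (LinearMap.liftBaseChange ℂ _) _ _
  smul_mem' c Y hY V f k := by
    convert (contDiff_const_smul c).comp_contMDiff (hY V f k) using 1
    funext p
    exact map_smul (LinearMap.liftBaseChange ℂ _) _ _

variable (E M F T) in
/-- `Ω¹(T, h C^∞(M)⟦h⟧ / ℂ⟦h⟧)`: smooth `1`-forms on `T` with values in formal functions modulo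
constants that are multiples of `h`. Smoothness means that `β(V)` lifts to a smooth section of
`T × C^∞(M)⟦h⟧` for every smooth vector field `V`. -/
def functionForms : Submodule ℂ (RawOneForm F T fun _ => hFormalFnModConst E M) where
  carrier := {β | ∀ V : VectorFields F T, ∃ g : Sections E M F T,
    ∀ σ, (β σ (V σ)).1 = Submodule.Quotient.mk (g.1 σ)}
  zero_mem' _ := ⟨0, fun _ => rfl⟩
  add_mem' {α β} hα hβ V := by
    obtain ⟨f, hf⟩ := hα V
    obtain ⟨g, hg⟩ := hβ V
    exact ⟨f + g, fun σ => congrArg₂ (· + ·) (hf σ) (hg σ)⟩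
  smul_mem' c α hα V := by
    obtain ⟨f, hf⟩ := hα V
    exact ⟨c • f, fun σ => congrArg (c • ·) (hf σ)⟩

end Connections
end FormalConnections
end

open scoped Manifold ContDiff TensorProduct PowerSeries

noncomputable section

namespace FormalConnections

/-! ## Smooth dependence of integrals on parameters -/

section ParametricIntegral

open Set MeasureTheory

variable {P : Type*} [NormedAddCommGroup P] [NormedSpace ℝ P] [FiniteDimensional ℝ P]
  {G : Type*} [NormedAddCommGroup G] [NormedSpace ℝ G]

/-! Two compatible connections share the term V[f], so their difference is a 1-form with values in
operators. Testing it on constant sections, and on vector fields through a given tangent vector,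
shows that its values are derivations of ⋆_σ that vanish modulo h. Conversely, adding such a form
keeps compatibility; the real point is that the sum is still natural, i.e. that the k-th coefficient
of every element of Der₀ has order at most k (`StarProduct.isNatural_of_mem_derivations`). This,
like the second statement, rests on the local description B = h⁻¹[b, ·].

For that description, let B be a derivation that vanishes modulo h^m. Comparing the lowest
coefficients in B(f ⋆ g) and in B([f, g]), of degree m and m + 1, shows that B_m is a derivation of
the pointwise product and of the Poisson bracket. By Hadamard's lemma B_m = iY for a complex vector
field Y. A computation in coordinates, with the Jacobi identity obtained from the associativity of
⋆, shows that ι_Yω is closed (`SymplecticForm.mem_symplecticFields_of_bracket`). By the Poincaré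
lemma Y is locally some X_b, and h⁻¹[h^m b, ·] has the leading coefficient iY too. Locally b is
unique up to constants, which are central, and ⋆ is local; hence these local operators agree on
overlaps and glue to a global derivation (`StarProduct.ev_ad_eq_of_isHamiltonianOn`,
`StarProduct.exists_corresponds`). Subtracting it and repeating produces the fields Y_m one after
the other, with h-adic convergence (`StarProduct.exists_corresponds_of_mem_derivations`). If Y_0 =
0, then b may be taken to be hd, so that locally B = [d, ·], and this operator is natural.

Smoothness in σ is carried by the radial primitive of ι_Yω, an integral that depends smoothly on
parameters (`SymplecticForm.exists_smooth_hamiltonian`). In the other direction, Y_k is read off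
from the k-th coefficient of B once the contribution of Y_0, …, Y_{k-1} is subtracted.

If M is connected and H¹(M; ℝ) = 0, symplectic fields have global Hamiltonians, unique up to
constants. Normalised to vanish at one point, they depend smoothly on σ at that point, and a clopen
argument spreads this over M (`SymplecticForm.contMDiff_hamiltonian_family`). -/

theorem hasFDerivAt_intervalIntegral_of_contDiffOn {s : Set P} {O : Set (P × ℝ)} (hs : IsOpen s)
    (hO : IsOpen O) (hsO : s ×ˢ Icc (0 : ℝ) 1 ⊆ O) {φ : P × ℝ → G} (hφ : ContDiffOn ℝ ∞ φ O)
    {p : P} (hp : p ∈ s) :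
    IntervalIntegrable (fun t => (fderiv ℝ φ (p, t)).comp (.inl ℝ P ℝ)) volume 0 1 ∧
    HasFDerivAt (fun q => ∫ t in (0 : ℝ)..1, φ (q, t))
      (∫ t in (0 : ℝ)..1, (fderiv ℝ φ (p, t)).comp (.inl ℝ P ℝ)) p := by
  -- In finite dimension the closed ball is compact, so the partial derivative is bounded on its
  -- product with [0, 1]; this bound is the dominating function.
  obtain ⟨ε, hε, hεs⟩ := Metric.nhds_basis_closedBall.mem_iff.1 (hs.mem_nhds hp)
  have hsub : Metric.closedBall p ε ×ˢ Icc (0 : ℝ) 1 ⊆ O :=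
    (prod_mono_left hεs).trans hsO
  have hc : ContinuousOn (fun z => (fderiv ℝ φ z).comp (.inl ℝ P ℝ)) O :=
    ((hφ.continuousOn_fderiv_of_isOpen hO (by simp))).clm_comp continuousOn_const
  obtain ⟨C, hC⟩ := ((isCompact_closedBall p ε).prod isCompact_Icc).exists_bound_of_continuousOn
    (hc.mono hsub)
  have hcont {q : P} (hq : q ∈ s) : ContinuousOn (fun t => φ (q, t)) (Icc 0 1) :=
    hφ.continuousOn.comp (by fun_prop) fun t ht => hsO ⟨hq, ht⟩
  have hcont' {q : P} (hq : q ∈ s) :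
      ContinuousOn (fun t => (fderiv ℝ φ (q, t)).comp (.inl ℝ P ℝ)) (Icc 0 1) :=
    hc.comp (f := fun t => (q, t)) (by fun_prop) fun t ht => hsO ⟨hq, ht⟩
  have hint {q : P} (hq : q ∈ s) : IntervalIntegrable (fun t => φ (q, t)) volume 0 1 :=
    ContinuousOn.intervalIntegrable (by rw [uIcc_of_le zero_le_one]; exact hcont hq)
  have hint' : IntervalIntegrable (fun t => (fderiv ℝ φ (p, t)).comp (.inl ℝ P ℝ)) volume 0 1 :=
    ContinuousOn.intervalIntegrable (by rw [uIcc_of_le zero_le_one]; exact hcont' hp)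
  refine ⟨hint', ?_⟩
  refine intervalIntegral.hasFDerivAt_integral_of_dominated_of_fderiv_le
    (F := fun q t => φ (q, t)) (F' := fun q t => (fderiv ℝ φ (q, t)).comp (.inl ℝ P ℝ))
    (bound := fun _ => C)
    (Metric.ball_mem_nhds p hε) ?_ (hint hp) ?_ ?_ intervalIntegrable_const ?_
  · filter_upwards [hs.mem_nhds hp] with q hq
    exact (intervalIntegrable_iff.1 (hint hq)).aestronglyMeasurable
  · exact (intervalIntegrable_iff.1 hint').aestronglyMeasurable
  · refine Filter.Eventually.of_forall fun t ht q hq => hC (q, t) ⟨Metric.ball_subset_closedBall hq, ?_⟩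
    rw [uIoc_of_le zero_le_one] at ht
    exact Ioc_subset_Icc_self ht
  · refine Filter.Eventually.of_forall fun t ht q hq => ?_
    rw [uIoc_of_le zero_le_one] at ht
    have hmem : (q, t) ∈ O := hsub ⟨Metric.ball_subset_closedBall hq, Ioc_subset_Icc_self ht⟩
    have h1 : HasFDerivAt φ (fderiv ℝ φ (q, t)) (q, t) :=
      ((hφ.contDiffAt (hO.mem_nhds hmem)).differentiableAt (by simp)).hasFDerivAt
    exact h1.comp q (hasFDerivAt_prodMk_left q t)

/-- The derivative in a direction v is the integral of the partial derivative of φ along v, an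
integral of the same type; so induction on the order, over all φ at once, suffices. The open set O
lets φ be differentiated in the ordinary sense also at t = 0 and t = 1. -/
theorem contDiffOn_intervalIntegral {s : Set P} {O : Set (P × ℝ)} (hs : IsOpen s)
    (hO : IsOpen O) (hsO : s ×ˢ Icc (0 : ℝ) 1 ⊆ O) {φ : P × ℝ → G} (hφ : ContDiffOn ℝ ∞ φ O) :
    ContDiffOn ℝ ∞ (fun q => ∫ t in (0 : ℝ)..1, φ (q, t)) s := by
  rw [contDiffOn_infty]
  intro n
  induction n generalizing φ with
  | zero =>
    refine contDiffOn_zero.2 fun p hp => ?_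
    exact (hasFDerivAt_intervalIntegral_of_contDiffOn hs hO hsO hφ hp).2.continuousAt.continuousWithinAt
  | succ n ih =>
    -- Analyticity is demanded only at order ω, which no natural number equals.
    have hn : ((n : ℕ) : WithTop ℕ∞) = ω → AnalyticOn ℝ (fun q => ∫ t in (0 : ℝ)..1, φ (q, t)) s :=
      fun h => by cases h
    refine contDiffOn_succ_of_fderiv_apply (fun p hp => ?_) hn fun v => ?_
    · exact (hasFDerivAt_intervalIntegral_of_contDiffOn hs hO hsO hφ
        hp).2.differentiableAt.differentiableWithinAt
    · have h1 : ContDiffOn ℝ ∞ (fun z => fderiv ℝ φ z (v, 0)) O :=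
        (hφ.fderiv_of_isOpen hO (m := ∞) (by simp)).clm_apply contDiffOn_const
      refine (ih h1).congr fun p hp => ?_
      have h2 := hasFDerivAt_intervalIntegral_of_contDiffOn hs hO hsO hφ hp
      rw [h2.2.hasFDerivWithinAt.fderivWithin (hs.uniqueDiffOn p hp),
        ContinuousLinearMap.intervalIntegral_apply h2.1]
      rfl

omit [FiniteDimensional ℝ P] in
/-- The increment of a function on a convex set as the integral of its derivative along a
segment. -/
theorem sub_eq_intervalIntegral_of_hasFDerivAt [CompleteSpace G] {s : Set P} (hs : Convex ℝ s)
    {g : P → G} {α : P → P →L[ℝ] G} (hα : ContinuousOn α s)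
    (hg : ∀ p ∈ s, HasFDerivAt g (α p) p) {p q : P} (hp : p ∈ s) (hq : q ∈ s) :
    g q - g p = ∫ t in (0 : ℝ)..1, α (p + t • (q - p)) (q - p) := by
  have hmem : ∀ t ∈ Icc (0 : ℝ) 1, p + t • (q - p) ∈ s := fun t ht =>
    hs.add_smul_sub_mem hp hq ht
  have hc : ContinuousOn (fun t : ℝ => α (p + t • (q - p)) (q - p)) (Icc 0 1) :=
    (hα.comp (f := fun t : ℝ => p + t • (q - p)) (by fun_prop) hmem).clm_apply continuousOn_const
  have h := intervalIntegral.integral_eq_sub_of_hasDerivAt (a := (0 : ℝ)) (b := 1)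
    (f := fun t => g (p + t • (q - p))) (f' := fun t => α (p + t • (q - p)) (q - p))
    (fun t ht => ?_) (ContinuousOn.intervalIntegrable (by rwa [uIcc_of_le zero_le_one]))
  · rw [h]; simp
  · rw [uIcc_of_le zero_le_one] at ht
    have h1 : HasDerivAt (fun t : ℝ => p + t • (q - p)) (q - p) t := by
      simpa using ((hasDerivAt_id t).smul_const (q - p)).const_add p
    exact (hg _ (hmem t ht)).comp_hasDerivAt t h1

end ParametricIntegral

/-! ## One-forms in charts -/

section Charts

variable {E : Type*} [NormedAddCommGroup E] [NormedSpace ℝ E]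
  {M : Type*} [TopologicalSpace M] [ChartedSpace E M]
  {G : Type*} [NormedAddCommGroup G] [NormedSpace ℝ G]

/-- The derivative of the inverse of the preferred chart at `x₀`. -/
def chartDeriv (x₀ : M) (y : E) :
    E →L[ℝ] TangentSpace 𝓘(ℝ, E) ((extChartAt 𝓘(ℝ, E) x₀).symm y) :=
  mfderiv 𝓘(ℝ, E) 𝓘(ℝ, E) (extChartAt 𝓘(ℝ, E) x₀).symm y

/-- A field of linear functionals on the tangent spaces, read in the preferred chart at `x₀`. -/
def localForm (α : (x : M) → TangentSpace 𝓘(ℝ, E) x →L[ℝ] G) (x₀ : M) (y : E) : E →L[ℝ] G :=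
  (α ((extChartAt 𝓘(ℝ, E) x₀).symm y)).comp (chartDeriv x₀ y)

theorem isSmooth_oneForm_iff (α : (x : M) → TangentSpace 𝓘(ℝ, E) x →L[ℝ] G) :
    (oneForm α).IsSmooth ↔
      ∀ x₀, ContDiffOn ℝ ∞ (localForm α x₀) (extChartAt 𝓘(ℝ, E) x₀).target := by
  refine forall_congr' fun x₀ => ?_
  let e : (E →L[ℝ] G) ≃L[ℝ] (E [⋀^Fin 1]→L[ℝ] G) :=
    (ContinuousAlternatingMap.ofSubsingletonLIE (𝕜 := ℝ) (E := E) (F := G)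
      (0 : Fin 1)).toContinuousLinearEquiv
  exact e.comp_contDiffOn_iff (E := E) (f := localForm α x₀)

/-- On a pair (v, w) the exterior derivative is the antisymmetrised derivative. The symmetric form
of closedness is the one that the Poincaré lemma on convex sets takes. -/
theorem isClosed_oneForm_iff {α : (x : M) → TangentSpace 𝓘(ℝ, E) x →L[ℝ] G}
    (hα : (oneForm α).IsSmooth) :
    (oneForm α).IsClosed ↔ ∀ x₀, ∀ y ∈ (extChartAt 𝓘(ℝ, E) x₀).target, ∀ v w,
      fderiv ℝ (localForm α x₀) y v w = fderiv ℝ (localForm α x₀) y w v := by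
  refine forall_congr' fun x₀ => forall₂_congr fun y hy => ?_
  have hd : DifferentiableAt ℝ (localForm α x₀) y :=
    (((isSmooth_oneForm_iff α).1 hα x₀).contDiffAt
      ((isOpen_extChartAt_target (I := 𝓘(ℝ, E)) x₀).mem_nhds hy)).differentiableAt (by simp)
  have hv (v w : E) : extDeriv ((oneForm α).inChart x₀) y ![v, w] =
      fderiv ℝ (localForm α x₀) y v w - fderiv ℝ (localForm α x₀) y w v := by
    rw [extDeriv_apply (hα.differentiableAt hy), Fin.sum_univ_two]
    have h1 (u : E) (i : Fin 2) (hu : (i.removeNth ![v, w]) = fun _ => u) :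
        (fun x => ((oneForm α).inChart x₀ x) (i.removeNth ![v, w])) =
          fun x => localForm α x₀ x u := by
      rw [hu]; rfl
    have h2 (u : E) : fderiv ℝ (fun x => localForm α x₀ x u) y =
        (fderiv ℝ (localForm α x₀) y).flip u := by
      ext z
      rw [fderiv_clm_apply hd (differentiableAt_const u)]
      simp
    rw [h1 w 0 (by ext i; fin_cases i; rfl), h1 v 1 (by ext i; fin_cases i; rfl), h2, h2]
    simp [sub_eq_add_neg]
  constructor
  · intro h v w
    rw [← sub_eq_zero, ← hv, h]
    rfl
  · intro h
    ext v
    rw [show v = ![v 0, v 1] from by ext i; fin_cases i <;> rfl, hv, h, sub_self]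
    rfl

/-- The open set of points whose image under the preferred chart at `x₀` is at distance less
than `r` from the image of `x₀`. -/
def chartBall (x₀ : M) (r : ℝ) : Set M :=
  (extChartAt 𝓘(ℝ, E) x₀).source ∩
    extChartAt 𝓘(ℝ, E) x₀ ⁻¹' Metric.ball (extChartAt 𝓘(ℝ, E) x₀ x₀) r

theorem isOpen_chartBall (x₀ : M) (r : ℝ) : IsOpen (chartBall (E := E) x₀ r) := by
  rw [chartBall, extChartAt_source]
  exact isOpen_extChartAt_preimage x₀ Metric.isOpen_ball

theorem mem_chartBall (x₀ : M) {r : ℝ} (hr : 0 < r) : x₀ ∈ chartBall (E := E) x₀ r :=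
  ⟨mem_extChartAt_source x₀, Metric.mem_ball_self hr⟩

theorem chartBall_mono (x₀ : M) {r r' : ℝ} (h : r ≤ r') :
    chartBall (E := E) x₀ r ⊆ chartBall (E := E) x₀ r' :=
  fun _ hx => ⟨hx.1, Metric.ball_subset_ball h hx.2⟩

theorem extChartAt_symm_mem_chartBall {x₀ : M} {r : ℝ} {y : E}
    (hr : Metric.ball (extChartAt 𝓘(ℝ, E) x₀ x₀) r ⊆ (extChartAt 𝓘(ℝ, E) x₀).target)
    (hy : y ∈ Metric.ball (extChartAt 𝓘(ℝ, E) x₀ x₀) r) :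
    (extChartAt 𝓘(ℝ, E) x₀).symm y ∈ chartBall (E := E) x₀ r := by
  refine ⟨(extChartAt 𝓘(ℝ, E) x₀).map_target (hr hy), ?_⟩
  rwa [Set.mem_preimage, (extChartAt 𝓘(ℝ, E) x₀).right_inv (hr hy)]

/-- Chart balls serve as small neighbourhoods because their image is convex: functions with zero
differential are constant there, and closed forms are exact. -/
theorem exists_chartBall_subset {x₀ : M} {U : Set M} (hU : U ∈ nhds x₀) :
    ∃ r > 0, Metric.ball (extChartAt 𝓘(ℝ, E) x₀ x₀) r ⊆ (extChartAt 𝓘(ℝ, E) x₀).target ∧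
      chartBall (E := E) x₀ r ⊆ U := by
  have h1 : (extChartAt 𝓘(ℝ, E) x₀).target ∩ (extChartAt 𝓘(ℝ, E) x₀).symm ⁻¹' U ∈
      nhds (extChartAt 𝓘(ℝ, E) x₀ x₀) := by
    refine Filter.inter_mem (extChartAt_target_mem_nhds x₀) ?_
    refine (continuousAt_extChartAt_symm x₀).preimage_mem_nhds ?_
    rwa [extChartAt_to_inv]
  obtain ⟨r, hr, h⟩ := Metric.mem_nhds_iff.1 h1
  refine ⟨r, hr, h.trans Set.inter_subset_left, fun x hx => ?_⟩
  have := (h hx.2).2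
  rwa [Set.mem_preimage, (extChartAt 𝓘(ℝ, E) x₀).left_inv hx.1] at this

variable [IsManifold 𝓘(ℝ, E) ∞ M]

theorem isInvertible_chartDeriv {x₀ : M} {y : E} (hy : y ∈ (extChartAt 𝓘(ℝ, E) x₀).target) :
    ∃ e : E ≃L[ℝ] TangentSpace 𝓘(ℝ, E) ((extChartAt 𝓘(ℝ, E) x₀).symm y),
      (e : E →L[ℝ] TangentSpace 𝓘(ℝ, E) ((extChartAt 𝓘(ℝ, E) x₀).symm y)) = chartDeriv x₀ y := by
  have : IsManifold 𝓘(ℝ, E) 1 M := IsManifold.of_le (n := ∞) (by simp)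
  have h := isInvertible_mfderivWithin_extChartAt_symm (I := 𝓘(ℝ, E)) hy
  rw [ModelWithCorners.range_eq_univ, mfderivWithin_univ] at h
  exact h

theorem mdifferentiableAt_extChartAt_symm {x₀ : M} {y : E}
    (hy : y ∈ (extChartAt 𝓘(ℝ, E) x₀).target) :
    MDifferentiableAt 𝓘(ℝ, E) 𝓘(ℝ, E) (extChartAt 𝓘(ℝ, E) x₀).symm y := by
  have : IsManifold 𝓘(ℝ, E) 1 M := IsManifold.of_le (n := ∞) (by simp)
  have h := mdifferentiableWithinAt_extChartAt_symm (I := 𝓘(ℝ, E)) hy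
  rwa [ModelWithCorners.range_eq_univ, mdifferentiableWithinAt_univ] at h

/-- The chain rule for the expression of a function in a chart. -/
theorem hasFDerivAt_comp_extChartAt_symm {f : M → G} {x₀ : M} {y : E}
    (hy : y ∈ (extChartAt 𝓘(ℝ, E) x₀).target)
    (hf : MDifferentiableAt 𝓘(ℝ, E) 𝓘(ℝ, G) f ((extChartAt 𝓘(ℝ, E) x₀).symm y)) :
    HasFDerivAt (f ∘ (extChartAt 𝓘(ℝ, E) x₀).symm)
      (localForm (fun x => mfderiv 𝓘(ℝ, E) 𝓘(ℝ, G) f x) x₀ y) y :=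
  (hf.hasMFDerivAt.comp y (mdifferentiableAt_extChartAt_symm hy).hasMFDerivAt).hasFDerivAt

theorem contDiffOn_comp_extChartAt_symm {f : M → G} (hf : ContMDiff 𝓘(ℝ, E) 𝓘(ℝ, G) ∞ f) (x₀ : M) :
    ContDiffOn ℝ ∞ (f ∘ (extChartAt 𝓘(ℝ, E) x₀).symm) (extChartAt 𝓘(ℝ, E) x₀).target :=
  (hf.comp_contMDiffOn (contMDiffOn_extChartAt_symm x₀)).contDiffOn

/-- A function whose derivative vanishes on a chart ball is constant there. -/
theorem eq_of_mfderiv_eq_zero_on_chartBall {f : M → G} {x₀ : M} {r : ℝ}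
    (hr : Metric.ball (extChartAt 𝓘(ℝ, E) x₀ x₀) r ⊆ (extChartAt 𝓘(ℝ, E) x₀).target)
    (hf : MDifferentiable 𝓘(ℝ, E) 𝓘(ℝ, G) f)
    (h : ∀ x ∈ chartBall (E := E) x₀ r, mfderiv 𝓘(ℝ, E) 𝓘(ℝ, G) f x = 0)
    {x x' : M} (hx : x ∈ chartBall (E := E) x₀ r) (hx' : x' ∈ chartBall (E := E) x₀ r) :
    f x = f x' := by
  have hd (y) (hy : y ∈ Metric.ball (extChartAt 𝓘(ℝ, E) x₀ x₀) r) :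
      HasFDerivAt (f ∘ (extChartAt 𝓘(ℝ, E) x₀).symm) (0 : E →L[ℝ] G) y := by
    convert hasFDerivAt_comp_extChartAt_symm (hr hy) (hf _) using 1
    simp only [localForm]
    rw [h _ (extChartAt_symm_mem_chartBall hr hy)]
    rfl
  have key := Metric.isOpen_ball.is_const_of_fderiv_eq_zero (𝕜 := ℝ)
    (convex_ball (extChartAt 𝓘(ℝ, E) x₀ x₀) r).isPreconnected
    (fun y hy => (hd y hy).differentiableAt.differentiableWithinAt)
    (fun y hy => (hd y hy).fderiv) hx.2 hx'.2
  simpa only [Function.comp_apply, (extChartAt 𝓘(ℝ, E) x₀).left_inv hx.1,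
    (extChartAt 𝓘(ℝ, E) x₀).left_inv hx'.1] using key

end Charts

/-! ## Complex tangent vectors and derivations of smooth functions -/

section ComplexTangent

variable {E : Type*} [NormedAddCommGroup E] [NormedSpace ℝ E]
  {M : Type*} [TopologicalSpace M] [ChartedSpace E M]

/-- The differential at `x` of a complex valued function. -/
def diffAt (f : M → ℂ) (x : M) : TangentSpace 𝓘(ℝ, E) x →L[ℝ] ℂ :=
  mfderiv 𝓘(ℝ, E) 𝓘(ℝ, ℂ) f x

theorem SmoothFn.mdifferentiableAt (f : SmoothFn E M) (x : M) :
    MDifferentiableAt 𝓘(ℝ, E) 𝓘(ℝ, ℂ) f.1 x :=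
  f.2.mdifferentiable (by simp) x

namespace ComplexTangent

variable {x : M}

theorem deriv_tmul (c : ℂ) (v : TangentSpace 𝓘(ℝ, E) x) (f : M → ℂ) :
    deriv (c ⊗ₜ[ℝ] v : ComplexTangent E x) f =
      c * diffAt f x v :=
  LinearMap.liftBaseChange_tmul ..

theorem deriv_add (Y Z : ComplexTangent E x) (f : M → ℂ) :
    (Y + Z).deriv f = Y.deriv f + Z.deriv f :=
  map_add (LinearMap.liftBaseChange ℂ _) Y Z

theorem deriv_zero (f : M → ℂ) : (0 : ComplexTangent E x).deriv f = 0 :=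
  map_zero (LinearMap.liftBaseChange ℂ _)

theorem deriv_smul (c : ℂ) (Y : ComplexTangent E x) (f : M → ℂ) :
    (c • Y).deriv f = c * Y.deriv f :=
  map_smul (LinearMap.liftBaseChange ℂ _) c Y

theorem deriv_sum {ι : Type*} (s : Finset ι) (Y : ι → ComplexTangent E x) (f : M → ℂ) :
    (∑ i ∈ s, Y i).deriv f = ∑ i ∈ s, (Y i).deriv f :=
  map_sum (LinearMap.liftBaseChange ℂ _) Y s

theorem deriv_mul (Y : ComplexTangent E x) (f g : SmoothFn E M) :
    Y.deriv (f * g).1 = f.1 x * Y.deriv g.1 + g.1 x * Y.deriv f.1 := by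
  induction Y using TensorProduct.induction_on with
  | zero => simp [deriv_zero]
  | add Y Z hY hZ => rw [deriv_add, deriv_add, deriv_add, hY, hZ]; ring
  | tmul c v =>
    have h := ((SmoothFn.mdifferentiableAt f x).hasMFDerivAt.mul
      (SmoothFn.mdifferentiableAt g x).hasMFDerivAt).mfderiv
    rw [deriv_tmul, deriv_tmul, deriv_tmul]
    have h2 : diffAt (f * g).1 x v =
      f.1 x * diffAt g.1 x v +
      g.1 x * diffAt f.1 x v :=
      DFunLike.congr_fun h v
    rw [h2]
    ring

/-- The real and imaginary part of a complex tangent vector. -/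
theorem exists_eq_add_I (Y : ComplexTangent E x) :
    ∃ u v : TangentSpace 𝓘(ℝ, E) x, Y = (1 : ℂ) ⊗ₜ[ℝ] u + Complex.I ⊗ₜ[ℝ] v := by
  induction Y using TensorProduct.induction_on with
  | zero => exact ⟨0, 0, by simp⟩
  | add Y Z hY hZ =>
    obtain ⟨u, v, rfl⟩ := hY
    obtain ⟨u', v', rfl⟩ := hZ
    exact ⟨u + u', v + v', by rw [TensorProduct.tmul_add, TensorProduct.tmul_add]; abel⟩
  | tmul c v =>
    refine ⟨c.re • v, c.im • v, ?_⟩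
    rw [← TensorProduct.smul_tmul, ← TensorProduct.smul_tmul, ← TensorProduct.add_tmul]
    congr 1
    simp

theorem deriv_fn_add (Y : ComplexTangent E x) (f g : SmoothFn E M) :
    Y.deriv (f + g).1 = Y.deriv f.1 + Y.deriv g.1 := by
  have h (v : TangentSpace 𝓘(ℝ, E) x) : diffAt (f + g).1 x v = diffAt f.1 x v + diffAt g.1 x v :=
    DFunLike.congr_fun ((SmoothFn.mdifferentiableAt f x).hasMFDerivAt.add
      (SmoothFn.mdifferentiableAt g x).hasMFDerivAt).mfderiv v
  obtain ⟨u, v, rfl⟩ := Y.exists_eq_add_I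
  simp only [deriv_add, deriv_tmul, h]
  ring

theorem deriv_const (Y : ComplexTangent E x) (c : ℂ) : Y.deriv (fun _ : M => c) = 0 := by
  have h (v : TangentSpace 𝓘(ℝ, E) x) : diffAt (fun _ : M => c) x v = 0 :=
    DFunLike.congr_fun (mfderiv_const (I := 𝓘(ℝ, E)) (I' := 𝓘(ℝ, ℂ)) (c := c)) v
  obtain ⟨u, v, rfl⟩ := Y.exists_eq_add_I
  simp only [deriv_add, deriv_tmul, h, mul_zero, add_zero]

theorem deriv_fn_smul (Y : ComplexTangent E x) (c : ℂ) (f : SmoothFn E M) :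
    Y.deriv (c • f).1 = c * Y.deriv f.1 := by
  rw [Algebra.smul_def, deriv_mul, show (algebraMap ℂ (SmoothFn E M) c).1 = fun _ => c from rfl,
    deriv_const, mul_zero, add_zero]

/-- The action of a complex tangent vector on smooth functions. -/
def derivLinear (Y : ComplexTangent E x) : SmoothFn E M →ₗ[ℂ] ℂ where
  toFun f := Y.deriv f.1
  map_add' := Y.deriv_fn_add
  map_smul' := Y.deriv_fn_smul

end ComplexTangent

end ComplexTangent

/-! ### Cutoff functions and globally defined local coordinates -/

section Cutoff

variable {E : Type*} [NormedAddCommGroup E] [NormedSpace ℝ E] [FiniteDimensional ℝ E]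
  {M : Type*} [TopologicalSpace M] [T2Space M] [ChartedSpace E M] [IsManifold 𝓘(ℝ, E) ∞ M]

theorem exists_cutoff {x₀ : M} {U : Set M} (hU : U ∈ nhds x₀) :
    ∃ χ : M → ℝ, ContMDiff 𝓘(ℝ, E) 𝓘(ℝ, ℝ) ∞ χ ∧ tsupport χ ⊆ U ∧
      ∃ r > 0, Metric.ball (extChartAt 𝓘(ℝ, E) x₀ x₀) r ⊆ (extChartAt 𝓘(ℝ, E) x₀).target ∧
        ∀ x ∈ chartBall (E := E) x₀ r, χ x = 1 := by
  obtain ⟨χ, -, hχ⟩ := (SmoothBumpFunction.nhds_basis_tsupport (I := 𝓘(ℝ, E)) x₀).mem_iff.1 hU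
  refine ⟨χ, χ.contMDiff, hχ, χ.rIn, χ.rIn_pos, fun y hy => ?_, fun x hx => ?_⟩
  · exact χ.closedBall_subset ⟨Metric.ball_subset_closedBall
      (Metric.ball_subset_ball χ.rIn_lt_rOut.le hy), by simp⟩
  · refine χ.one_of_dist_le ?_ (Metric.mem_ball.1 hx.2).le
    simpa using hx.1

omit [FiniteDimensional ℝ E] [T2Space M] [IsManifold 𝓘(ℝ, E) ∞ M] in
/-- Cutting off a function that is smooth over an open set. -/
theorem contMDiff_cutoff_smul {K : Type*} [NormedAddCommGroup K] [NormedSpace ℝ K]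
    {H : Type*} [TopologicalSpace H] {I : ModelWithCorners ℝ K H}
    {N : Type*} [TopologicalSpace N] [ChartedSpace H N]
    {π : N → M} (hπ : ContMDiff I 𝓘(ℝ, E) ∞ π) {χ : M → ℝ}
    (hχ : ContMDiff 𝓘(ℝ, E) 𝓘(ℝ, ℝ) ∞ χ) {U : Set M} (hχU : tsupport χ ⊆ U) {g : N → ℂ}
    (hg : ∀ p, π p ∈ U → ContMDiffAt I 𝓘(ℝ, ℂ) ∞ g p) :
    ContMDiff I 𝓘(ℝ, ℂ) ∞ (fun p => χ (π p) • g p) := by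
  intro p
  by_cases hp : π p ∈ tsupport χ
  · exact ((hχ.comp hπ) p).smul (hg p (hχU hp))
  · have h : (fun p => χ (π p) • g p) =ᶠ[nhds p] fun _ => 0 := by
      filter_upwards [hπ.continuous.continuousAt.preimage_mem_nhds
        ((isClosed_tsupport χ).isOpen_compl.mem_nhds hp)] with q hq
      rw [image_eq_zero_of_notMem_tsupport hq, zero_smul]
    exact contMDiffAt_const.congr_of_eventuallyEq h

/-- A function that is smooth near a point agrees near this point with a smooth function. -/
theorem exists_smoothFn_eventuallyEq {x₀ : M} {U : Set M} (hU : U ∈ nhds x₀) {g : M → ℂ}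
    (hg : ∀ x ∈ U, ContMDiffAt 𝓘(ℝ, E) 𝓘(ℝ, ℂ) ∞ g x) :
    ∃ f : SmoothFn E M, f.1 =ᶠ[nhds x₀] g := by
  obtain ⟨χ, hχ, hχU, r, hr, -, h1⟩ := exists_cutoff (E := E) hU
  refine ⟨⟨fun x => χ x • g x, contMDiff_cutoff_smul contMDiff_id hχ hχU hg⟩, ?_⟩
  filter_upwards [(isOpen_chartBall (E := E) x₀ r).mem_nhds (mem_chartBall x₀ hr)] with x hx
  simp [h1 x hx]

/-- Smooth functions `κ i` on `M` whose expressions in the preferred chart at `x₀` are, over `V`,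
the coordinates with respect to a basis of `E`. -/
structure IsCoordinateSystem (x₀ : M) (V : Set E) (κ : Fin (Module.finrank ℝ E) → SmoothFn E M) :
    Prop where
  isOpen : IsOpen V
  subset : V ⊆ (extChartAt 𝓘(ℝ, E) x₀).target
  apply : ∀ i, ∀ y ∈ V,
    (κ i).1 ((extChartAt 𝓘(ℝ, E) x₀).symm y) = ((Module.finBasis ℝ E).coord i y : ℝ)

/-- Derivations act on global functions only, so the coordinates of the chart at x₀ are multiplied
by a cutoff around the point with coordinates y₁. V consists of the points where the cutoff is known
to be 1. -/
theorem exists_isCoordinateSystem {x₀ : M} {y₁ : E} (hy₁ : y₁ ∈ (extChartAt 𝓘(ℝ, E) x₀).target) :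
    ∃ V κ, IsCoordinateSystem x₀ V κ ∧ y₁ ∈ V := by
  obtain ⟨χ, hχ, hχU, r, hr, hrt, h1⟩ := exists_cutoff (E := E)
    ((isOpen_extChartAt_source (I := 𝓘(ℝ, E)) x₀).mem_nhds
      ((extChartAt 𝓘(ℝ, E) x₀).map_target hy₁))
  have hs (i : Fin (Module.finrank ℝ E)) (x) (hx : x ∈ (extChartAt 𝓘(ℝ, E) x₀).source) :
      ContMDiffAt 𝓘(ℝ, E) 𝓘(ℝ, ℂ) ∞
        (fun x => (((Module.finBasis ℝ E).coord i (extChartAt 𝓘(ℝ, E) x₀ x) : ℝ) : ℂ)) x := by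
    have h : ContDiff ℝ ∞ (fun y => (((Module.finBasis ℝ E).coord i y : ℝ) : ℂ)) :=
      (Complex.ofRealCLM.comp
        (LinearMap.toContinuousLinearMap ((Module.finBasis ℝ E).coord i))).contDiff
    exact h.contMDiff.contMDiffAt.comp x (contMDiffAt_extChartAt' (by simpa using hx))
  refine ⟨(extChartAt 𝓘(ℝ, E) x₀).target ∩ (extChartAt 𝓘(ℝ, E) x₀).symm ⁻¹' chartBall (E := E) _ r,
    fun i => ⟨_, contMDiff_cutoff_smul contMDiff_id hχ hχU (hs i)⟩,
    ⟨?_, Set.inter_subset_left, fun i y hy => ?_⟩, hy₁, mem_chartBall _ hr⟩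
  · exact (continuousOn_extChartAt_symm x₀).isOpen_inter_preimage
      (isOpen_extChartAt_target x₀) (isOpen_chartBall _ r)
  · simp only [id]
    rw [h1 _ hy.2, one_smul, (extChartAt 𝓘(ℝ, E) x₀).right_inv hy.1]

namespace IsCoordinateSystem

variable {x₀ : M} {V : Set E} {κ : Fin (Module.finrank ℝ E) → SmoothFn E M}

omit [T2Space M]

theorem diffAt_chartDeriv (h : IsCoordinateSystem x₀ V κ) {y : E} (hy : y ∈ V)
    (i : Fin (Module.finrank ℝ E)) (v : E) :
    diffAt (κ i).1 ((extChartAt 𝓘(ℝ, E) x₀).symm y) (chartDeriv x₀ y v) =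
      ((Module.finBasis ℝ E).coord i v : ℝ) := by
  have h2 := hasFDerivAt_comp_extChartAt_symm (h.subset hy) (SmoothFn.mdifferentiableAt (κ i) _)
  have h3 : HasFDerivAt (fun y => (((Module.finBasis ℝ E).coord i y : ℝ) : ℂ))
      (Complex.ofRealCLM.comp
        (LinearMap.toContinuousLinearMap ((Module.finBasis ℝ E).coord i))) y :=
    (Complex.ofRealCLM.comp
        (LinearMap.toContinuousLinearMap ((Module.finBasis ℝ E).coord i))).hasFDerivAt
  have h4 := (h3.congr_of_eventuallyEq ?_).unique h2
  · exact (DFunLike.congr_fun h4 v).symm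
  · filter_upwards [h.isOpen.mem_nhds hy] with z hz
    exact h.apply i z hz

/-- The derivative of the inverse chart is invertible, so the images of a basis of E form a basis of
the tangent space, and applying a vector to the κ i picks out its components. -/
theorem expand (h : IsCoordinateSystem x₀ V κ) {y : E} (hy : y ∈ V)
    (Y : ComplexTangent E ((extChartAt 𝓘(ℝ, E) x₀).symm y)) :
    Y = ∑ i, Y.deriv (κ i).1 • ((1 : ℂ) ⊗ₜ[ℝ] chartDeriv x₀ y (Module.finBasis ℝ E i)) := by
  induction Y using TensorProduct.induction_on with
  | zero =>
    exact (Finset.sum_eq_zero fun i _ =>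
      (congrArg (· • _) (ComplexTangent.deriv_zero _)).trans (zero_smul ℂ _)).symm
  | add Y Z hY hZ =>
    simp only [ComplexTangent.deriv_add, add_smul, Finset.sum_add_distrib]
    rw [← hY, ← hZ]
  | tmul c v =>
    obtain ⟨e, he⟩ := isInvertible_chartDeriv (h.subset hy)
    obtain ⟨w, rfl⟩ := e.surjective v
    have he' : e w = chartDeriv x₀ y w := by rw [← he]; rfl
    have hw : chartDeriv x₀ y w =
        ∑ i, (Module.finBasis ℝ E).coord i w • chartDeriv x₀ y (Module.finBasis ℝ E i) := by
      conv_lhs => rw [← (Module.finBasis ℝ E).sum_repr w]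
      rw [map_sum]
      exact Finset.sum_congr rfl fun i _ => (chartDeriv x₀ y).map_smul _ _
    simp only [ComplexTangent.deriv_tmul, he', h.diffAt_chartDeriv hy]
    conv_lhs => rw [hw]
    rw [TensorProduct.tmul_sum]
    refine Finset.sum_congr rfl fun i _ => ?_
    refine (TensorProduct.smul_tmul _ c _).symm.trans ?_
    rw [TensorProduct.smul_tmul']
    congr 1
    simp [mul_comm]

end IsCoordinateSystem

end Cutoff

/-! ### Hadamard's lemma and derivations at a point -/

section Hadamard

variable {E : Type*} [NormedAddCommGroup E] [NormedSpace ℝ E] [FiniteDimensional ℝ E]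
  {M : Type*} [TopologicalSpace M] [T2Space M] [ChartedSpace E M] [IsManifold 𝓘(ℝ, E) ∞ M]

/-- Complex tangent vectors are determined by their action on smooth functions. -/
theorem ComplexTangent.ext_deriv {x : M} {Y Z : ComplexTangent E x}
    (h : ∀ f : SmoothFn E M, Y.deriv f.1 = Z.deriv f.1) : Y = Z := by
  obtain ⟨V, κ, hκ, hV⟩ := exists_isCoordinateSystem (mem_extChartAt_target (I := 𝓘(ℝ, E)) x)
  have h4 := hκ.expand hV
  rw [extChartAt_to_inv] at h4
  rw [h4 Y, h4 Z]
  simp only [h]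

/-- Hadamard's lemma. -/
theorem exists_hadamard_expansion (f : SmoothFn E M) (x₀ : M) :
    ∃ g : Fin (Module.finrank ℝ E) → SmoothFn E M, ∀ᶠ x in nhds x₀,
      f.1 x = f.1 x₀ + ∑ i, (((Module.finBasis ℝ E).coord i (extChartAt 𝓘(ℝ, E) x₀ x) : ℝ) -
        ((Module.finBasis ℝ E).coord i (extChartAt 𝓘(ℝ, E) x₀ x₀) : ℝ)) * (g i).1 x := by
  obtain ⟨r, hr, hrt, hrU⟩ := exists_chartBall_subset (E := E) (Filter.univ_mem (f := nhds x₀))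
  set y₀ := extChartAt 𝓘(ℝ, E) x₀ x₀ with hy₀
  set F := f.1 ∘ (extChartAt 𝓘(ℝ, E) x₀).symm with hF
  have hFs : ContDiffOn ℝ ∞ F (Metric.ball y₀ r) :=
    (contDiffOn_comp_extChartAt_symm f.2 x₀).mono hrt
  have hdF : ContDiffOn ℝ ∞ (fderiv ℝ F) (Metric.ball y₀ r) :=
    hFs.fderiv_of_isOpen Metric.isOpen_ball (by simp)
  -- The pairs (y, t) for which the point at time t on the line from y₀ towards y lies in the ball.
  let O : Set (E × ℝ) := (fun p : E × ℝ => y₀ + p.2 • (p.1 - y₀)) ⁻¹' Metric.ball y₀ r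
  have hO : IsOpen O := Metric.isOpen_ball.preimage (by fun_prop)
  have hsO : Metric.ball y₀ r ×ˢ Set.Icc (0 : ℝ) 1 ⊆ O := fun p hp =>
    (convex_ball y₀ r).add_smul_sub_mem (Metric.mem_ball_self hr) hp.1 hp.2
  have hφ (v : E) : ContDiffOn ℝ ∞ (fun p : E × ℝ => fderiv ℝ F (y₀ + p.2 • (p.1 - y₀)) v) O :=
    (hdF.comp (g := fderiv ℝ F) (f := fun p : E × ℝ => y₀ + p.2 • (p.1 - y₀)) (by fun_prop)
      (fun p hp => hp)).clm_apply contDiffOn_const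
  let G (i : Fin (Module.finrank ℝ E)) (y : E) : ℂ :=
    ∫ t in (0 : ℝ)..1, fderiv ℝ F (y₀ + t • (y - y₀)) (Module.finBasis ℝ E i)
  have hG (i) : ContDiffOn ℝ ∞ (G i) (Metric.ball y₀ r) :=
    contDiffOn_intervalIntegral Metric.isOpen_ball hO hsO (hφ (Module.finBasis ℝ E i))
  -- The integrals are controlled only over the ball. They are replaced by global smooth functions
  -- with the same germ at x₀, and so the expansion is claimed only near x₀.
  have hext (i) : ∃ g : SmoothFn E M, g.1 =ᶠ[nhds x₀] fun x => G i (extChartAt 𝓘(ℝ, E) x₀ x) := by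
    refine exists_smoothFn_eventuallyEq
      ((isOpen_chartBall (E := E) x₀ r).mem_nhds (mem_chartBall x₀ hr)) fun x hx => ?_
    have h := ((hG i).contDiffAt (Metric.isOpen_ball.mem_nhds hx.2)).contMDiffAt
    exact h.comp x (contMDiffAt_extChartAt' (by simpa using hx.1))
  choose g hg using hext
  refine ⟨g, ?_⟩
  filter_upwards [(isOpen_chartBall (E := E) x₀ r).mem_nhds (mem_chartBall x₀ hr),
    Filter.eventually_all.2 hg] with x hx hgx
  have h1 := sub_eq_intervalIntegral_of_hasFDerivAt (convex_ball y₀ r) hdF.continuousOn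
    (fun p hp => ((hFs.contDiffAt (Metric.isOpen_ball.mem_nhds hp)).differentiableAt
      (by simp)).hasFDerivAt) (Metric.mem_ball_self hr) hx.2
  have h2 : F (extChartAt 𝓘(ℝ, E) x₀ x) = f.1 x := by
    simp only [hF, Function.comp_apply, (extChartAt 𝓘(ℝ, E) x₀).left_inv hx.1]
  have h3 : F y₀ = f.1 x₀ := by
    simp only [hF, hy₀, Function.comp_apply, extChartAt_to_inv]
  rw [h2, h3, sub_eq_iff_eq_add'] at h1
  rw [h1]
  congr 1
  set w := extChartAt 𝓘(ℝ, E) x₀ x - y₀ with hw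
  have h4 (t : ℝ) : fderiv ℝ F (y₀ + t • w) w =
      ∑ i, (((Module.finBasis ℝ E).coord i w : ℝ) : ℂ) *
        fderiv ℝ F (y₀ + t • w) (Module.finBasis ℝ E i) := by
    generalize fderiv ℝ F (y₀ + t • w) = L
    conv_lhs => rw [← (Module.finBasis ℝ E).sum_repr w]
    rw [map_sum]
    simp
  simp only [h4]
  rw [intervalIntegral.integral_finsetSum]
  · refine Finset.sum_congr rfl fun i _ => ?_
    rw [intervalIntegral.integral_const_mul, hgx i, hw, map_sub]
    push_cast
    rfl
  · intro i _
    refine ContinuousOn.intervalIntegrable ?_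
    rw [Set.uIcc_of_le zero_le_one]
    refine continuousOn_const.mul ?_
    exact (hφ (Module.finBasis ℝ E i)).continuousOn.comp
      (f := fun t : ℝ => (extChartAt 𝓘(ℝ, E) x₀ x, t)) (by fun_prop) fun t ht => hsO ⟨hx.2, ht⟩

/-- A derivation at a point kills functions that vanish near the point. -/
theorem pointDerivation_eq_zero {x₀ : M} {D : SmoothFn E M →ₗ[ℂ] ℂ}
    (hD : ∀ f g, D (f * g) = f.1 x₀ * D g + g.1 x₀ * D f) {f : SmoothFn E M}
    (hf : f.1 =ᶠ[nhds x₀] 0) : D f = 0 := by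
  obtain ⟨χ, hχ, hχU, r, hr, -, h1⟩ := exists_cutoff (E := E) hf
  let φ : SmoothFn E M := ⟨fun x => (χ x : ℂ),
    Complex.ofRealCLM.contDiff.comp_contMDiff hχ⟩
  -- φ is supported where f vanishes and φ(x₀) = 1, so the Leibniz rule for φ f = 0 reduces to D f =
  -- 0.
  have h2 : φ * f = 0 := by
    ext x
    by_cases hx : x ∈ tsupport χ
    · have : f.1 x = 0 := hχU hx
      simp [this]
    · simp [φ, image_eq_zero_of_notMem_tsupport hx]
  have h3 := hD φ f
  rw [h2, map_zero, hf.self_of_nhds] at h3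
  simpa [φ, h1 x₀ (mem_chartBall x₀ hr)] using h3.symm

/-- Derivations at a point are complex tangent vectors. -/
theorem exists_complexTangent_of_pointDerivation {x₀ : M} {D : SmoothFn E M →ₗ[ℂ] ℂ}
    (hD : ∀ f g, D (f * g) = f.1 x₀ * D g + g.1 x₀ * D f) :
    ∃ Y : ComplexTangent E x₀, ∀ f : SmoothFn E M, Y.deriv f.1 = D f := by
  obtain ⟨V, κ, hκV, hV⟩ := exists_isCoordinateSystem (mem_extChartAt_target (I := 𝓘(ℝ, E)) x₀)
  have hv : ∀ j, ∃ v : TangentSpace 𝓘(ℝ, E) x₀, ∀ i, diffAt (κ i).1 x₀ v =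
      ((Module.finBasis ℝ E).coord i (Module.finBasis ℝ E j) : ℝ) := by
    intro j
    -- The chart vectors live over the image of x₀ under the chart and its inverse, which equals x₀
    -- only propositionally; stated as an existence claim, the fact can be transported by rewriting.
    have h2' : ∃ v : TangentSpace 𝓘(ℝ, E)
        ((extChartAt 𝓘(ℝ, E) x₀).symm (extChartAt 𝓘(ℝ, E) x₀ x₀)), ∀ i, diffAt (κ i).1 _ v =
        ((Module.finBasis ℝ E).coord i (Module.finBasis ℝ E j) : ℝ) :=
      ⟨_, fun i => hκV.diffAt_chartDeriv hV i _⟩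
    rwa [extChartAt_to_inv] at h2'
  choose v hv using hv
  let Y : ComplexTangent E x₀ := ∑ j, D (κ j) • ((1 : ℂ) ⊗ₜ[ℝ] v j)
  have hY (i) : Y.deriv (κ i).1 = D (κ i) := by
    simp only [Y, ComplexTangent.deriv_sum, ComplexTangent.deriv_smul, ComplexTangent.deriv_tmul, hv]
    simp [Finsupp.single_apply, apply_ite Complex.ofReal]
  refine ⟨Y, fun f => ?_⟩
  -- The difference of Y and D is a derivation at x₀ that kills constants and coordinates. Near x₀,
  -- Hadamard's lemma writes f as a constant plus products of κ i - κ i(x₀) with smooth functions;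
  -- each product is killed, since its first factor vanishes at x₀ and is itself killed.
  have hleib : ∀ f g, (Y.derivLinear - D) (f * g) =
      f.1 x₀ * (Y.derivLinear - D) g + g.1 x₀ * (Y.derivLinear - D) f := by
    intro f g
    rw [LinearMap.sub_apply, LinearMap.sub_apply, LinearMap.sub_apply, hD]
    change Y.deriv (f * g).1 - _ = _ * (Y.deriv g.1 - _) + _ * (Y.deriv f.1 - _)
    rw [ComplexTangent.deriv_mul]
    ring
  generalize hD' : Y.derivLinear - D = D' at hleib
  have hκ (i) : D' (κ i) = 0 := by
    rw [← hD', LinearMap.sub_apply]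
    exact sub_eq_zero.2 (hY i)
  suffices D' f = 0 by
    rw [← hD', LinearMap.sub_apply] at this
    exact sub_eq_zero.1 this
  have h1' : D' 1 = 0 := by
    have := hleib 1 1
    simpa using this
  have hc (c : ℂ) : D' (algebraMap ℂ _ c) = 0 := by
    rw [Algebra.algebraMap_eq_smul_one, map_smul, h1', smul_zero]
  obtain ⟨g, hg⟩ := exists_hadamard_expansion f x₀
  have hz := pointDerivation_eq_zero hleib (f := f - (algebraMap ℂ _ (f.1 x₀) +
    ∑ i, (κ i - algebraMap ℂ _ ((κ i).1 x₀)) * g i)) <| by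
    filter_upwards [hg, extChartAt_source_mem_nhds (I := 𝓘(ℝ, E)) x₀,
      (continuousAt_extChartAt (I := 𝓘(ℝ, E)) x₀).preimage_mem_nhds (hκV.isOpen.mem_nhds hV)]
      with x hx hxs hxV
    have hsum : (∑ i, (κ i - algebraMap ℂ _ ((κ i).1 x₀)) * g i : SmoothFn E M).1 x =
        ∑ i, ((κ i).1 x - (κ i).1 x₀) * (g i).1 x := by
      rw [AddSubmonoidClass.coe_finsetSum, Finset.sum_apply]
      rfl
    change f.1 x - (f.1 x₀ + (∑ i, (κ i - algebraMap ℂ _ ((κ i).1 x₀)) * g i : SmoothFn E M).1 x) = 0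
    rw [hsum, hx, sub_eq_zero]
    congr 1
    refine Finset.sum_congr rfl fun i _ => ?_
    have hv1 := hκV.apply i _ hxV
    have hv2 := hκV.apply i _ hV
    rw [(extChartAt 𝓘(ℝ, E) x₀).left_inv hxs] at hv1
    rw [extChartAt_to_inv] at hv2
    rw [hv1, hv2]
  rw [map_sub, map_add, hc, map_sum, zero_add, sub_eq_zero] at hz
  rw [hz]
  refine Finset.sum_eq_zero fun i _ => ?_
  rw [hleib, map_sub, hκ, hc, sub_zero, mul_zero, add_zero]
  exact mul_eq_zero_of_left (sub_self _) _

end Hadamard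

/-! ## Symplectic forms in coordinates -/

section SymplecticCoordinates

variable {E : Type*} [NormedAddCommGroup E] [NormedSpace ℝ E]
  {M : Type*} [TopologicalSpace M] [ChartedSpace E M]

namespace SymplecticForm

variable (Ω : SymplecticForm E M)

theorem flatComplex_tmul (x : M) (c : ℂ) (v w : TangentSpace 𝓘(ℝ, E) x) :
    Ω.flatComplex x (c ⊗ₜ[ℝ] v : ComplexTangent E x) w = c * (Ω.flat x v w : ℝ) := by
  have h : Ω.flatComplex x (c ⊗ₜ[ℝ] v : ComplexTangent E x) =
    c • Complex.ofRealCLM.comp (Ω.flat x v) := LinearMap.liftBaseChange_tmul ..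
  rw [h]
  rfl

/-- Evaluated on real tangent vectors, the real and imaginary parts of ι_Yω are the contractions
with the real and imaginary parts of Y. -/
theorem flatComplex_injective (x : M) : Function.Injective (Ω.flatComplex x) := by
  rw [← LinearMap.ker_eq_bot, LinearMap.ker_eq_bot']
  intro Y hY
  obtain ⟨u, v, rfl⟩ := Y.exists_eq_add_I
  have h (w : TangentSpace 𝓘(ℝ, E) x) :
      (Ω.flat x u w : ℂ) + Complex.I * (Ω.flat x v w : ℝ) = 0 := by
    have h1 := DFunLike.congr_fun hY w
    rw [map_add] at h1
    have h2 : Ω.flatComplex x ((1 : ℂ) ⊗ₜ[ℝ] u : ComplexTangent E x) w +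
      Ω.flatComplex x (Complex.I ⊗ₜ[ℝ] v : ComplexTangent E x) w = 0 := h1
    rwa [flatComplex_tmul, flatComplex_tmul, one_mul] at h2
  have hu : u = 0 := Ω.flat_injective x <| by
    rw [map_zero]
    ext w
    simpa using congrArg Complex.re (h w)
  have hv : v = 0 := Ω.flat_injective x <| by
    rw [map_zero]
    ext w
    simpa using congrArg Complex.im (h w)
  rw [hu, hv]
  simp

theorem eq_hamiltonianField_iff [FiniteDimensional ℝ E] {f : M → ℂ} {x : M}
    {Y : ComplexTangent E x} :
    Y = Ω.hamiltonianField f x ↔ Ω.flatComplex x Y = diffAt f x := by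
  rw [← (Ω.flatComplex_injective x).eq_iff, Ω.flatComplex_hamiltonianField]
  rfl

/-- The coefficients of the symplectic form in the preferred chart at `x₀`. -/
def coefficient (x₀ : M) (i j : Fin (Module.finrank ℝ E)) [FiniteDimensional ℝ E] (y : E) : ℝ :=
  Ω.toForm.inChart x₀ y ![Module.finBasis ℝ E i, Module.finBasis ℝ E j]

theorem contDiffOn_coefficient [FiniteDimensional ℝ E] (x₀ : M)
    (i j : Fin (Module.finrank ℝ E)) :
    ContDiffOn ℝ ∞ (Ω.coefficient x₀ i j) (extChartAt 𝓘(ℝ, E) x₀).target := by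
  have h := Ω.smooth x₀
  exact (ContinuousAlternatingMap.apply ℝ E ℝ
    ![Module.finBasis ℝ E i, Module.finBasis ℝ E j]).contDiff.comp_contDiffOn h

theorem coefficient_swap [FiniteDimensional ℝ E] (x₀ : M)
    (i j : Fin (Module.finrank ℝ E)) (y : E) :
    Ω.coefficient x₀ i j y = - Ω.coefficient x₀ j i y := by
  have h := (Ω.toForm.inChart x₀ y).map_swap
    ![Module.finBasis ℝ E j, Module.finBasis ℝ E i] (show (0 : Fin 2) ≠ 1 by decide)
  refine Eq.trans ?_ h
  change Ω.toForm.inChart x₀ y _ = Ω.toForm.inChart x₀ y _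
  congr 1
  ext k
  fin_cases k <;> rfl

theorem flat_chartDeriv [FiniteDimensional ℝ E] (x₀ : M)
    (i j : Fin (Module.finrank ℝ E)) (y : E) :
    Ω.flat _ (chartDeriv x₀ y (Module.finBasis ℝ E i)) (chartDeriv x₀ y (Module.finBasis ℝ E j)) =
      Ω.coefficient x₀ i j y := by
  rw [flat_apply]
  change _ = Ω.toForm _ _
  congr 1
  ext k
  fin_cases k <;> rfl

/-- The contraction of the symplectic form with a vector field, in the preferred chart at `x₀`. -/
def contractLocal (Y : (x : M) → ComplexTangent E x) (x₀ : M) : E → E →L[ℝ] ℂ :=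
  localForm (fun x => Ω.flatComplex x (Y x)) x₀

variable [FiniteDimensional ℝ E] [IsManifold 𝓘(ℝ, E) ∞ M]
  {x₀ : M} {V : Set E} {κ : Fin (Module.finrank ℝ E) → SmoothFn E M}

theorem contractLocal_basis (hκ : IsCoordinateSystem x₀ V κ) {y : E} (hy : y ∈ V)
    (Y : (x : M) → ComplexTangent E x) (j : Fin (Module.finrank ℝ E)) :
    Ω.contractLocal Y x₀ y (Module.finBasis ℝ E j) =
      ∑ i, (Y ((extChartAt 𝓘(ℝ, E) x₀).symm y)).deriv (κ i).1 * Ω.coefficient x₀ i j y := by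
  have h := hκ.expand hy (Y ((extChartAt 𝓘(ℝ, E) x₀).symm y))
  change Ω.flatComplex _ (Y _) (chartDeriv x₀ y _) = _
  conv_lhs => rw [h]
  rw [map_sum]
  refine (sum_apply ..).trans (Finset.sum_congr rfl fun i _ => ?_)
  rw [map_smul]
  refine (smul_apply ..).trans ?_
  rw [flatComplex_tmul, one_mul, flat_chartDeriv, smul_eq_mul]

theorem _root_.FormalConnections.ComplexTangent.deriv_eq_sum (hκ : IsCoordinateSystem x₀ V κ) {y : E} (hy : y ∈ V)
    (Y : ComplexTangent E ((extChartAt 𝓘(ℝ, E) x₀).symm y)) (f : SmoothFn E M) :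
    Y.deriv f.1 = ∑ i, Y.deriv (κ i).1 *
      fderiv ℝ (f.1 ∘ (extChartAt 𝓘(ℝ, E) x₀).symm) y (Module.finBasis ℝ E i) := by
  have h := hκ.expand hy Y
  conv_lhs => rw [h]
  rw [ComplexTangent.deriv_sum]
  refine Finset.sum_congr rfl fun i _ => ?_
  rw [ComplexTangent.deriv_smul, ComplexTangent.deriv_tmul, one_mul,
    (hasFDerivAt_comp_extChartAt_symm (hκ.subset hy) (SmoothFn.mdifferentiableAt f _)).fderiv]
  rfl

/-- The identity behind the closedness of `ι_Y Ω` for an infinitesimal automorphism `Y` of the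
Poisson bracket, in terms of the components `R` of the bracket, `p` of the field and `α` of the
contraction, and of their derivatives. -/
theorem _root_.FormalConnections.curl_eq_zero {ι : Type*} [Fintype ι] [DecidableEq ι]
    {R W : Matrix ι ι ℂ} {α p : ι → ℂ} {dR : ι → ι → ι → ℂ} {dα dp : ι → ι → ℂ}
    (hinv : R * W = 1) (hanti : ∀ i j, R i j = -R j i)
    (hp : ∀ i, p i = -∑ l, R i l * α l)
    (hdp : ∀ k j, dp k j = -∑ l, (dR k j l * α l + R j l * dα k l))
    (hjac : ∀ i j l, ∑ k, R i k * dR k j l - ∑ k, R j k * dR k i l = -∑ k, R l k * dR k i j)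
    (hder : ∀ i j, ∑ k, p k * dR k i j = -∑ l, R j l * dp l i + ∑ k, R i k * dp k j) (k l : ι) :
    dα k l = dα l k := by
  -- Inserting p = -Rα into `hder` gives terms in α and terms in dα. By the Jacobi identity, in the
  -- form `e3`, the terms in α cancel. What is left is R C Rᵀ = 0 with C the curl of α, and R is
  -- invertible.
  have e1 (i j) : ∑ k, p k * dR k i j = ∑ m, (∑ k, R m k * dR k i j) * α m := by
    simp only [hp, ← Finset.sum_neg_distrib, Finset.sum_mul]
    rw [Finset.sum_comm]
    refine Finset.sum_congr rfl fun m _ => Finset.sum_congr rfl fun k _ => ?_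
    rw [hanti k m]
    ring
  have e2 (i j) : ∑ k, R i k * dp k j = -∑ m, (∑ k, R i k * dR k j m) * α m -
      ∑ k, ∑ m, R i k * R j m * dα k m := by
    have : ∑ m, (∑ k, R i k * dR k j m) * α m = ∑ k, ∑ m, R i k * dR k j m * α m := by
      simp only [Finset.sum_mul]
      rw [Finset.sum_comm]
    rw [this, ← Finset.sum_neg_distrib, ← Finset.sum_sub_distrib]
    refine Finset.sum_congr rfl fun k _ => ?_
    rw [hdp, mul_neg, Finset.mul_sum, ← Finset.sum_neg_distrib, ← Finset.sum_neg_distrib,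
      ← Finset.sum_sub_distrib]
    exact Finset.sum_congr rfl fun m _ => by ring
  have e3 (i j) : ∑ m, (∑ k, R i k * dR k j m) * α m - ∑ m, (∑ k, R j k * dR k i m) * α m =
      -∑ m, (∑ k, R m k * dR k i j) * α m := by
    rw [← Finset.sum_sub_distrib, ← Finset.sum_neg_distrib]
    exact Finset.sum_congr rfl fun m _ => by rw [← sub_mul, hjac, neg_mul]
  have hC : R * Matrix.of (fun k l => dα k l - dα l k) * R.transpose = 0 := by
    ext i j
    have h1 : (R * Matrix.of (fun k l => dα k l - dα l k) * R.transpose) i j =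
        ∑ k, ∑ m, R i k * R j m * dα k m - ∑ k, ∑ m, R j k * R i m * dα k m := by
      rw [Finset.sum_comm (f := fun k m => R j k * R i m * dα k m), ← Finset.sum_sub_distrib]
      simp only [Matrix.mul_apply, Matrix.transpose_apply, Matrix.of_apply, Finset.sum_mul]
      rw [Finset.sum_comm]
      refine Finset.sum_congr rfl fun k _ => ?_
      rw [← Finset.sum_sub_distrib]
      exact Finset.sum_congr rfl fun m _ => by ring
    rw [h1, Matrix.zero_apply]
    have h2 := hder i j
    rw [e1, e2, e2] at h2
    linear_combination h2 - e3 i j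
  have hinv' : W * R = 1 := mul_eq_one_comm.1 hinv
  have hinvT : R.transpose * W.transpose = 1 := by
    rw [← Matrix.transpose_mul, hinv', Matrix.transpose_one]
  have hz : Matrix.of (fun k l => dα k l - dα l k) = 0 := by
    calc Matrix.of (fun k l => dα k l - dα l k)
        = (W * R) * Matrix.of (fun k l => dα k l - dα l k) * (R.transpose * W.transpose) := by
          rw [hinv', hinvT, Matrix.one_mul, Matrix.mul_one]
      _ = W * (R * Matrix.of (fun k l => dα k l - dα l k) * R.transpose) * W.transpose := by
          simp only [Matrix.mul_assoc]
      _ = 0 := by rw [hC, Matrix.mul_zero, Matrix.zero_mul]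
  exact sub_eq_zero.1 (congrFun (congrFun hz k) l)

omit [IsManifold 𝓘(ℝ, E) ∞ M] in
theorem contractLocal_eq_sum (Y : (x : M) → ComplexTangent E x) (y w : E) :
    Ω.contractLocal Y x₀ y w = ∑ j, ((Module.finBasis ℝ E).coord j w : ℝ) *
      Ω.contractLocal Y x₀ y (Module.finBasis ℝ E j) := by
  conv_lhs => rw [← (Module.finBasis ℝ E).sum_repr w]
  rw [map_sum]
  simp

/-- The components of the contraction are combinations of the functions Y(κ i), smooth by
hypothesis, with the smooth coefficients of the symplectic form. -/
theorem contDiffOn_contractLocal {Y : (x : M) → ComplexTangent E x}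
    (hκ : IsCoordinateSystem x₀ V κ)
    (hY : ∀ f ∈ SmoothFn E M, (fun x => (Y x).deriv f) ∈ SmoothFn E M) :
    ContDiffOn ℝ ∞ (Ω.contractLocal Y x₀) V := by
  rw [contDiffOn_clm_apply]
  intro w
  have h (i) : ContDiffOn ℝ ∞
      (fun y => (Y ((extChartAt 𝓘(ℝ, E) x₀).symm y)).deriv (κ i).1) V :=
    (contDiffOn_comp_extChartAt_symm (hY _ (κ i).2) x₀).mono hκ.subset
  have h' (i j) : ContDiffOn ℝ ∞ (fun y => (Ω.coefficient x₀ i j y : ℂ)) V :=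
    Complex.ofRealCLM.contDiff.comp_contDiffOn ((Ω.contDiffOn_coefficient x₀ i j).mono hκ.subset)
  have h'' : ContDiffOn ℝ ∞ (fun y => ∑ j, (((Module.finBasis ℝ E).coord j w : ℝ) : ℂ) *
      ∑ i, (Y ((extChartAt 𝓘(ℝ, E) x₀).symm y)).deriv (κ i).1 * Ω.coefficient x₀ i j y) V :=
    ContDiffOn.sum fun j _ => contDiffOn_const.mul (ContDiffOn.sum fun i _ => (h i).mul (h' i j))
  refine h''.congr fun y hy => ?_
  rw [contractLocal_eq_sum]
  exact Finset.sum_congr rfl fun j _ => by rw [Ω.contractLocal_basis hκ hy]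

/-- The matrix of the Poisson bracket is inverse to the matrix of the symplectic form. -/
theorem sum_poisson_mul_coefficient (hκ : IsCoordinateSystem x₀ V κ) {y : E} (hy : y ∈ V)
    (i j : Fin (Module.finrank ℝ E)) :
    ∑ k, Ω.poisson (κ i).1 (κ k).1 ((extChartAt 𝓘(ℝ, E) x₀).symm y) * Ω.coefficient x₀ k j y =
      if i = j then 1 else 0 := by
  have h := Ω.contractLocal_basis hκ hy (Ω.hamiltonianField (κ i).1) j
  have h2 : Ω.contractLocal (Ω.hamiltonianField (κ i).1) x₀ y (Module.finBasis ℝ E j) =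
      diffAt (κ i).1 ((extChartAt 𝓘(ℝ, E) x₀).symm y) (chartDeriv x₀ y (Module.finBasis ℝ E j)) :=
    DFunLike.congr_fun (Ω.flatComplex_hamiltonianField (κ i).1 _) _
  rw [h2, hκ.diffAt_chartDeriv hy] at h
  refine h.symm.trans ?_
  simp [Finsupp.single_apply, apply_ite Complex.ofReal, eq_comm]

/-- Infinitesimal automorphisms of the Poisson bracket are symplectic vector fields. -/
theorem mem_symplecticFields_of_bracket [T2Space M] {br : SmoothFn E M → SmoothFn E M → SmoothFn E M}
    (hbr : ∀ f g x, (br f g).1 x = Ω.poisson f.1 g.1 x) (hanti : ∀ f g, br f g = -br g f)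
    (hjac : ∀ f g k, br f (br g k) - br g (br f k) = -br k (br f g))
    {P : SmoothFn E M → SmoothFn E M} (hP : ∀ f g, P (br f g) = br (P f) g + br f (P g))
    {Y : (x : M) → ComplexTangent E x} (hY : ∀ f x, (Y x).deriv f.1 = (P f).1 x) :
    Y ∈ Ω.symplecticFields := by
  have hYs : ∀ f ∈ SmoothFn E M, (fun x => (Y x).deriv f) ∈ SmoothFn E M := fun f hf => by
    convert (P ⟨f, hf⟩).2 using 2 with x
    exact hY ⟨f, hf⟩ x
  have hsm : (Ω.contract Y).IsSmooth := by
    refine (isSmooth_oneForm_iff _).2 fun x₀ y hy => ?_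
    obtain ⟨V, κ, hκ, hV⟩ := exists_isCoordinateSystem hy
    exact ((Ω.contDiffOn_contractLocal hκ hYs).contDiffAt
      (hκ.isOpen.mem_nhds hV)).contDiffWithinAt
  refine ⟨hYs, hsm, (isClosed_oneForm_iff hsm).2 fun x₀ y hy => ?_⟩
  obtain ⟨V, κ, hκ, hV⟩ := exists_isCoordinateSystem hy
  set ψ := (extChartAt 𝓘(ℝ, E) x₀).symm with hψ
  set b := Module.finBasis ℝ E with hb
  -- In coordinates {κ_i, u} = ∑ {κ_i, κ_k} ∂_k u; this turns the Jacobi identity and the derivation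
  -- property into identities between first derivatives.
  have hbr' (i) (u : SmoothFn E M) {z : E} (hz : z ∈ V) : (br (κ i) u).1 (ψ z) =
      ∑ k, (br (κ i) (κ k)).1 (ψ z) * fderiv ℝ (u.1 ∘ ψ) z (b k) := by
    simp only [hbr]
    exact (Ω.hamiltonianField (κ i).1 _).deriv_eq_sum hκ hz u
  have hdiff (f : SmoothFn E M) : DifferentiableAt ℝ (f.1 ∘ ψ) y :=
    (hasFDerivAt_comp_extChartAt_symm hy (SmoothFn.mdifferentiableAt f _)).differentiableAt
  have hdα : DifferentiableAt ℝ (Ω.contractLocal Y x₀) y :=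
    ((Ω.contDiffOn_contractLocal hκ hYs).contDiffAt
      (hκ.isOpen.mem_nhds hV)).differentiableAt (by simp)
  have hinv {z : E} (hz : z ∈ V) (i j) : ∑ k, (br (κ i) (κ k)).1 (ψ z) * Ω.coefficient x₀ k j z =
      if i = j then 1 else 0 := by
    simp only [hbr]
    exact Ω.sum_poisson_mul_coefficient hκ hz i j
  -- The contraction has components α_k = ∑ p_i ω_ik. Inverting with the bracket matrix, and using
  -- that ω_ik is antisymmetric, gives p = -Rα.
  have hp {z : E} (hz : z ∈ V) (i) : (P (κ i)).1 (ψ z) =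
      -∑ l, (br (κ i) (κ l)).1 (ψ z) * Ω.contractLocal Y x₀ z (b l) := by
    have h1 : ∑ l, (br (κ i) (κ l)).1 (ψ z) * Ω.contractLocal Y x₀ z (b l) =
        ∑ k, (P (κ k)).1 (ψ z) * -∑ l, (br (κ i) (κ l)).1 (ψ z) * Ω.coefficient x₀ l k z := by
      simp only [hb, Ω.contractLocal_basis hκ hz, Finset.mul_sum, ← Finset.sum_neg_distrib]
      rw [Finset.sum_comm]
      refine Finset.sum_congr rfl fun k _ => Finset.sum_congr rfl fun l _ => ?_
      rw [hY, Ω.coefficient_swap x₀ k l]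
      push_cast
      ring
    rw [h1]
    simp only [hinv hz]
    simp
  have hbasis : ∀ k l, fderiv ℝ (Ω.contractLocal Y x₀) y (b k) (b l) =
      fderiv ℝ (Ω.contractLocal Y x₀) y (b l) (b k) := by
    refine curl_eq_zero (R := Matrix.of fun i j => (br (κ i) (κ j)).1 (ψ y))
      (W := Matrix.of fun i j => (Ω.coefficient x₀ i j y : ℂ))
      (α := fun l => Ω.contractLocal Y x₀ y (b l)) (p := fun i => (P (κ i)).1 (ψ y))
      (dR := fun k i j => fderiv ℝ ((br (κ i) (κ j)).1 ∘ ψ) y (b k))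
      (dα := fun k l => fderiv ℝ (Ω.contractLocal Y x₀) y (b k) (b l))
      (dp := fun k j => fderiv ℝ ((P (κ j)).1 ∘ ψ) y (b k)) ?_ ?_ ?_ ?_ ?_ ?_
    · ext i j
      rw [Matrix.mul_apply, Matrix.one_apply, ← hinv hV i j]
      rfl
    · intro i j
      simp only [Matrix.of_apply]
      rw [hanti]
      rfl
    · exact fun i => hp hV i
    · intro k j
      -- The relation p = -Rα holds on all of V, so it may be differentiated at y.
      have h1 : (P (κ j)).1 ∘ ψ =ᶠ[nhds y]
          fun z => -∑ l, ((br (κ j) (κ l)).1 ∘ ψ) z * Ω.contractLocal Y x₀ z (b l) := by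
        filter_upwards [hκ.isOpen.mem_nhds hV] with z hz
        exact hp hz j
      have h2 := (HasFDerivAt.fun_sum (u := Finset.univ) fun l _ =>
        (hdiff (br (κ j) (κ l))).hasFDerivAt.mul
          (hdα.hasFDerivAt.clm_apply (hasFDerivAt_const (b l) y))).neg
      rw [h1.fderiv_eq]
      refine (DFunLike.congr_fun h2.fderiv (b k)).trans ?_
      simp [sum_apply, mul_comm, add_comm]
    · intro i j l
      have h1 := congrArg (fun f : SmoothFn E M => f.1 (ψ y)) (hjac (κ i) (κ j) (κ l))
      have h2 : (br (κ i) (br (κ j) (κ l))).1 (ψ y) - (br (κ j) (br (κ i) (κ l))).1 (ψ y) =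
        -(br (κ l) (br (κ i) (κ j))).1 (ψ y) := h1
      rwa [hbr' _ _ hV, hbr' _ _ hV, hbr' _ _ hV] at h2
    · intro i j
      have h1 := congrArg (fun f : SmoothFn E M => f.1 (ψ y)) (hP (κ i) (κ j))
      rw [hanti (P (κ i))] at h1
      have h2 : (P (br (κ i) (κ j))).1 (ψ y) = -(br (κ j) (P (κ i))).1 (ψ y) +
        (br (κ i) (P (κ j))).1 (ψ y) := h1
      rw [hbr' _ _ hV, hbr' _ _ hV, ← hY, (Y _).deriv_eq_sum hκ hV] at h2
      simp only [hY] at h2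
      exact h2
  intro v w
  have hflip : fderiv ℝ (Ω.contractLocal Y x₀) y = (fderiv ℝ (Ω.contractLocal Y x₀) y).flip :=
    ContinuousLinearMap.coe_injective <| b.ext fun k =>
      ContinuousLinearMap.coe_injective <| b.ext fun l => hbasis k l
  exact DFunLike.congr_fun (DFunLike.congr_fun hflip v) w

end SymplecticForm

end SymplecticCoordinates

/-! ## Local Hamiltonians depending smoothly on parameters -/

section LocalHamiltonian

variable {E : Type*} [NormedAddCommGroup E] [NormedSpace ℝ E]
  {M : Type*} [TopologicalSpace M] [ChartedSpace E M] [IsManifold 𝓘(ℝ, E) ∞ M]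
  {F : Type*} [NormedAddCommGroup F] [NormedSpace ℝ F]
  {T : Type*} [TopologicalSpace T] [ChartedSpace F T] [IsManifold 𝓘(ℝ, F) ∞ T]

theorem eq_of_localForm_eq {G : Type*} [NormedAddCommGroup G] [NormedSpace ℝ G]
    {α β : (x : M) → TangentSpace 𝓘(ℝ, E) x →L[ℝ] G} {x₀ : M}
    {y : E} (hy : y ∈ (extChartAt 𝓘(ℝ, E) x₀).target) (h : localForm α x₀ y = localForm β x₀ y) :
    α ((extChartAt 𝓘(ℝ, E) x₀).symm y) = β ((extChartAt 𝓘(ℝ, E) x₀).symm y) := by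
  obtain ⟨e, he⟩ := isInvertible_chartDeriv hy
  simp only [localForm, ← he] at h
  ext v
  obtain ⟨w, rfl⟩ := e.surjective v
  exact DFunLike.congr_fun h w

/-- The expression in charts of a function that is smooth on a product. -/
theorem contDiffOn_comp_prod_extChartAt_symm {c : T × M → ℂ}
    (hc : ContMDiff (𝓘(ℝ, F).prod 𝓘(ℝ, E)) 𝓘(ℝ, ℂ) ∞ c) (σ₀ : T) (x₀ : M) :
    ContDiffOn ℝ ∞ (fun p : F × E => c ((extChartAt 𝓘(ℝ, F) σ₀).symm p.1,
      (extChartAt 𝓘(ℝ, E) x₀).symm p.2))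
      ((extChartAt 𝓘(ℝ, F) σ₀).target ×ˢ (extChartAt 𝓘(ℝ, E) x₀).target) := by
  refine ContMDiffOn.contDiffOn (hc.comp_contMDiffOn (ContMDiffOn.prodMk ?_ ?_))
  · exact (contMDiffOn_extChartAt_symm σ₀).comp contDiff_fst.contMDiff.contMDiffOn fun p hp => hp.1
  · exact (contMDiffOn_extChartAt_symm x₀).comp contDiff_snd.contMDiff.contMDiffOn fun p hp => hp.2

namespace SymplecticForm

variable (Ω : SymplecticForm E M) [FiniteDimensional ℝ E] [FiniteDimensional ℝ F]

/-- The radial primitive of `ι_{Y σ} Ω` around `x₀`. -/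
def radialPrimitive (Y : T → (x : M) → ComplexTangent E x) (x₀ : M) (p : T × M) : ℂ :=
  ∫ t in (0 : ℝ)..1, Ω.contractLocal (Y p.1) x₀ (extChartAt 𝓘(ℝ, E) x₀ x₀ +
    t • (extChartAt 𝓘(ℝ, E) x₀ p.2 - extChartAt 𝓘(ℝ, E) x₀ x₀))
    (extChartAt 𝓘(ℝ, E) x₀ p.2 - extChartAt 𝓘(ℝ, E) x₀ x₀)

/-- In charts on both factors the integrand is jointly smooth in the parameter, the point and t, so
smoothness is that of a parametric integral over [0, 1]. -/
theorem contMDiffAt_radialPrimitive {Y : T → (x : M) → ComplexTangent E x}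
    (hY : ∀ f : SmoothFn E M, ContMDiff (𝓘(ℝ, F).prod 𝓘(ℝ, E)) 𝓘(ℝ, ℂ) ∞
      (fun p : T × M => (Y p.1 p.2).deriv f.1))
    {x₀ : M} {V : Set E} {κ : Fin (Module.finrank ℝ E) → SmoothFn E M}
    (hκ : IsCoordinateSystem x₀ V κ) {R : ℝ}
    (hR : Metric.ball (extChartAt 𝓘(ℝ, E) x₀ x₀) R ⊆ V) {p : T × M}
    (hp : p.2 ∈ chartBall (E := E) x₀ R) :
    ContMDiffAt (𝓘(ℝ, F).prod 𝓘(ℝ, E)) 𝓘(ℝ, ℂ) ∞ (Ω.radialPrimitive Y x₀) p := by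
  obtain ⟨σ₀, x⟩ := p
  set y₀ := extChartAt 𝓘(ℝ, E) x₀ x₀ with hy₀
  let s : Set (F × E) := (extChartAt 𝓘(ℝ, F) σ₀).target ×ˢ Metric.ball y₀ R
  have hs : IsOpen s := (isOpen_extChartAt_target σ₀).prod Metric.isOpen_ball
  let seg : (F × E) × ℝ → F × E := fun q => (q.1.1, y₀ + q.2 • (q.1.2 - y₀))
  have hseg : ContDiff ℝ ∞ seg := by fun_prop
  have hO : IsOpen (seg ⁻¹' s) := hs.preimage hseg.continuous
  have hpos (y : E) (hy : y ∈ Metric.ball y₀ R) : 0 < R :=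
    dist_nonneg.trans_lt (Metric.mem_ball.1 hy)
  have hsO : s ×ˢ Set.Icc (0 : ℝ) 1 ⊆ seg ⁻¹' s := fun q hq => ⟨hq.1.1,
    (convex_ball y₀ R).add_smul_sub_mem (Metric.mem_ball_self (hpos _ hq.1.2)) hq.1.2 hq.2⟩
  -- The integrand is expanded in coordinates, since the hypothesis gives joint smoothness only for
  -- the functions Y(κ i), not for the contraction itself.
  let φ : (F × E) × ℝ → ℂ := fun q => ∑ j, (((Module.finBasis ℝ E).coord j (q.1.2 - y₀) : ℝ) : ℂ) *
    ∑ i, (Y ((extChartAt 𝓘(ℝ, F) σ₀).symm (seg q).1)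
      ((extChartAt 𝓘(ℝ, E) x₀).symm (seg q).2)).deriv (κ i).1 * Ω.coefficient x₀ i j (seg q).2
  have hφ : ContDiffOn ℝ ∞ φ (seg ⁻¹' s) := by
    refine ContDiffOn.sum fun j _ => ContDiffOn.mul ?_ (ContDiffOn.sum fun i _ => ContDiffOn.mul ?_ ?_)
    · have h : ContDiff ℝ ∞ (fun w : E => (((Module.finBasis ℝ E).coord j w : ℝ) : ℂ)) :=
        (Complex.ofRealCLM.comp
          (LinearMap.toContinuousLinearMap ((Module.finBasis ℝ E).coord j))).contDiff
      exact (h.comp (f := fun q : (F × E) × ℝ => q.1.2 - y₀) (by fun_prop)).contDiffOn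
    · exact (contDiffOn_comp_prod_extChartAt_symm (hY (κ i)) σ₀ x₀).comp hseg.contDiffOn
        fun q hq => ⟨hq.1, hκ.subset (hR hq.2)⟩
    · exact Complex.ofRealCLM.contDiff.comp_contDiffOn
        ((Ω.contDiffOn_coefficient x₀ i j).comp (f := fun q => (seg q).2)
          (contDiff_snd.comp hseg).contDiffOn fun q hq => hκ.subset (hR hq.2))
  have hG := contDiffOn_intervalIntegral hs hO hsO hφ
  have hmem : (extChartAt 𝓘(ℝ, F) σ₀ σ₀, extChartAt 𝓘(ℝ, E) x₀ x) ∈ s :=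
    ⟨mem_extChartAt_target σ₀, hp.2⟩
  have hchart : ContMDiffAt (𝓘(ℝ, F).prod 𝓘(ℝ, E)) 𝓘(ℝ, F × E) ∞
      (fun p : T × M => (extChartAt 𝓘(ℝ, F) σ₀ p.1, extChartAt 𝓘(ℝ, E) x₀ p.2)) (σ₀, x) :=
    ContMDiffAt.prodMk_space
      ((contMDiffAt_extChartAt (x := σ₀)).comp (σ₀, x) contMDiffAt_fst)
      ((contMDiffAt_extChartAt' (by simpa using hp.1)).comp (σ₀, x) contMDiffAt_snd)
  refine ((hG.contDiffAt (hs.mem_nhds hmem)).contMDiffAt.comp (σ₀, x) hchart).congr_of_eventuallyEq ?_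
  have hev : ∀ᶠ q : T × M in nhds (σ₀, x), q.1 ∈ (extChartAt 𝓘(ℝ, F) σ₀).source ∧
      q.2 ∈ chartBall (E := E) x₀ R :=
    ((isOpen_extChartAt_source σ₀).prod (isOpen_chartBall x₀ R)).mem_nhds
      ⟨mem_extChartAt_source σ₀, hp⟩
  filter_upwards [hev] with q hq
  refine intervalIntegral.integral_congr fun t ht => ?_
  rw [Set.uIcc_of_le zero_le_one] at ht
  have hq' := hsO (a := ((extChartAt 𝓘(ℝ, F) σ₀ q.1, extChartAt 𝓘(ℝ, E) x₀ q.2), t))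
    ⟨⟨(extChartAt 𝓘(ℝ, F) σ₀).map_source hq.1, hq.2.2⟩, ht⟩
  simp only [seg]
  rw [contractLocal_eq_sum, (extChartAt 𝓘(ℝ, F) σ₀).left_inv hq.1]
  exact Finset.sum_congr rfl fun j _ => by rw [Ω.contractLocal_basis hκ (hR hq'.2)]

omit [IsManifold 𝓘(ℝ, E) ∞ M] [FiniteDimensional ℝ E] [TopologicalSpace T] in
/-- Over a chart ball, the radial primitive differs by a constant from any primitive. -/
theorem exists_primitive {Y : (x : M) → ComplexTangent E x} (hY : Y ∈ Ω.symplecticFields)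
    {x₀ : M} {R : ℝ}
    (hR : Metric.ball (extChartAt 𝓘(ℝ, E) x₀ x₀) R ⊆ (extChartAt 𝓘(ℝ, E) x₀).target) :
    ∃ g : E → ℂ, (∀ y ∈ Metric.ball (extChartAt 𝓘(ℝ, E) x₀ x₀) R,
      HasFDerivAt g (Ω.contractLocal Y x₀ y) y) ∧
      ∀ (σ : T) (Z : T → (x : M) → ComplexTangent E x), Z σ = Y →
        ∀ x ∈ chartBall (E := E) x₀ R, Ω.radialPrimitive Z x₀ (σ, x) =
          g (extChartAt 𝓘(ℝ, E) x₀ x) - g (extChartAt 𝓘(ℝ, E) x₀ x₀) := by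
  have hsm := (isSmooth_oneForm_iff _).1 hY.2.1 x₀
  have hcl := (isClosed_oneForm_iff hY.2.1).1 hY.2.2 x₀
  obtain ⟨g, hg⟩ := (convex_ball (extChartAt 𝓘(ℝ, E) x₀ x₀) R
    ).exists_forall_hasFDerivAt_of_fderiv_symmetric Metric.isOpen_ball
    ((hsm.mono hR).differentiableOn (by simp)) (fun y hy => hcl y (hR hy))
  refine ⟨g, hg, fun σ Z hZ x hx => ?_⟩
  have hpos : 0 < R := dist_nonneg.trans_lt (Metric.mem_ball.1 hx.2)
  rw [sub_eq_intervalIntegral_of_hasFDerivAt (convex_ball _ R) (hsm.mono hR).continuousOn hg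
    (Metric.mem_ball_self hpos) hx.2, radialPrimitive, hZ]
  rfl

variable (F T) in
/-- Smooth families of symplectic vector fields have, locally on `M`, smooth families of
Hamiltonians. -/
theorem exists_smooth_hamiltonian [T2Space M] (x₀ : M) : ∃ r > 0,
    Metric.ball (extChartAt 𝓘(ℝ, E) x₀ x₀) r ⊆ (extChartAt 𝓘(ℝ, E) x₀).target ∧
    ∀ Y : T → (x : M) → ComplexTangent E x, (∀ σ, Y σ ∈ Ω.symplecticFields) →
      (∀ f : SmoothFn E M, ContMDiff (𝓘(ℝ, F).prod 𝓘(ℝ, E)) 𝓘(ℝ, ℂ) ∞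
        (fun p : T × M => (Y p.1 p.2).deriv f.1)) →
      ∃ b : T × M → ℂ, ContMDiff (𝓘(ℝ, F).prod 𝓘(ℝ, E)) 𝓘(ℝ, ℂ) ∞ b ∧
        ∀ σ, ∀ x ∈ chartBall (E := E) x₀ r, Y σ x = Ω.hamiltonianField (fun x => b (σ, x)) x := by
  obtain ⟨V, κ, hκ, hV⟩ := exists_isCoordinateSystem (mem_extChartAt_target (I := 𝓘(ℝ, E)) x₀)
  obtain ⟨R, hR0, hR⟩ := Metric.mem_nhds_iff.1 (hκ.isOpen.mem_nhds hV)
  obtain ⟨χ, hχ, hχU, r, hr, -, h1⟩ := exists_cutoff (E := E)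
    ((isOpen_chartBall (E := E) x₀ R).mem_nhds (mem_chartBall x₀ hR0))
  -- Radius R is where the primitive is controlled, radius r is where the cutoff equals 1. Neither
  -- depends on Y.
  have hmin : Metric.ball (extChartAt 𝓘(ℝ, E) x₀ x₀) (min r R) ⊆ (extChartAt 𝓘(ℝ, E) x₀).target :=
    (Metric.ball_subset_ball (min_le_right _ _)).trans (hR.trans hκ.subset)
  refine ⟨min r R, lt_min hr hR0, hmin, fun Y hYs hY => ?_⟩
  have hb : ContMDiff (𝓘(ℝ, F).prod 𝓘(ℝ, E)) 𝓘(ℝ, ℂ) ∞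
      (fun p : T × M => χ p.2 • Ω.radialPrimitive Y x₀ p) :=
    contMDiff_cutoff_smul contMDiff_snd hχ hχU fun p hp =>
      Ω.contMDiffAt_radialPrimitive hY hκ hR hp
  refine ⟨_, hb, fun σ x hx => Ω.eq_hamiltonianField_iff.2 ?_⟩
  -- For fixed σ the radial primitive differs from a Poincaré primitive g by a constant, so its
  -- differential is ι_Yω without differentiating under the integral.
  obtain ⟨g, hg, hgr⟩ := Ω.exists_primitive (T := T) (hYs σ) (hR.trans hκ.subset)
  have hbσ : ContMDiff 𝓘(ℝ, E) 𝓘(ℝ, ℂ) ∞ (fun x => χ x • Ω.radialPrimitive Y x₀ (σ, x)) :=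
    hb.comp (contMDiff_const.prodMk contMDiff_id)
  obtain ⟨y, hy, rfl⟩ : ∃ y ∈ Metric.ball (extChartAt 𝓘(ℝ, E) x₀ x₀) (min r R),
      (extChartAt 𝓘(ℝ, E) x₀).symm y = x := ⟨_, hx.2, (extChartAt 𝓘(ℝ, E) x₀).left_inv hx.1⟩
  refine eq_of_localForm_eq (α := fun x => Ω.flatComplex x (Y σ x)) (β := fun x => diffAt _ x)
    (hmin hy) ?_
  have h2 := hasFDerivAt_comp_extChartAt_symm (hmin hy) (hbσ.mdifferentiable (by simp) _)
  refine HasFDerivAt.unique ?_ h2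
  refine ((hg y (Metric.ball_subset_ball (min_le_right _ _) hy)).sub_const
    (g (extChartAt 𝓘(ℝ, E) x₀ x₀))).congr_of_eventuallyEq ?_
  filter_upwards [Metric.isOpen_ball.mem_nhds hy] with z hz
  have hz' := extChartAt_symm_mem_chartBall hmin hz
  rw [Function.comp_apply, h1 _ (chartBall_mono x₀ (min_le_left _ _) hz'), one_smul,
    hgr σ Y rfl _ (chartBall_mono x₀ (min_le_right _ _) hz'),
    (extChartAt 𝓘(ℝ, E) x₀).right_inv (hmin hz)]

end SymplecticForm

end LocalHamiltonian

/-! ### Hamiltonian functions: uniqueness, global existence, smooth families -/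

section Hamiltonians

variable {E : Type*} [NormedAddCommGroup E] [NormedSpace ℝ E]
  {M : Type*} [TopologicalSpace M] [ChartedSpace E M]
  {F : Type*} [NormedAddCommGroup F] [NormedSpace ℝ F]
  {T : Type*} [TopologicalSpace T] [ChartedSpace F T]

theorem diffAt_sub (f g : SmoothFn E M) (x : M) :
    diffAt (E := E) (f - g).1 x = diffAt f.1 x - diffAt g.1 x :=
  ((SmoothFn.mdifferentiableAt f x).hasMFDerivAt.sub
      (SmoothFn.mdifferentiableAt g x).hasMFDerivAt).mfderiv

theorem diffAt_add (f g : SmoothFn E M) (x : M) :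
    diffAt (E := E) (f + g).1 x = diffAt f.1 x + diffAt g.1 x :=
  ((SmoothFn.mdifferentiableAt f x).hasMFDerivAt.add
      (SmoothFn.mdifferentiableAt g x).hasMFDerivAt).mfderiv

theorem diffAt_const (c : ℂ) (x : M) : diffAt (E := E) (fun _ : M => c) x = 0 :=
  mfderiv_const

theorem diffAt_smul (c : ℂ) (f : SmoothFn E M) (x : M) :
    diffAt (E := E) (c • f).1 x = c • diffAt f.1 x := by
  ext v
  have h := ComplexTangent.deriv_fn_smul ((1 : ℂ) ⊗ₜ[ℝ] v : ComplexTangent E x) c f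
  rwa [ComplexTangent.deriv_tmul, ComplexTangent.deriv_tmul, one_mul, one_mul] at h

namespace SymplecticForm

variable (Ω : SymplecticForm E M) [FiniteDimensional ℝ E]

theorem flatComplex_hamiltonianField' (f : M → ℂ) (x : M) :
    Ω.flatComplex x (Ω.hamiltonianField f x) = diffAt f x :=
  Ω.flatComplex_hamiltonianField f x

theorem hamiltonianField_sub (f g : SmoothFn E M) (x : M) :
    Ω.hamiltonianField (f - g).1 x = Ω.hamiltonianField f.1 x - Ω.hamiltonianField g.1 x := by
  refine Eq.symm (Ω.eq_hamiltonianField_iff.2 ?_)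
  rw [map_sub, flatComplex_hamiltonianField', flatComplex_hamiltonianField', diffAt_sub]

theorem hamiltonianField_add (f g : SmoothFn E M) (x : M) :
    Ω.hamiltonianField (f + g).1 x = Ω.hamiltonianField f.1 x + Ω.hamiltonianField g.1 x := by
  refine Eq.symm (Ω.eq_hamiltonianField_iff.2 ?_)
  rw [map_add, flatComplex_hamiltonianField', flatComplex_hamiltonianField', diffAt_add]

theorem hamiltonianField_smul (c : ℂ) (f : SmoothFn E M) (x : M) :
    Ω.hamiltonianField (c • f).1 x = c • Ω.hamiltonianField f.1 x := by
  refine Eq.symm (Ω.eq_hamiltonianField_iff.2 ?_)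
  rw [map_smul, flatComplex_hamiltonianField', diffAt_smul]

theorem hamiltonianField_const (c : ℂ) (x : M) : Ω.hamiltonianField (fun _ => c) x = 0 := by
  refine Eq.symm (Ω.eq_hamiltonianField_iff.2 ?_)
  rw [map_zero, diffAt_const]

theorem hamiltonianField_eq_zero_iff {f : M → ℂ} {x : M} :
    Ω.hamiltonianField f x = 0 ↔ diffAt (E := E) f x = 0 := by
  rw [eq_comm, eq_hamiltonianField_iff, map_zero, eq_comm]

variable [IsManifold 𝓘(ℝ, E) ∞ M]

/-- Functions with vanishing Hamiltonian field are locally constant. -/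
theorem eq_of_hamiltonianField_eq_zero {f : SmoothFn E M} {x₀ : M} {r : ℝ}
    (hr : Metric.ball (extChartAt 𝓘(ℝ, E) x₀ x₀) r ⊆ (extChartAt 𝓘(ℝ, E) x₀).target)
    (h : ∀ x ∈ chartBall (E := E) x₀ r, Ω.hamiltonianField f.1 x = 0) {x x' : M}
    (hx : x ∈ chartBall (E := E) x₀ r) (hx' : x' ∈ chartBall (E := E) x₀ r) : f.1 x = f.1 x' :=
  eq_of_mfderiv_eq_zero_on_chartBall hr (fun x => SmoothFn.mdifferentiableAt f x)
    (fun x hx => Ω.hamiltonianField_eq_zero_iff.1 (h x hx)) hx hx'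

theorem eq_of_hamiltonianField_eq_zero_of_preconnected [PreconnectedSpace M] {f : SmoothFn E M}
    (h : ∀ x, Ω.hamiltonianField f.1 x = 0) (x x' : M) : f.1 x = f.1 x' := by
  refine IsLocallyConstant.apply_eq_of_preconnectedSpace
    ((IsLocallyConstant.iff_exists_open _).2 fun x₀ => ?_) x x'
  obtain ⟨r, hr, hrt, -⟩ := exists_chartBall_subset (E := E) (Filter.univ_mem (f := nhds x₀))
  exact ⟨_, isOpen_chartBall x₀ r, mem_chartBall x₀ hr, fun y hy =>
    Ω.eq_of_hamiltonianField_eq_zero hrt (fun x _ => h x) hy (mem_chartBall x₀ hr)⟩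

omit [FiniteDimensional ℝ E] [IsManifold 𝓘(ℝ, E) ∞ M] in
/-- If `H¹(M; ℝ) = 0`, smooth closed real one-forms are differentials. -/
theorem _root_.FormalConnections.exists_mfderiv_eq (hH : Subsingleton (DeRhamH1 E M))
    {α : (x : M) → TangentSpace 𝓘(ℝ, E) x →L[ℝ] ℝ} (h1 : (oneForm α).IsSmooth)
    (h2 : (oneForm α).IsClosed) :
    ∃ f : M → ℝ, ContMDiff 𝓘(ℝ, E) 𝓘(ℝ, ℝ) ∞ f ∧
      ∀ x, mfderiv 𝓘(ℝ, E) 𝓘(ℝ, ℝ) f x = α x := by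
  have h3 : (Submodule.Quotient.mk (⟨oneForm α, h1, h2⟩ : closedOneForms E M) : DeRhamH1 E M) = 0 :=
    Subsingleton.elim _ _
  rw [Submodule.Quotient.mk_eq_zero] at h3
  obtain ⟨f, hf, hfα⟩ := h3
  exact ⟨f, hf, fun x => (ContinuousAlternatingMap.ofSubsingleton ℝ
    (TangentSpace 𝓘(ℝ, E) x) ℝ (0 : Fin 1)).injective (congrFun hfα x)⟩

omit [IsManifold 𝓘(ℝ, E) ∞ M] in
/-- If `H¹(M; ℝ) = 0`, symplectic vector fields are Hamiltonian. -/
theorem exists_hamiltonian_of_subsingleton (hH : Subsingleton (DeRhamH1 E M))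
    {Y : (x : M) → ComplexTangent E x} (hY : Y ∈ Ω.symplecticFields) :
    ∃ b : SmoothFn E M, ∀ x, Y x = Ω.hamiltonianField b.1 x := by
  -- The hypothesis concerns real cohomology, so the real and imaginary parts of the closed form are
  -- integrated separately.
  have hL (L : ℂ →L[ℝ] ℝ) : ∃ f : M → ℝ, ContMDiff 𝓘(ℝ, E) 𝓘(ℝ, ℝ) ∞ f ∧
      ∀ x, mfderiv 𝓘(ℝ, E) 𝓘(ℝ, ℝ) f x = L.comp (Ω.flatComplex x (Y x)) := by
    have hloc (x₀ : M) : localForm (fun x => L.comp (Ω.flatComplex x (Y x))) x₀ =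
        fun y => L.comp (Ω.contractLocal Y x₀ y) := rfl
    have h1 (x₀ : M) := (isSmooth_oneForm_iff _).1 hY.2.1 x₀
    have h2 := (isClosed_oneForm_iff hY.2.1).1 hY.2.2
    have h3 : (oneForm fun x => L.comp (Ω.flatComplex x (Y x))).IsSmooth := by
      refine (isSmooth_oneForm_iff _).2 fun x₀ => ?_
      rw [hloc]
      exact contDiffOn_const.clm_comp (h1 x₀)
    refine exists_mfderiv_eq hH h3 ((isClosed_oneForm_iff h3).2 fun x₀ y hy v w => ?_)
    have h4 : DifferentiableAt ℝ (Ω.contractLocal Y x₀) y :=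
      ((h1 x₀).contDiffAt ((isOpen_extChartAt_target x₀).mem_nhds hy)).differentiableAt (by simp)
    have h5 : HasFDerivAt (fun y => L.comp (Ω.contractLocal Y x₀ y))
        ((ContinuousLinearMap.compL ℝ E ℂ ℝ L).comp (fderiv ℝ (Ω.contractLocal Y x₀) y)) y :=
      (ContinuousLinearMap.compL ℝ E ℂ ℝ L).hasFDerivAt.comp y h4.hasFDerivAt
    rw [hloc, h5.fderiv]
    exact congrArg L (h2 x₀ y hy v w)
  obtain ⟨f, hf, hfd⟩ := hL Complex.reCLM
  obtain ⟨g, hg, hgd⟩ := hL Complex.imCLM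
  let f' : SmoothFn E M := ⟨fun x => (f x : ℂ), Complex.ofRealCLM.contDiff.comp_contMDiff hf⟩
  let g' : SmoothFn E M := ⟨fun x => (g x : ℂ), Complex.ofRealCLM.contDiff.comp_contMDiff hg⟩
  have hd {u : M → ℝ} (hu : ContMDiff 𝓘(ℝ, E) 𝓘(ℝ, ℝ) ∞ u) (x : M) :
      diffAt (fun x => (u x : ℂ)) x = Complex.ofRealCLM.comp
        (mfderiv 𝓘(ℝ, E) 𝓘(ℝ, ℝ) u x : TangentSpace 𝓘(ℝ, E) x →L[ℝ] ℝ) :=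
    ((Complex.ofRealCLM.hasFDerivAt.hasMFDerivAt).comp x
      (hu.mdifferentiable (by simp) x).hasMFDerivAt).mfderiv
  refine ⟨f' + Complex.I • g', fun x => Ω.eq_hamiltonianField_iff.2 ?_⟩
  rw [diffAt_add, diffAt_smul]
  simp only [f', g', hd hf, hd hg, hfd, hgd]
  ext v
  exact ((congrArg _ (mul_comm _ _)).trans (Complex.re_add_im _)).symm

/-- A family of Hamiltonians of a smooth family of symplectic vector fields on a connected manifold
depends smoothly on the parameter if it does so at one point. -/
theorem contMDiff_hamiltonian_family [T2Space M] [FiniteDimensional ℝ F] [IsManifold 𝓘(ℝ, F) ∞ T]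
    [PreconnectedSpace M] {Y : T → (x : M) → ComplexTangent E x}
    (hYs : ∀ σ, Y σ ∈ Ω.symplecticFields)
    (hY : ∀ f : SmoothFn E M, ContMDiff (𝓘(ℝ, F).prod 𝓘(ℝ, E)) 𝓘(ℝ, ℂ) ∞
        (fun p : T × M => (Y p.1 p.2).deriv f.1))
    {b : T → SmoothFn E M} (hb : ∀ σ x, Y σ x = Ω.hamiltonianField (b σ).1 x) {x₁ : M}
    (hx₁ : ContMDiff 𝓘(ℝ, F) 𝓘(ℝ, ℂ) ∞ fun σ => (b σ).1 x₁) :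
    ContMDiff (𝓘(ℝ, F).prod 𝓘(ℝ, E)) 𝓘(ℝ, ℂ) ∞ fun p : T × M => (b p.1).1 p.2 := by
  choose r hr hrt hH using Ω.exists_smooth_hamiltonian F T
  choose c hc hcY using fun x₀ => hH x₀ Y hYs hY
  have hcs (x₀ : M) (σ : T) : ContMDiff 𝓘(ℝ, E) 𝓘(ℝ, ℂ) ∞ fun x => c x₀ (σ, x) :=
    (hc x₀).comp (contMDiff_const.prodMk contMDiff_id)
  -- On a chart ball, b σ and the smooth local Hamiltonian c differ by a constant depending on σ,
  -- which can be computed at any point x' of the ball. So smoothness in σ at one point of the ball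
  -- passes to the whole ball.
  have hdiff (x₀ : M) (σ : T) {x x' : M} (hx : x ∈ chartBall (E := E) x₀ (r x₀))
      (hx' : x' ∈ chartBall (E := E) x₀ (r x₀)) :
      (b σ).1 x = c x₀ (σ, x) + ((b σ).1 x' - c x₀ (σ, x')) := by
    have h := Ω.eq_of_hamiltonianField_eq_zero (f := b σ - ⟨_, hcs x₀ σ⟩) (hrt x₀)
      (fun x hx => by rw [hamiltonianField_sub, ← hb, ← hcY x₀ σ x hx, sub_self]) hx hx'
    have h' : (b σ).1 x - c x₀ (σ, x) = (b σ).1 x' - c x₀ (σ, x') := h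
    rw [← h']
    ring
  have hev (x : M) (h : ContMDiff 𝓘(ℝ, F) 𝓘(ℝ, ℂ) ∞ fun σ => (b σ).1 x) (x₀ : M)
      (hx : x ∈ chartBall (E := E) x₀ (r x₀)) (p : T × M)
      (hp : p.2 ∈ chartBall (E := E) x₀ (r x₀)) :
      ContMDiffAt (𝓘(ℝ, F).prod 𝓘(ℝ, E)) 𝓘(ℝ, ℂ) ∞ (fun p : T × M => (b p.1).1 p.2) p := by
    have h1 : ContMDiff (𝓘(ℝ, F).prod 𝓘(ℝ, E)) 𝓘(ℝ, ℂ) ∞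
        fun p : T × M => c x₀ p + ((b p.1).1 x - c x₀ (p.1, x)) :=
      (hc x₀).add ((h.comp contMDiff_fst).sub
        ((hc x₀).comp (contMDiff_fst.prodMk contMDiff_const)))
    refine (h1 p).congr_of_eventuallyEq ?_
    filter_upwards [continuous_snd.continuousAt.preimage_mem_nhds
      ((isOpen_chartBall (E := E) x₀ (r x₀)).mem_nhds hp)] with q hq
    exact hdiff x₀ q.1 hq hx
  have hslice (x : M) (h : ∀ σ, ContMDiffAt (𝓘(ℝ, F).prod 𝓘(ℝ, E)) 𝓘(ℝ, ℂ) ∞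
      (fun p : T × M => (b p.1).1 p.2) (σ, x)) :
      ContMDiff 𝓘(ℝ, F) 𝓘(ℝ, ℂ) ∞ fun σ => (b σ).1 x := fun σ =>
    (h σ).comp σ (contMDiffAt_id.prodMk contMDiffAt_const)
  -- The ball around x₀ lies in G if x₀ does, and misses G if x₀ does not.
  let G : Set M := {x | ContMDiff 𝓘(ℝ, F) 𝓘(ℝ, ℂ) ∞ fun σ => (b σ).1 x}
  have hG : IsClopen G := by
    refine ⟨isOpen_compl_iff.1 (isOpen_iff_mem_nhds.2 fun x₀ hx₀ => ?_),
      isOpen_iff_mem_nhds.2 fun x₀ hx₀ => ?_⟩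
    · refine Filter.mem_of_superset ((isOpen_chartBall (E := E) x₀ _).mem_nhds
        (mem_chartBall x₀ (hr x₀))) fun x hx hxG => hx₀ ?_
      exact hslice _ fun σ => hev x hxG x₀ hx (σ, x₀) (mem_chartBall x₀ (hr x₀))
    · refine Filter.mem_of_superset ((isOpen_chartBall (E := E) x₀ _).mem_nhds
        (mem_chartBall x₀ (hr x₀))) fun x hx => ?_
      exact hslice _ fun σ => hev x₀ hx₀ x₀ (mem_chartBall x₀ (hr x₀)) (σ, x) hx
  have hGu : G = Set.univ := hG.eq_univ ⟨x₁, hx₁⟩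
  intro p
  have hp : p.2 ∈ G := hGu ▸ Set.mem_univ _
  exact hev p.2 hp p.2 (mem_chartBall _ (hr _)) p (mem_chartBall _ (hr _))

end SymplecticForm

end Hamiltonians

/-! ## Formal functions and formal operators -/

section Formal

variable {E : Type*} [NormedAddCommGroup E] [NormedSpace ℝ E]
  {M : Type*} [TopologicalSpace M] [ChartedSpace E M]

namespace FormalFn

theorem smul_eq_mul_map (p : ℂ⟦X⟧) (f : FormalFn E M) :
    p • f = PowerSeries.map (algebraMap ℂ (SmoothFn E M)) p * f := rfl

theorem X_pow_smul (n : ℕ) (f : FormalFn E M) :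
    (PowerSeries.X ^ n : ℂ⟦X⟧) • f = PowerSeries.X ^ n * f := by
  rw [smul_eq_mul_map, map_pow, PowerSeries.map_X]

theorem X_smul (f : FormalFn E M) : (PowerSeries.X : ℂ⟦X⟧) • f = PowerSeries.X * f := by
  simpa using X_pow_smul 1 f

/-- The formal function `(f - f₀) / h`. -/
def shift (f : FormalFn E M) : FormalFn E M := PowerSeries.mk fun n => PowerSeries.coeff (n + 1) f

theorem eq_C_add_X_smul (f : FormalFn E M) :
    f = PowerSeries.C (PowerSeries.coeff 0 f) + (PowerSeries.X : ℂ⟦X⟧) • shift f := by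
  rw [X_smul, add_comm, PowerSeries.coeff_zero_eq_constantCoeff_apply]
  exact PowerSeries.eq_X_mul_shift_add_const f

theorem coeff_succ_X_smul (n : ℕ) (f : FormalFn E M) :
    PowerSeries.coeff (n + 1) ((PowerSeries.X : ℂ⟦X⟧) • f) = PowerSeries.coeff n f := by
  rw [X_smul, PowerSeries.coeff_succ_X_mul]

theorem coeff_zero_X_smul (f : FormalFn E M) :
    PowerSeries.coeff 0 ((PowerSeries.X : ℂ⟦X⟧) • f) = 0 := by
  rw [X_smul, PowerSeries.coeff_zero_X_mul]

/-- The value of a formal function at a point. -/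
def ev (x : M) : FormalFn E M →ₗ[ℂ⟦X⟧] ℂ⟦X⟧ where
  toFun := PowerSeries.map ((Pi.evalRingHom (fun _ : M => ℂ) x).comp (SmoothFn E M).subtype)
  map_add' := map_add _
  map_smul' p f := by
    rw [smul_eq_mul_map, map_mul, RingHom.id_apply, smul_eq_mul]
    congr 1

theorem coeff_ev (x : M) (f : FormalFn E M) (n : ℕ) :
    PowerSeries.coeff n (ev x f) = (PowerSeries.coeff n f : SmoothFn E M).1 x := by
  exact PowerSeries.coeff_map
    ((Pi.evalRingHom (fun _ : M => ℂ) x).comp (SmoothFn E M).subtype) n f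

theorem ext_ev {f g : FormalFn E M} (h : ∀ x, ev x f = ev x g) : f = g := by
  ext n x
  have := congrArg (PowerSeries.coeff (R := ℂ) n) (h x)
  rwa [coeff_ev, coeff_ev] at this

theorem exists_eq_X_pow_smul {f : FormalFn E M} {m : ℕ}
    (h : ∀ k < m, PowerSeries.coeff k f = 0) :
    ∃ g : FormalFn E M, f = (PowerSeries.X ^ m : ℂ⟦X⟧) • g := by
  obtain ⟨g, hg⟩ := PowerSeries.X_pow_dvd_iff.2 h
  exact ⟨g, by rw [X_pow_smul, hg]⟩

theorem coeff_X_pow_smul_add (m n : ℕ) (f : FormalFn E M) :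
    PowerSeries.coeff (n + m) ((PowerSeries.X ^ m : ℂ⟦X⟧) • f) = PowerSeries.coeff n f := by
  rw [X_pow_smul, PowerSeries.coeff_X_pow_mul]

theorem coeff_X_pow_smul_of_lt {m k : ℕ} (h : k < m) (f : FormalFn E M) :
    PowerSeries.coeff k ((PowerSeries.X ^ m : ℂ⟦X⟧) • f) = 0 := by
  rw [X_pow_smul, PowerSeries.coeff_X_pow_mul', if_neg (by omega)]

end FormalFn

open FormalFn

theorem IsDiffOp.add {k : ℕ} {P Q : SmoothFn E M →ₗ[ℂ] SmoothFn E M} (hP : IsDiffOp k P)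
    (hQ : IsDiffOp k Q) : IsDiffOp k (P + Q) := by
  have h (P Q : SmoothFn E M →ₗ[ℂ] SmoothFn E M) (g) :
      commutatorMul (P + Q) g = commutatorMul P g + commutatorMul Q g := by
    ext f : 1
    simp only [commutatorMul, LinearMap.sub_apply, LinearMap.comp_apply, LinearMap.add_apply, map_add]
    abel
  induction k generalizing P Q with
  | zero => exact fun g => by rw [h, hP, hQ, add_zero]
  | succ k ih => exact fun g => by rw [h]; exact ih (hP g) (hQ g)

theorem IsDiffOp.neg {k : ℕ} {P : SmoothFn E M →ₗ[ℂ] SmoothFn E M} (hP : IsDiffOp k P) :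
    IsDiffOp k (-P) := by
  have h (P : SmoothFn E M →ₗ[ℂ] SmoothFn E M) (g) : commutatorMul (-P) g = -commutatorMul P g := by
    ext f : 1
    simp only [commutatorMul, LinearMap.sub_apply, LinearMap.comp_apply, LinearMap.neg_apply, map_neg]
    abel
  induction k generalizing P with
  | zero => exact fun g => by rw [h, hP]; ext f x; exact neg_zero (G := ℂ)
  | succ k ih => exact fun g => by rw [h]; exact ih (hP g)

theorem IsDiffOp.succ {k : ℕ} {P : SmoothFn E M →ₗ[ℂ] SmoothFn E M} (hP : IsDiffOp k P) :
    IsDiffOp (k + 1) P := by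
  induction k generalizing P with
  | zero =>
    intro g g'
    rw [hP g]
    ext f : 1
    simp [commutatorMul]
  | succ k ih => exact fun g => ih (hP g)

/-- Being a differential operator can be tested pointwise. -/
theorem isDiffOp_of_pointwise {k : ℕ} {P : SmoothFn E M →ₗ[ℂ] SmoothFn E M}
    (h : ∀ x, ∃ Q : SmoothFn E M →ₗ[ℂ] SmoothFn E M, IsDiffOp k Q ∧ ∀ f, (P f).1 x = (Q f).1 x) :
    IsDiffOp k P := by
  -- The value at x of a commutator with a multiplication involves only values at x of the operator,
  -- so the comparison operator Q may vary with x throughout the induction.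
  have hc (P Q : SmoothFn E M →ₗ[ℂ] SmoothFn E M) (x : M) (hPQ : ∀ f, (P f).1 x = (Q f).1 x) (g f) :
      (commutatorMul P g f).1 x = (commutatorMul Q g f).1 x := by
    change (P (g * f)).1 x - g.1 x * (P f).1 x = (Q (g * f)).1 x - g.1 x * (Q f).1 x
    rw [hPQ, hPQ]
  induction k generalizing P with
  | zero =>
    intro g
    ext f x
    obtain ⟨Q, hQ, hPQ⟩ := h x
    rw [hc P Q x hPQ, hQ g]
  | succ k ih =>
    intro g
    refine ih fun x => ?_
    obtain ⟨Q, hQ, hPQ⟩ := h x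
    exact ⟨commutatorMul Q g, hQ g, hc P Q x hPQ g⟩

namespace FormalOp

theorem coeff_apply (B : FormalOp E M) (k : ℕ) (f : SmoothFn E M) :
    B.coeff k f = PowerSeries.coeff k (B (PowerSeries.C f)) := rfl

theorem coeff_zero_eq (B : FormalOp E M) (f : FormalFn E M) :
    PowerSeries.coeff 0 (B f) = B.coeff 0 (PowerSeries.coeff 0 f) := by
  conv_lhs => rw [eq_C_add_X_smul f]
  rw [map_add, map_add, map_smul, coeff_zero_X_smul, add_zero]
  rfl

/-- By h-linearity, splitting off the constant term f₀ of f lowers the degree by one. This recursion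
reduces formal operators to their coefficients. -/
theorem coeff_succ_eq (B : FormalOp E M) (n : ℕ) (f : FormalFn E M) :
    PowerSeries.coeff (n + 1) (B f) =
      B.coeff (n + 1) (PowerSeries.coeff 0 f) + PowerSeries.coeff n (B (shift f)) := by
  conv_lhs => rw [eq_C_add_X_smul f]
  rw [map_add, map_add, map_smul, coeff_succ_X_smul]
  rfl

theorem IsNatural.sub {A B : FormalOp E M} (hA : A.IsNatural) (hB : B.IsNatural) :
    (A - B).IsNatural := fun k => by
  have h : (A - B).coeff k = A.coeff k + -B.coeff k := by
    ext f : 1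
    rw [LinearMap.add_apply, LinearMap.neg_apply, coeff_apply, coeff_apply, coeff_apply,
      LinearMap.sub_apply, map_sub, sub_eq_add_neg]
  rw [h]
  exact (hA k).add (hB k).neg

theorem IsNatural.add {A B : FormalOp E M} (hA : A.IsNatural) (hB : B.IsNatural) :
    (A + B).IsNatural := fun k => by
  have h : (A + B).coeff k = A.coeff k + B.coeff k := by
    ext f : 1
    rw [LinearMap.add_apply, coeff_apply, coeff_apply, coeff_apply,
      LinearMap.add_apply, map_add]
  rw [h]
  exact (hA k).add (hB k)

theorem VanishesModH.sub {A B : FormalOp E M} (hA : A.VanishesModH) (hB : B.VanishesModH) :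
    (A - B).VanishesModH := fun f => by
  rw [LinearMap.sub_apply, map_sub, hA, hB, sub_zero]

theorem VanishesModH.add {A B : FormalOp E M} (hA : A.VanishesModH) (hB : B.VanishesModH) :
    (A + B).VanishesModH := fun f => by
  rw [LinearMap.add_apply, map_add, hA, hB, add_zero]

/-- A bilinear family of operators `c ↦ L c` is natural if it is so for functions `c`. -/
theorem isNatural_of_C {L : FormalFn E M →ₗ[ℂ⟦X⟧] FormalOp E M}
    (hL : ∀ f : SmoothFn E M, (L (PowerSeries.C f)).IsNatural) (c : FormalFn E M) :
    (L c).IsNatural := by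
  intro k
  induction k generalizing c with
  | zero =>
    have h : (L c).coeff 0 = (L (PowerSeries.C (PowerSeries.coeff 0 c))).coeff 0 := by
      ext f : 1
      rw [coeff_apply, coeff_apply]
      conv_lhs => rw [eq_C_add_X_smul c]
      rw [map_add, map_smul, LinearMap.add_apply, LinearMap.smul_apply, map_add,
        coeff_zero_X_smul, add_zero]
    rw [h]
    exact hL _ 0
  | succ k ih =>
    have h : (L c).coeff (k + 1) = (L (PowerSeries.C (PowerSeries.coeff 0 c))).coeff (k + 1) +
        (L (shift c)).coeff k := by
      ext f : 1
      rw [LinearMap.add_apply, coeff_apply, coeff_apply, coeff_apply]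
      conv_lhs => rw [eq_C_add_X_smul c]
      rw [map_add, map_smul, LinearMap.add_apply, LinearMap.smul_apply, map_add,
        coeff_succ_X_smul]
    rw [h]
    -- The part of c divisible by h contributes in degree k + 1 an operator of order at most k, one
    -- better than needed.
    exact (hL _ _).add (ih _).succ

end FormalOp

/-! ### Locality of natural operators -/

section Locality

variable [FiniteDimensional ℝ E] [T2Space M] [IsManifold 𝓘(ℝ, E) ∞ M]

/-- If φ is 1 where f does not vanish and φ(x) = 0, then f = φ f and (P f)(x) = ([P, φ] f)(x), with
a commutator of smaller order; the last commutator is zero. -/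
theorem IsDiffOp.apply_eq_zero {k : ℕ} {P : SmoothFn E M →ₗ[ℂ] SmoothFn E M} (hP : IsDiffOp k P)
    {x : M} {f : SmoothFn E M} (hf : f.1 =ᶠ[nhds x] 0) : (P f).1 x = 0 := by
  obtain ⟨χ, hχ, hχU, r, hr, -, h1⟩ := exists_cutoff (E := E) hf
  let φ : SmoothFn E M := ⟨fun x => 1 - (χ x : ℂ),
    (contDiff_const.sub Complex.ofRealCLM.contDiff).comp_contMDiff hχ⟩
  have h2 : φ * f = f := by
    ext y
    change (1 - (χ y : ℂ)) * f.1 y = f.1 y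
    by_cases hy : y ∈ tsupport χ
    · have : f.1 y = 0 := hχU hy
      simp [this]
    · simp [image_eq_zero_of_notMem_tsupport hy]
  have hφ : φ.1 x = 0 := by simp [φ, h1 x (mem_chartBall x hr)]
  have h3 (P : SmoothFn E M →ₗ[ℂ] SmoothFn E M) : (P f).1 x = (commutatorMul P φ f).1 x := by
    change _ = (P (φ * f)).1 x - φ.1 x * (P f).1 x
    rw [h2, hφ, zero_mul, sub_zero]
  induction k generalizing P with
  | zero => rw [h3, hP]; rfl
  | succ k ih => rw [h3]; exact ih (hP φ)

/-- Natural operators are local. -/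
theorem FormalOp.IsNatural.ev_congr {B : FormalOp E M} (hB : B.IsNatural) {x : M} {U : Set M}
    (hU : U ∈ nhds x) {f g : FormalFn E M} (h : ∀ y ∈ U, ev y f = ev y g) :
    ev x (B f) = ev x (B g) := by
  have key : ∀ (n : ℕ) (f : FormalFn E M), (∀ y ∈ U, ev y f = 0) →
      (PowerSeries.coeff n (B f) : SmoothFn E M).1 x = 0 := by
    intro n
    have h0 (f : FormalFn E M) (hf : ∀ y ∈ U, ev y f = 0) (k : ℕ) :
        (PowerSeries.coeff k f : SmoothFn E M).1 =ᶠ[nhds x] 0 := by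
      filter_upwards [hU] with y hy
      rw [← coeff_ev, hf y hy]
      rfl
    induction n with
    | zero =>
      intro f hf
      rw [coeff_zero_eq]
      exact (hB 0).apply_eq_zero (h0 f hf 0)
    | succ n ih =>
      intro f hf
      rw [coeff_succ_eq]
      have h1 := (hB (n + 1)).apply_eq_zero (h0 f hf 0)
      have h2 := ih (shift f) fun y hy => by
        ext k
        rw [coeff_ev, shift, PowerSeries.coeff_mk, ← coeff_ev, hf y hy]
        rfl
      change _ + _ = (0 : ℂ)
      rw [h1, h2, add_zero]
  rw [← sub_eq_zero, ← map_sub, ← map_sub]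
  ext n
  rw [coeff_ev, key n (f - g) fun y hy => by rw [map_sub, h y hy, sub_self]]
  rfl

end Locality

end Formal

/-! ## Commutators of a star product -/

section StarCommutator

open FormalFn

variable {E : Type*} [NormedAddCommGroup E] [NormedSpace ℝ E] [FiniteDimensional ℝ E]
  {M : Type*} [TopologicalSpace M] [ChartedSpace E M] {Ω : SymplecticForm E M}

namespace StarProduct

variable (S : StarProduct Ω)

/-- The commutator `f ↦ b ⋆ f - f ⋆ b`. -/
def ad : FormalFn E M →ₗ[ℂ⟦X⟧] FormalOp E M where
  toFun b := S.mul b - S.mul.flip b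
  map_add' b c := by
    rw [map_add, map_add]
    abel
  map_smul' p b := by
    rw [map_smul, map_smul]
    ext1 f
    exact (smul_sub p (S.mul b f) (S.mul f b)).symm

theorem ad_apply (b f : FormalFn E M) : S.ad b f = S.mul b f - S.mul f b := rfl

theorem ad_swap (b f : FormalFn E M) : S.ad b f = -S.ad f b := by
  rw [ad_apply, ad_apply, neg_sub]

theorem ad_mul (b f g : FormalFn E M) :
    S.ad b (S.mul f g) = S.mul (S.ad b f) g + S.mul f (S.ad b g) := by
  simp only [ad_apply, map_sub, LinearMap.sub_apply, S.mul_assoc]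
  abel

theorem ad_ad (a b c : FormalFn E M) :
    S.ad a (S.ad b c) = S.ad (S.ad a b) c + S.ad b (S.ad a c) := by
  rw [S.ad_apply b c, map_sub, ad_mul, ad_mul, S.ad_apply (S.ad a b), S.ad_apply b (S.ad a c)]
  abel

theorem ad_smul_one (p : ℂ⟦X⟧) : S.ad (p • 1) = 0 := by
  ext1 f
  rw [map_smul, LinearMap.smul_apply, ad_apply, S.one_mul, S.mul_one, sub_self, smul_zero]
  rfl

theorem isNatural_mul (c : FormalFn E M) : FormalOp.IsNatural (S.mul c) :=
  FormalOp.isNatural_of_C (fun f => (S.natural f).1) c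

theorem isNatural_flip (c : FormalFn E M) : FormalOp.IsNatural (S.mul.flip c) :=
  FormalOp.isNatural_of_C (fun f => (S.natural f).2) c

theorem isNatural_ad (c : FormalFn E M) : FormalOp.IsNatural (S.ad c) :=
  (S.isNatural_mul c).sub (S.isNatural_flip c)

theorem coeff_zero_mul (f g : FormalFn E M) :
    PowerSeries.coeff 0 (S.mul f g) = PowerSeries.coeff 0 f * PowerSeries.coeff 0 g := by
  rw [FormalOp.coeff_zero_eq, FormalOp.coeff_apply]
  change PowerSeries.coeff 0 (S.mul.flip (PowerSeries.C (PowerSeries.coeff 0 g)) f) = _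
  rw [FormalOp.coeff_zero_eq, FormalOp.coeff_apply]
  exact S.coeff_zero _ _

theorem coeff_zero_ad (f g : FormalFn E M) : PowerSeries.coeff 0 (S.ad f g) = 0 := by
  rw [ad_apply, map_sub, coeff_zero_mul, coeff_zero_mul, mul_comm, sub_self]

/-- The Poisson bracket as an operation on smooth functions. -/
def bracket (f g : SmoothFn E M) : SmoothFn E M :=
  (-Complex.I) • PowerSeries.coeff 1 (S.ad (PowerSeries.C f) (PowerSeries.C g))

theorem bracket_apply (f g : SmoothFn E M) (x : M) :
    (S.bracket f g).1 x = Ω.poisson f.1 g.1 x := by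
  change -Complex.I * (PowerSeries.coeff 1 (S.ad (PowerSeries.C f) (PowerSeries.C g)) :
    SmoothFn E M).1 x = _
  rw [ad_apply, map_sub, S.coeff_one, ← _root_.mul_assoc]
  simp

theorem I_smul_bracket (f g : SmoothFn E M) :
    Complex.I • S.bracket f g = PowerSeries.coeff 1 (S.ad (PowerSeries.C f) (PowerSeries.C g)) := by
  rw [bracket, smul_smul]
  simp

theorem coeff_one_ad (b f : FormalFn E M) : PowerSeries.coeff 1 (S.ad b f) =
    Complex.I • S.bracket (PowerSeries.coeff 0 b) (PowerSeries.coeff 0 f) := by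
  rw [FormalOp.coeff_succ_eq, coeff_zero_ad, add_zero, FormalOp.coeff_apply, ad_swap, map_neg,
    FormalOp.coeff_succ_eq, coeff_zero_ad, add_zero, FormalOp.coeff_apply, ad_swap, map_neg, neg_neg,
    I_smul_bracket]

theorem bracket_swap (f g : SmoothFn E M) : S.bracket f g = -S.bracket g f := by
  rw [bracket, ad_swap, map_neg, smul_neg]
  rfl

/-- The operator `h⁻¹ (b ⋆ · - · ⋆ b)` applied to a function, for which there is only one
choice. -/
theorem exists_ad_eq_X_smul (b f : FormalFn E M) :
    ∃ d : FormalFn E M, S.ad b f = (PowerSeries.X : ℂ⟦X⟧) • d ∧ PowerSeries.coeff 0 d =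
      Complex.I • S.bracket (PowerSeries.coeff 0 b) (PowerSeries.coeff 0 f) := by
  refine ⟨shift (S.ad b f), ?_, ?_⟩
  · conv_lhs => rw [eq_C_add_X_smul (S.ad b f)]
    rw [coeff_zero_ad, map_zero, zero_add]
  · rw [shift, PowerSeries.coeff_mk, coeff_one_ad]

/-- The Jacobi identity is the h²-coefficient of the one for ⋆-commutators, a consequence of
associativity. Each commutator begins with ih times the bracket, so a double one begins with -h²
times the double bracket. -/
theorem bracket_bracket (f g k : SmoothFn E M) :
    S.bracket f (S.bracket g k) - S.bracket g (S.bracket f k) = -S.bracket k (S.bracket f g) := by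
  have h0 (u v : SmoothFn E M) : ∃ d : FormalFn E M,
      S.ad (PowerSeries.C u) (PowerSeries.C v) = (PowerSeries.X : ℂ⟦X⟧) • d ∧
        PowerSeries.coeff 0 d = Complex.I • S.bracket u v := by
    simpa using S.exists_ad_eq_X_smul (PowerSeries.C u) (PowerSeries.C v)
  have hs (c : ℂ) (u v : SmoothFn E M) : S.bracket u (c • v) = c • S.bracket u v := by
    ext x
    change (S.bracket u (c • v)).1 x = c * (S.bracket u v).1 x
    rw [bracket_apply, bracket_apply]
    exact ComplexTangent.deriv_fn_smul _ c v
  have h1 (u v w : SmoothFn E M) : PowerSeries.coeff 2 (S.ad (PowerSeries.C u)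
      (S.ad (PowerSeries.C v) (PowerSeries.C w))) = -S.bracket u (S.bracket v w) := by
    obtain ⟨d, hd, hd0⟩ := h0 v w
    rw [hd, map_smul, coeff_succ_X_smul, coeff_one_ad, hd0, PowerSeries.coeff_zero_C, hs, smul_smul,
      Complex.I_mul_I, neg_smul, one_smul]
  have h2 := congrArg (PowerSeries.coeff 2)
    (S.ad_ad (PowerSeries.C f) (PowerSeries.C g) (PowerSeries.C k))
  rw [map_add, h1, h1, ad_swap, map_neg, h1] at h2
  rw [sub_eq_iff_eq_add, ← neg_inj, h2]
  abel

end StarProduct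

end StarCommutator

/-! ## Derivations of a star product -/

section Derivations

open FormalFn

variable {E : Type*} [NormedAddCommGroup E] [NormedSpace ℝ E] [FiniteDimensional ℝ E]
  {M : Type*} [TopologicalSpace M] [ChartedSpace E M] {Ω : SymplecticForm E M}

namespace StarProduct

variable (S : StarProduct Ω)

omit [FiniteDimensional ℝ E] in
theorem _root_.FormalConnections.FormalOp.coeff_eq_of_vanishing {B : FormalOp E M} {m : ℕ}
    (hB : ∀ f, ∀ k < m, PowerSeries.coeff k (B f) = 0) (f : FormalFn E M) :
    PowerSeries.coeff m (B f) = B.coeff m (PowerSeries.coeff 0 f) := by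
  cases m with
  | zero => exact B.coeff_zero_eq f
  | succ m => rw [FormalOp.coeff_succ_eq, hB _ m m.lt_succ_self, add_zero]

omit [FiniteDimensional ℝ E] in
theorem _root_.FormalConnections.FormalOp.exists_eq_X_pow_smul {B : FormalOp E M} {m : ℕ}
    (hB : ∀ f, ∀ k < m, PowerSeries.coeff k (B f) = 0) (f : FormalFn E M) :
    ∃ d : FormalFn E M, B f = (PowerSeries.X ^ m : ℂ⟦X⟧) • d ∧
      PowerSeries.coeff 0 d = B.coeff m (PowerSeries.coeff 0 f) := by
  obtain ⟨d, hd⟩ := FormalFn.exists_eq_X_pow_smul (hB f)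
  refine ⟨d, hd, ?_⟩
  have h := FormalOp.coeff_eq_of_vanishing hB f
  have h1 := coeff_X_pow_smul_add m 0 d
  rw [← hd, zero_add, h] at h1
  exact h1.symm

variable {S} {B : FormalOp E M} (hder : ∀ f g, B (S.mul f g) = S.mul (B f) g + S.mul f (B g))
  {m : ℕ} (hB : ∀ f, ∀ k < m, PowerSeries.coeff k (B f) = 0)

include hder hB

/-- The leading coefficient of a derivation is a derivation of the algebra of functions. -/
theorem leading_coeff_mul (f g : SmoothFn E M) :
    B.coeff m (f * g) = f * B.coeff m g + g * B.coeff m f := by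
  obtain ⟨d, hd, hd0⟩ := FormalOp.exists_eq_X_pow_smul hB (PowerSeries.C f)
  obtain ⟨e, he, he0⟩ := FormalOp.exists_eq_X_pow_smul hB (PowerSeries.C g)
  -- In degree m only the pointwise product contributes, as B already supplies the factor h^m.
  have h := congrArg (PowerSeries.coeff (0 + m)) (hder (PowerSeries.C f) (PowerSeries.C g))
  rw [hd, he, map_smul, LinearMap.smul_apply, map_smul, map_add, coeff_X_pow_smul_add,
    coeff_X_pow_smul_add, zero_add, FormalOp.coeff_eq_of_vanishing hB, coeff_zero_mul,
    coeff_zero_mul, coeff_zero_mul, hd0, he0, PowerSeries.coeff_zero_C,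
    PowerSeries.coeff_zero_C] at h
  rw [h]
  ring

/-- The leading coefficient of a derivation is a derivation of the Poisson bracket. -/
theorem leading_coeff_bracket (f g : SmoothFn E M) :
    B.coeff m (S.bracket f g) = S.bracket (B.coeff m f) g + S.bracket f (B.coeff m g) := by
  obtain ⟨d, hd, hd0⟩ := FormalOp.exists_eq_X_pow_smul hB (PowerSeries.C f)
  obtain ⟨e, he, he0⟩ := FormalOp.exists_eq_X_pow_smul hB (PowerSeries.C g)
  obtain ⟨c, hc, hc0⟩ := S.exists_ad_eq_X_smul (PowerSeries.C f) (PowerSeries.C g)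
  have h : B (S.ad (PowerSeries.C f) (PowerSeries.C g)) = S.ad (B (PowerSeries.C f)) (PowerSeries.C g)
      + S.ad (PowerSeries.C f) (B (PowerSeries.C g)) := by
    simp only [ad_apply, map_sub, hder]
    abel
  -- B supplies h^m and the commutator one more h with the factor i, which is cancelled at the end.
  have h1 := congrArg (PowerSeries.coeff (m + 1)) h
  rw [hc, hd, he, map_smul, coeff_succ_X_smul, FormalOp.coeff_eq_of_vanishing hB, map_smul,
    LinearMap.smul_apply, map_smul, map_add, add_comm m 1, coeff_X_pow_smul_add,
    coeff_X_pow_smul_add, coeff_one_ad, coeff_one_ad, hc0, hd0, he0, PowerSeries.coeff_zero_C,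
    PowerSeries.coeff_zero_C, map_smul, ← smul_add] at h1
  exact smul_right_injective _ Complex.I_ne_zero h1

variable [T2Space M] [IsManifold 𝓘(ℝ, E) ∞ M]

/-- The leading coefficient of a derivation is a symplectic vector field. -/
theorem exists_symplecticField_leading_coeff :
    ∃ Y ∈ Ω.symplecticFields, ∀ (f : FormalFn E M) (x : M),
      (PowerSeries.coeff m (B f) : SmoothFn E M).1 x =
        Complex.I * (Y x).deriv (PowerSeries.coeff 0 f : SmoothFn E M).1 := by
  have hex (x : M) : ∃ Z : ComplexTangent E x, ∀ f : SmoothFn E M,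
      Z.deriv f.1 = (-Complex.I) * (B.coeff m f).1 x := by
    -- The factor -i normalises the field: h⁻¹[b, ·] begins with iX_b at the lowest coefficient of
    -- b.
    let D : SmoothFn E M →ₗ[ℂ] ℂ := (-Complex.I) •
      ((LinearMap.proj x).comp ((SmoothFn E M).val.toLinearMap.comp (B.coeff m)))
    have hD (f) : D f = (-Complex.I) * (B.coeff m f).1 x := rfl
    obtain ⟨Z, hZ⟩ := exists_complexTangent_of_pointDerivation (x₀ := x) (D := D) fun f g => by
      rw [hD, hD, hD, leading_coeff_mul hder hB]
      change -Complex.I * (f.1 x * (B.coeff m g).1 x + g.1 x * (B.coeff m f).1 x) = _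
      ring
    exact ⟨Z, hZ⟩
  choose Y hY using hex
  refine ⟨Y, ?_, fun f x => ?_⟩
  · refine Ω.mem_symplecticFields_of_bracket (br := S.bracket) (fun f g x => S.bracket_apply f g x)
      S.bracket_swap S.bracket_bracket (P := fun f => (-Complex.I) • B.coeff m f) (fun f g => ?_)
      (fun f x => hY x f)
    rw [leading_coeff_bracket hder hB, smul_add]
    have hs (c : ℂ) (u v : SmoothFn E M) : S.bracket u (c • v) = c • S.bracket u v := by
      ext x
      change (S.bracket u (c • v)).1 x = c * (S.bracket u v).1 x
      rw [bracket_apply, bracket_apply]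
      exact ComplexTangent.deriv_fn_smul _ c v
    rw [hs, S.bracket_swap (_ • _) g, hs, ← smul_neg, ← S.bracket_swap]
  · rw [hY, FormalOp.coeff_eq_of_vanishing hB, ← _root_.mul_assoc]
    simp

end StarProduct

end Derivations

/-! ## Derivations and formal symplectic vector fields -/

section Correspondence

open FormalFn

variable {E : Type*} [NormedAddCommGroup E] [NormedSpace ℝ E] [FiniteDimensional ℝ E]
  {M : Type*} [TopologicalSpace M] [ChartedSpace E M] {Ω : SymplecticForm E M}

namespace IsHamiltonianOn

variable {Y Z : ℕ → Ω.symplecticFields} {b c : FormalFn E M} {U V : Set M}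

theorem mono (h : IsHamiltonianOn Y b U) (hV : V ⊆ U) : IsHamiltonianOn Y b V :=
  fun k x hx => h k x (hV hx)

theorem add (hY : IsHamiltonianOn Y b U) (hZ : IsHamiltonianOn Z c U) :
    IsHamiltonianOn (Y + Z) (b + c) U := fun k x hx => by
  rw [map_add, Ω.hamiltonianField_add, ← hY k x hx, ← hZ k x hx]
  rfl

theorem smul (a : ℂ) (hY : IsHamiltonianOn Y b U) : IsHamiltonianOn (a • Y) (a • b) U :=
  fun k x hx => by
    rw [PowerSeries.coeff_smul, Ω.hamiltonianField_smul, ← hY k x hx]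
    rfl

theorem sub (hY : IsHamiltonianOn Y b U) (hZ : IsHamiltonianOn Z c U) :
    IsHamiltonianOn (Y - Z) (b - c) U := fun k x hx => by
  rw [map_sub, Ω.hamiltonianField_sub, ← hY k x hx, ← hZ k x hx]
  rfl

/-- The coefficients of b below m have zero Hamiltonian field on U, so they may be replaced by 0;
this makes the Hamiltonian divisible by h^m. -/
theorem exists_X_pow_smul {m : ℕ} (hm : ∀ k < m, Y k = 0) (h : IsHamiltonianOn Y b U) :
    ∃ d : FormalFn E M, IsHamiltonianOn Y ((PowerSeries.X ^ m : ℂ⟦X⟧) • d) U := by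
  refine ⟨PowerSeries.mk fun n => PowerSeries.coeff (n + m) b, fun k x hx => ?_⟩
  obtain hk | hk := lt_or_ge k m
  · rw [coeff_X_pow_smul_of_lt hk, hm k hk]
    exact (Ω.hamiltonianField_const 0 x).symm
  · obtain ⟨n, rfl⟩ := Nat.exists_eq_add_of_le' hk
    rw [coeff_X_pow_smul_add, PowerSeries.coeff_mk]
    exact h _ x hx

end IsHamiltonianOn

omit [FiniteDimensional ℝ E] in
theorem FormalFn.ev_one (x : M) : ev x (1 : FormalFn E M) = 1 := map_one
  (PowerSeries.map ((Pi.evalRingHom (fun _ : M => ℂ) x).comp (SmoothFn E M).subtype))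

section Family

variable [IsManifold 𝓘(ℝ, E) ∞ M] [T2Space M]
  {F : Type*} [NormedAddCommGroup F] [NormedSpace ℝ F] [FiniteDimensional ℝ F]
  {T : Type*} [TopologicalSpace T] [ChartedSpace F T] [IsManifold 𝓘(ℝ, F) ∞ T]

/-- Smooth families of formal symplectic vector fields are locally Hamiltonian, with Hamiltonians
that depend smoothly on the parameter. -/
theorem exists_isHamiltonianOn_family {Y : T → ℕ → Ω.symplecticFields}
    (hY : ∀ (f : SmoothFn E M) (k : ℕ), ContMDiff (𝓘(ℝ, F).prod 𝓘(ℝ, E)) 𝓘(ℝ, ℂ) ∞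
      (fun p : T × M => ((Y p.1 k).1 p.2).deriv f.1)) (x₀ : M) :
    ∃ U : Set M, IsOpen U ∧ x₀ ∈ U ∧ ∃ b ∈ Sections E M F T,
      ∀ σ, IsHamiltonianOn (Y σ) (b σ) U := by
  obtain ⟨r, hr, -, h⟩ := Ω.exists_smooth_hamiltonian F T x₀
  -- The radius was fixed before the vector field, so a single neighbourhood serves all coefficients
  -- k.
  choose b hb hYb using fun k => h (fun σ => (Y σ k).1) (fun σ => (Y σ k).2) fun f => hY f k
  refine ⟨chartBall x₀ r, isOpen_chartBall (E := E) x₀ r, mem_chartBall x₀ hr, fun σ => PowerSeries.mk fun k =>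
    ⟨fun x => b k (σ, x), (hb k).comp (contMDiff_const.prodMk contMDiff_id)⟩, fun k => ?_,
    fun σ k x hx => ?_⟩
  · simp only [PowerSeries.coeff_mk]
    exact hb k
  · rw [PowerSeries.coeff_mk]
    exact hYb k σ x hx

theorem exists_isHamiltonianOn (Y : ℕ → Ω.symplecticFields) (x₀ : M) :
    ∃ U : Set M, IsOpen U ∧ x₀ ∈ U ∧ ∃ b, IsHamiltonianOn Y b U := by
  obtain ⟨U, hU, hx, b, -, hb⟩ := exists_isHamiltonianOn_family (F := ℝ) (T := ℝ)
    (Y := fun _ => Y) (fun f k => ContMDiff.comp (I' := 𝓘(ℝ, E))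
      (g := fun x => ((Y k).1 x).deriv f.1) ((Y k).2.1 f.1 f.2) contMDiff_snd) x₀
  exact ⟨U, hU, hx, b 0, hb 0⟩

end Family

namespace StarProduct

variable (S : StarProduct Ω)

section

variable [T2Space M] [IsManifold 𝓘(ℝ, E) ∞ M]

theorem ev_mul_congr {x : M} {U : Set M} (hU : U ∈ nhds x) {f f' g g' : FormalFn E M}
    (hf : ∀ y ∈ U, ev y f = ev y f') (hg : ∀ y ∈ U, ev y g = ev y g') :
    ev x (S.mul f g) = ev x (S.mul f' g') :=
  ((S.isNatural_mul f).ev_congr hU hg).trans ((S.isNatural_flip g').ev_congr hU hf)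

theorem ev_ad_congr {x : M} {U : Set M} (hU : U ∈ nhds x) {f f' g g' : FormalFn E M}
    (hf : ∀ y ∈ U, ev y f = ev y f') (hg : ∀ y ∈ U, ev y g = ev y g') :
    ev x (S.ad f g) = ev x (S.ad f' g') := by
  rw [ad_apply, ad_apply, map_sub, map_sub, S.ev_mul_congr hU hf hg, S.ev_mul_congr hU hg hf]

/-- Near x two Hamiltonians of the same field differ by a constant power series, which is central
for ⋆; as ⋆ is local, the commutators agree at x. -/
theorem ev_ad_eq_of_isHamiltonianOn {Y : ℕ → Ω.symplecticFields} {b c : FormalFn E M} {x : M}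
    {U : Set M} (hU : U ∈ nhds x) (hb : IsHamiltonianOn Y b U) (hc : IsHamiltonianOn Y c U)
    (f : FormalFn E M) : ev x (S.ad b f) = ev x (S.ad c f) := by
  obtain ⟨r, hr, hball, hrU⟩ := exists_chartBall_subset (E := E) hU
  have h (y) (hy : y ∈ chartBall (E := E) x r) : ev y (b - c) = ev y (ev x (b - c) • (1 : FormalFn E M)) := by
    rw [map_smul, ev_one, smul_eq_mul, _root_.mul_one]
    ext k
    rw [coeff_ev, coeff_ev]
    refine Ω.eq_of_hamiltonianField_eq_zero (f := PowerSeries.coeff k (b - c)) hball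
      (fun z hz => ?_) hy (mem_chartBall (E := E) x hr)
    rw [← hb.sub hc k z (hrU hz), sub_self]
    rfl
  have h0 : S.ad b f - S.ad c f = S.ad (b - c) f := by
    simp only [ad_apply, map_sub, LinearMap.sub_apply]
  rw [← sub_eq_zero, ← map_sub, h0,
    S.ev_ad_congr ((isOpen_chartBall (E := E) x r).mem_nhds (mem_chartBall (E := E) x hr)) h
      fun _ _ => rfl,
    ad_smul_one, LinearMap.zero_apply, map_zero]

variable {S}

/-- Local Hamiltonians exist by the Poincaré lemma, so only the commutator clause of the
correspondence carries information. -/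
theorem corresponds_iff {B : FormalOp E M} {Y : ℕ → Ω.symplecticFields} :
    S.Corresponds B Y ↔ ∀ (U : Set M) (b : FormalFn E M), IsOpen U → IsHamiltonianOn Y b U →
      ∀ f, ∀ x ∈ U, ev x ((PowerSeries.X : ℂ⟦X⟧) • B f) = ev x (S.ad b f) := by
  have h (b f : FormalFn E M) (x : M) :
      (∀ k, (PowerSeries.coeff k (PowerSeries.X * B f) : SmoothFn E M).1 x =
        (PowerSeries.coeff k (S.mul b f - S.mul f b) : SmoothFn E M).1 x) ↔
      ev x ((PowerSeries.X : ℂ⟦X⟧) • B f) = ev x (S.ad b f) := by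
    rw [PowerSeries.ext_iff]
    simp only [coeff_ev, X_smul, ad_apply]
  refine ⟨fun hB U b hU hb f x hx => (h b f x).1 fun k => hB.2 U b hU hb f k x hx,
    fun hB => ⟨exists_isHamiltonianOn Y, fun U b hU hb f k x hx =>
      (h b f x).2 (hB U b hU hb f x hx) k⟩⟩

/-- Since the commutator does not depend on the choice of Hamiltonian, one Hamiltonian near each
point is enough. -/
theorem corresponds_of_pointwise {B : FormalOp E M} {Y : ℕ → Ω.symplecticFields}
    (h : ∀ x, ∃ U ∈ nhds x, ∃ b, IsHamiltonianOn Y b U ∧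
      ∀ f, ev x ((PowerSeries.X : ℂ⟦X⟧) • B f) = ev x (S.ad b f)) : S.Corresponds B Y := by
  refine corresponds_iff.2 fun U b hU hb f x hx => ?_
  obtain ⟨V, hV, c, hc, hBc⟩ := h x
  rw [hBc, S.ev_ad_eq_of_isHamiltonianOn (Filter.inter_mem hV (hU.mem_nhds hx))
    (hc.mono Set.inter_subset_left) (hb.mono Set.inter_subset_right)]

namespace Corresponds

variable {A B : FormalOp E M} {Y Z : ℕ → Ω.symplecticFields}

theorem exists_local (hB : S.Corresponds B Y) {m : ℕ} (hm : ∀ k < m, Y k = 0) (x : M) :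
    ∃ U, IsOpen U ∧ x ∈ U ∧ ∃ d : FormalFn E M,
      IsHamiltonianOn Y ((PowerSeries.X ^ m : ℂ⟦X⟧) • d) U ∧ ∀ f, ∀ y ∈ U,
        ev y ((PowerSeries.X : ℂ⟦X⟧) • B f) = ev y ((PowerSeries.X ^ m : ℂ⟦X⟧) • S.ad d f) := by
  obtain ⟨U, hU, hx, b, hb⟩ := exists_isHamiltonianOn Y x
  obtain ⟨d, hd⟩ := hb.exists_X_pow_smul hm
  refine ⟨U, hU, hx, d, hd, fun f y hy => ?_⟩
  rw [corresponds_iff.1 hB U _ hU hd f y hy, map_smul, LinearMap.smul_apply]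

theorem exists_ad (hB : S.Corresponds B Y) (x : M) : ∃ U, IsOpen U ∧ x ∈ U ∧ ∃ b,
    IsHamiltonianOn Y b U ∧ ∀ f, ∀ y ∈ U,
      ev y ((PowerSeries.X : ℂ⟦X⟧) • B f) = ev y (S.ad b f) := by
  obtain ⟨U, hU, hx, b, hb⟩ := exists_isHamiltonianOn Y x
  exact ⟨U, hU, hx, b, hb, corresponds_iff.1 hB U b hU hb⟩

theorem add (hA : S.Corresponds A Y) (hB : S.Corresponds B Z) :
    S.Corresponds (A + B) (Y + Z) := by
  refine corresponds_of_pointwise fun x => ?_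
  obtain ⟨U, hU, hxU, b, hb, hAb⟩ := hA.exists_ad x
  obtain ⟨V, hV, hxV, c, hc, hBc⟩ := hB.exists_ad x
  refine ⟨U ∩ V, (hU.inter hV).mem_nhds ⟨hxU, hxV⟩, b + c, (hb.mono Set.inter_subset_left).add
    (hc.mono Set.inter_subset_right), fun f => ?_⟩
  rw [LinearMap.add_apply, smul_add, map_add, hAb f x hxU, hBc f x hxV, map_add S.ad,
    LinearMap.add_apply, map_add]

theorem smul (a : ℂ) (hA : S.Corresponds A Y) : S.Corresponds (a • A) (a • Y) := by
  refine corresponds_of_pointwise fun x => ?_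
  obtain ⟨U, hU, hxU, b, hb, hAb⟩ := hA.exists_ad x
  have h (p : FormalFn E M) : a • p = (a • (1 : ℂ⟦X⟧)) • p := by rw [smul_assoc, one_smul]
  refine ⟨U, hU.mem_nhds hxU, a • b, hb.smul a, fun f => ?_⟩
  rw [LinearMap.smul_apply, h, h, smul_comm, map_smul (ev x), hAb f x hxU, map_smul S.ad,
    LinearMap.smul_apply, map_smul]

theorem sub (hA : S.Corresponds A Y) (hB : S.Corresponds B Z) :
    S.Corresponds (A - B) (Y - Z) := by
  refine corresponds_of_pointwise fun x => ?_
  obtain ⟨U, hU, hxU, b, hb, hAb⟩ := hA.exists_ad x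
  obtain ⟨V, hV, hxV, c, hc, hBc⟩ := hB.exists_ad x
  refine ⟨U ∩ V, (hU.inter hV).mem_nhds ⟨hxU, hxV⟩, b - c, (hb.mono Set.inter_subset_left).sub
    (hc.mono Set.inter_subset_right), fun f => ?_⟩
  rw [LinearMap.sub_apply, smul_sub, map_sub, hAb f x hxU, hBc f x hxV, map_sub S.ad,
    LinearMap.sub_apply, map_sub]

theorem unique (hA : S.Corresponds A Y) (hB : S.Corresponds B Y) : A = B := by
  ext1 f
  refine ext_ev fun x => ?_
  obtain ⟨U, hU, hxU, b, hb, hAb⟩ := hA.exists_ad x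
  have h := (hAb f x hxU).trans (corresponds_iff.1 hB U b hU hb f x hxU).symm
  rw [map_smul, map_smul] at h
  exact mul_left_cancel₀ PowerSeries.X_ne_zero h

/-- The leading coefficient of the derivation that corresponds to `∑ Y_k h^k`. -/
theorem leading_coeff (hB : S.Corresponds B Y) {m : ℕ} (hm : ∀ k < m, Y k = 0)
    (f : FormalFn E M) :
    (∀ k < m, PowerSeries.coeff k (B f) = 0) ∧ ∀ x, (PowerSeries.coeff m (B f) : SmoothFn E M).1 x =
      Complex.I * ((Y m).1 x).deriv (PowerSeries.coeff 0 f : SmoothFn E M).1 := by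
  have key (k : ℕ) (x : M) : ∃ d : FormalFn E M, Ω.hamiltonianField
        (PowerSeries.coeff 0 d : SmoothFn E M).1 x = (Y m).1 x ∧
      (PowerSeries.coeff k (B f) : SmoothFn E M).1 x =
        (PowerSeries.coeff (k + 1) ((PowerSeries.X ^ m : ℂ⟦X⟧) • S.ad d f) : SmoothFn E M).1 x := by
    obtain ⟨U, hU, hxU, d, hd, hBd⟩ := hB.exists_local hm x
    refine ⟨d, ?_, ?_⟩
    · have := hd m x hxU
      have h0 := coeff_X_pow_smul_add m 0 d
      rw [zero_add] at h0
      rw [this, h0]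
    · rw [← coeff_ev x _ (k + 1), ← hBd f x hxU, coeff_ev, coeff_succ_X_smul]
  refine ⟨fun k hk => ?_, fun x => ?_⟩
  · ext x
    obtain ⟨d, -, hd⟩ := key k x
    rw [hd]
    -- Division by h shifts degree k to k + 1. In the borderline case k + 1 = m the coefficient
    -- still vanishes, because commutators vanish modulo h.
    obtain hk | rfl := Nat.lt_or_eq_of_le (Nat.succ_le_of_lt hk)
    · rw [coeff_X_pow_smul_of_lt hk]
    · have h := coeff_X_pow_smul_add (k + 1) 0 (S.ad d f)
      rw [zero_add, coeff_zero_ad] at h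
      rw [h]
  · obtain ⟨d, hY, hd⟩ := key m x
    rw [hd, add_comm, coeff_X_pow_smul_add, coeff_one_ad, ← hY]
    exact congrArg (Complex.I * ·) (S.bracket_apply _ _ x)

/-- The first nonzero Y_m would be visible as the leading coefficient iY_m of the operator. -/
theorem eq_zero (hY : S.Corresponds 0 Y) : Y = 0 := by
  funext m
  induction m using Nat.strong_induction_on with
  | _ m ih =>
    refine Subtype.ext (funext fun x => ComplexTangent.ext_deriv fun f => ?_)
    have h := (hY.leading_coeff ih (PowerSeries.C f)).2 x
    rw [LinearMap.zero_apply, map_zero, PowerSeries.coeff_zero_C] at h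
    have h' := (mul_eq_zero.1 h.symm).resolve_left Complex.I_ne_zero
    rw [h']
    exact (map_zero (LinearMap.liftBaseChange ℂ _)).symm

/-- Commutators are derivations. As hB is a commutator only near x, locality of ⋆ is needed to carry
the identity through the products; then h is cancelled. -/
theorem map_mul (hB : S.Corresponds B Y) (f g : FormalFn E M) :
    B (S.mul f g) = S.mul (B f) g + S.mul f (B g) := by
  refine ext_ev fun x => ?_
  obtain ⟨U, hU, hxU, b, hb, hBb⟩ := hB.exists_ad x
  have hU' := hU.mem_nhds hxU
  have h1 := S.ev_mul_congr hU' (hBb f) (fun _ _ => rfl : ∀ y ∈ U, ev y g = ev y g)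
  have h2 := S.ev_mul_congr hU' (fun _ _ => rfl : ∀ y ∈ U, ev y f = ev y f) (hBb g)
  have h3 := hBb (S.mul f g) x hxU
  rw [ad_mul, map_add, ← h1, ← h2, map_smul S.mul, LinearMap.smul_apply, map_smul (S.mul f),
    map_smul, map_smul, map_smul, ← smul_add] at h3
  rw [map_add]
  exact mul_left_cancel₀ PowerSeries.X_ne_zero h3

theorem mem_derivations (hB : S.Corresponds B Y) (hY : Y 0 = 0) : B ∈ S.derivations :=
  ⟨hB.map_mul, fun f => (hB.leading_coeff (m := 1)
    (fun k hk => by rw [Nat.lt_one_iff.1 hk, hY]) f).1 0 one_pos⟩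

/-- If Y_0 = 0 the local Hamiltonian can be written hd, and the division by h disappears: locally B
= [d, ·]. With a general b the k-th coefficient of B would be the (k + 1)-st of a natural operator,
and naturality would give only order k + 1. -/
theorem isNatural (hB : S.Corresponds B Y) (hY : Y 0 = 0) : B.IsNatural := fun k => by
  refine isDiffOp_of_pointwise fun x => ?_
  obtain ⟨U, hU, hxU, d, hd, hBd⟩ := hB.exists_local (m := 1)
    (fun k hk => by rw [Nat.lt_one_iff.1 hk, hY]) x
  refine ⟨(S.ad d).coeff k, S.isNatural_ad d k, fun f => ?_⟩
  have h := congrArg (PowerSeries.coeff (R := ℂ) (k + 1)) (hBd (PowerSeries.C f) x hxU)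
  rwa [pow_one, coeff_ev, coeff_ev, coeff_succ_X_smul, coeff_succ_X_smul] at h

end Corresponds

variable (S)

/-- The value at x is computed with the Hamiltonian chosen at x. Near x₀ all these choices give the
same result as the one at x₀, which yields smoothness. Commutators vanish modulo h, so dividing by h
loses nothing. -/
theorem exists_corresponds (Y : ℕ → Ω.symplecticFields) : ∃ B, S.Corresponds B Y := by
  choose U hU hxU b hb using exists_isHamiltonianOn (Ω := Ω) Y
  let op (f : FormalFn E M) : FormalFn E M := PowerSeries.mk fun k =>
    ⟨fun x => (PowerSeries.coeff (k + 1) (S.ad (b x) f) : SmoothFn E M).1 x, fun x₀ => by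
      refine ((PowerSeries.coeff (k + 1) (S.ad (b x₀) f) : SmoothFn E M).2 x₀).congr_of_eventuallyEq ?_
      filter_upwards [(hU x₀).mem_nhds (hxU x₀)] with x hx
      rw [← coeff_ev, ← coeff_ev]
      exact congrArg _ (S.ev_ad_eq_of_isHamiltonianOn
        (((hU x).inter (hU x₀)).mem_nhds ⟨hxU x, hx⟩) ((hb x).mono Set.inter_subset_left)
        ((hb x₀).mono Set.inter_subset_right) f)⟩
  have hop (f : FormalFn E M) (x : M) : PowerSeries.X * ev x (op f) = ev x (S.ad (b x) f) := by
    ext k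
    rw [coeff_ev]
    cases k with
    | zero =>
      rw [coeff_zero_ad, PowerSeries.coeff_zero_X_mul]
      rfl
    | succ k => rw [PowerSeries.coeff_succ_X_mul, coeff_ev, PowerSeries.coeff_mk]
  refine ⟨⟨⟨op, fun f g => ext_ev fun x => ?_⟩, fun p f => ext_ev fun x => ?_⟩,
    corresponds_of_pointwise fun x => ⟨U x, (hU x).mem_nhds (hxU x), b x, hb x, fun f => ?_⟩⟩
  · refine mul_left_cancel₀ PowerSeries.X_ne_zero ?_
    rw [map_add, mul_add, hop, hop, hop, map_add, map_add]
  · refine mul_left_cancel₀ PowerSeries.X_ne_zero ?_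
    rw [RingHom.id_apply, map_smul, mul_smul_comm, hop]
    change ev x (S.ad (b x) (p • f)) = _
    rw [hop, map_smul, map_smul]
  · rw [map_smul]
    exact hop f x

/-- Successive approximation: A_m is a derivation that vanishes modulo h^m, its leading coefficient
gives Y_m, and subtracting the derivation of Y_m h^m gives A_{m+1}. -/
theorem exists_corresponds_of_mem_derivations {B : FormalOp E M} (hB : B ∈ S.derivations) :
    ∃ Y : ℕ → Ω.symplecticFields, Y 0 = 0 ∧ S.Corresponds B Y := by
  choose φ hφ using S.exists_corresponds
  -- The hypotheses on A are moved inside the existential, with default value Z = 0, so that the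
  -- chosen function is defined on all operators and the recursion can be written before its terms
  -- are known to be derivations.
  have hL : ∀ (A : FormalOp E M) (m : ℕ), ∃ Z : Ω.symplecticFields,
      (∀ f g, A (S.mul f g) = S.mul (A f) g + S.mul f (A g)) →
      (∀ f, ∀ k < m, PowerSeries.coeff k (A f) = 0) → ∀ (f : FormalFn E M) (x : M),
      (PowerSeries.coeff m (A f) : SmoothFn E M).1 x =
        Complex.I * (Z.1 x).deriv (PowerSeries.coeff 0 f : SmoothFn E M).1 := by
    intro A m
    by_cases h : (∀ f g, A (S.mul f g) = S.mul (A f) g + S.mul f (A g)) ∧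
      (∀ f, ∀ k < m, PowerSeries.coeff k (A f) = 0)
    · obtain ⟨Z, hZ, h'⟩ := exists_symplecticField_leading_coeff h.1 h.2
      exact ⟨⟨Z, hZ⟩, fun _ _ => h'⟩
    · exact ⟨0, fun h1 h2 => (h ⟨h1, h2⟩).elim⟩
  choose L hL using hL
  let A : ℕ → FormalOp E M := fun m => Nat.rec B (fun m A => A - φ (Pi.single m (L A m))) m
  let Y : ℕ → Ω.symplecticFields := fun m => L (A m) m
  have hA (m : ℕ) : A (m + 1) = A m - φ (Pi.single m (Y m)) := rfl
  have hφs (m : ℕ) := (hφ (Pi.single m (Y m))).leading_coeff (m := m)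
    fun k hk => Pi.single_eq_of_ne hk.ne _
  have h1 (m : ℕ) : (∀ f g, A m (S.mul f g) = S.mul (A m f) g + S.mul f (A m g)) ∧
      ∀ f, ∀ k < m, PowerSeries.coeff k (A m f) = 0 := by
    induction m with
    | zero => exact ⟨hB.1, fun f k hk => by omega⟩
    | succ m ih =>
      refine ⟨fun f g => ?_, fun f k hk => ?_⟩
      · simp only [hA, LinearMap.sub_apply, ih.1, (hφ _).map_mul, map_sub]
        abel
      · rw [hA, LinearMap.sub_apply, map_sub]
        obtain hk | rfl := Nat.lt_succ_iff_lt_or_eq.1 hk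
        · rw [ih.2 f k hk, (hφs m f).1 k hk, sub_zero]
        · ext x
          change _ - _ = (0 : ℂ)
          rw [(hφs k f).2 x, hL (A k) k ih.1 ih.2 f x, Pi.single_eq_same, sub_self]
  -- What has been subtracted up to stage m corresponds to the truncation of Y at degree m.
  have h2 (m : ℕ) : S.Corresponds (B - A m) (fun k => if k < m then Y k else 0) := by
    induction m with
    | zero =>
      have h0 := (hφ 0).smul 0
      rw [smul_zero] at h0
      convert h0 using 1
      · rw [zero_smul]
        exact sub_self B
      · funext k
        exact if_neg k.not_lt_zero
    | succ m ih =>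
      convert ih.add (hφ (Pi.single m (Y m))) using 1
      · rw [hA]
        abel
      · funext k
        rw [Pi.add_apply]
        obtain hk | rfl | hk := lt_trichotomy k m
        · rw [if_pos hk, if_pos (by omega), Pi.single_eq_of_ne hk.ne, add_zero]
        · rw [if_neg (lt_irrefl k), if_pos k.lt_succ_self, Pi.single_eq_same, zero_add]
        · rw [if_neg (by omega), if_neg (by omega), Pi.single_eq_of_ne hk.ne', add_zero]
  have h3 : B = φ Y := by
    ext1 f
    ext1 k
    -- Both B and the operator of Y agree with that of the truncated field modulo h^(k+1), hence
    -- with each other in degree k.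
    have h4 := ((h2 (k + 1)).sub (hφ Y)).leading_coeff (m := k + 1)
      (fun j hj => by rw [Pi.sub_apply, if_pos hj, sub_self]) f
    have h5 := h4.1 k k.lt_succ_self
    rw [LinearMap.sub_apply, LinearMap.sub_apply, map_sub, map_sub, (h1 (k + 1)).2 f k k.lt_succ_self,
      sub_zero, sub_eq_zero] at h5
    exact h5
  have h4 : S.Corresponds B Y := h3 ▸ hφ Y
  refine ⟨Y, Subtype.ext (funext fun x => ComplexTangent.ext_deriv fun f => ?_), h4⟩
  -- With m = 0 the leading coefficient is iY_0, and it vanishes because B does modulo h.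
  have h5 := (h4.leading_coeff (m := 0) (fun k hk => by omega) (PowerSeries.C f)).2 x
  rw [hB.2, PowerSeries.coeff_zero_C] at h5
  have h' := (mul_eq_zero.1 h5.symm).resolve_left Complex.I_ne_zero
  rw [h']
  exact (map_zero (LinearMap.liftBaseChange ℂ _)).symm

end

end StarProduct

end Correspondence

/-! ## Vector fields through a given tangent vector, constant sections -/

section Parameters

variable {E : Type*} [NormedAddCommGroup E] [NormedSpace ℝ E]
  {M : Type*} [TopologicalSpace M] [ChartedSpace E M]
  {F : Type*} [NormedAddCommGroup F] [NormedSpace ℝ F]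
  {T : Type*} [TopologicalSpace T] [ChartedSpace F T]

/-- A local extension times a cutoff. It makes pointwise values of 1-forms accessible, as
connections are tested only on global vector fields. -/
theorem exists_vectorField_eq [FiniteDimensional ℝ F] [T2Space T] [IsManifold 𝓘(ℝ, F) ∞ T]
    {σ : T} (v : TangentSpace 𝓘(ℝ, F) σ) : ∃ V : VectorFields F T, V σ = v := by
  obtain ⟨s, hs, hsmooth⟩ := FiberBundle.exists_contMDiffOn_extend (k := ∞) 𝓘(ℝ, F) F
    (V := (TangentSpace 𝓘(ℝ, F) : T → Type _)) v
  obtain ⟨u, hus, hu, hσ⟩ := mem_nhds_iff.1 hs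
  obtain ⟨χ, hχ, hχu, r, hr, -, h1⟩ := exists_cutoff (E := F) (hu.mem_nhds hσ)
  refine ⟨⟨χ • FiberBundle.extend F v,
    ContMDiffOn.smul_section_of_tsupport hχ.contMDiffOn hu hχu (hsmooth.mono hus)⟩, ?_⟩
  change χ σ • FiberBundle.extend F v σ = v
  rw [h1 σ (mem_chartBall σ hr), one_smul, FiberBundle.extend_apply_self]

variable (F T) in
/-- The constant section. -/
def constSection (f : FormalFn E M) : Sections E M F T :=
  ⟨fun _ => f, fun k => ContMDiff.comp (I' := 𝓘(ℝ, E))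
    (g := (PowerSeries.coeff k f : SmoothFn E M).1) (PowerSeries.coeff k f).2 contMDiff_snd⟩

theorem Sections.sub_mem {f g : T → FormalFn E M} (hf : f ∈ Sections E M F T)
    (hg : g ∈ Sections E M F T) : (fun σ => f σ - g σ) ∈ Sections E M F T :=
  fun k => (hf k).sub (hg k)

end Parameters

/-! ## Connections and forms with values in derivations -/

section Torsor

open FormalFn

variable {E : Type*} [NormedAddCommGroup E] [NormedSpace ℝ E] [FiniteDimensional ℝ E]
  {M : Type*} [TopologicalSpace M] [ChartedSpace E M] [T2Space M] [IsManifold 𝓘(ℝ, E) ∞ M]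
  {F : Type*} [NormedAddCommGroup F] [NormedSpace ℝ F] [FiniteDimensional ℝ F]
  {T : Type*} [TopologicalSpace T] [ChartedSpace F T] [T2Space T] [IsManifold 𝓘(ℝ, F) ∞ T]
  {Ω : SymplecticForm E M}

theorem StarProduct.isNatural_of_mem_derivations (S : StarProduct Ω) {B : FormalOp E M}
    (hB : B ∈ S.derivations) : B.IsNatural := by
  obtain ⟨Y, hY, h⟩ := S.exists_corresponds_of_mem_derivations hB
  exact h.isNatural hY

omit [T2Space M] [IsManifold 𝓘(ℝ, E) ∞ M] in
theorem StarProduct.exists_linearMap_sub_eq (S : StarProduct Ω) {V : Type*} [AddCommGroup V]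
    [Module ℝ V] (A A' : V →ₗ[ℝ] FormalOp E M) (h : ∀ v, A v - A' v ∈ S.derivations) :
    ∃ L : V →ₗ[ℝ] S.derivations, ∀ v, (L v).1 = A v - A' v := by
  let C : V →ₗ[ℝ] FormalOp E M := A + (-1 : ℝ) • A'
  have hC (v) : C v = A v - A' v := by
    change (A + (-1 : ℝ) • A') v = _
    rw [LinearMap.add_apply, LinearMap.smul_apply]
    ext1 f
    rw [LinearMap.add_apply, LinearMap.smul_apply, neg_one_smul, LinearMap.sub_apply, sub_eq_add_neg]
  have hC' (v) : C v ∈ S.derivations.restrictScalars ℝ := by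
    rw [hC]
    exact h v
  exact ⟨C.codRestrict (S.derivations.restrictScalars ℝ) hC', hC⟩

namespace StarFamily

variable (S : StarFamily F T Ω)

omit [T2Space M] [IsManifold 𝓘(ℝ, E) ∞ M] in
theorem toOp_injective : Function.Injective S.toOp := by
  intro β β' h
  refine Subtype.ext (funext fun σ => LinearMap.ext fun v => Subtype.ext (LinearMap.ext fun f => ?_))
  obtain ⟨V, rfl⟩ := exists_vectorField_eq v
  have h1 := congrArg (fun D : CovariantOp E M F T => (D V (constSection F T f)).1 σ) h
  exact h1

/-- The compatible formal connections form an affine space over the forms with values in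
derivations. -/
theorem bijOn_toOp {D₀ : CovariantOp E M F T} (hD₀ : D₀ ∈ S.compatibleConnections) :
    Set.BijOn (fun β : S.derivationForms => D₀ + S.toOp β) Set.univ S.compatibleConnections := by
  obtain ⟨⟨A₀, hA₀, hnat₀, hDA₀⟩, hcomp₀⟩ := hD₀
  refine ⟨fun β _ => ?_, fun β _ β' _ h => S.toOp_injective (add_left_cancel h), fun D hD => ?_⟩
  · refine ⟨⟨fun σ => A₀ σ + ((S.star σ).derivations.subtype.restrictScalars ℝ) ∘ₗ β.1 σ,
      fun V f => (Sections E M F T).add_mem (hA₀ V f) (β.2 V f), fun σ v => ⟨?_, ?_⟩,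
      fun V f => ?_⟩, fun V f g => ?_⟩
    -- The one point where the structure of derivations enters: naturality is not part of the
    -- definition of Der₀.
    · exact (hnat₀ σ v).1.add ((S.star σ).isNatural_of_mem_derivations (β.1 σ v).2)
    · exact (hnat₀ σ v).2.add (β.1 σ v).2.2
    · change D₀ V f + S.toOp β V f = _
      rw [hDA₀, add_assoc]
      rfl
    · change D₀ V (S.mul f g) + S.toOp β V (S.mul f g) =
        S.mul (D₀ V f + S.toOp β V f) g + S.mul f (D₀ V g + S.toOp β V g)
      rw [hcomp₀]
      refine Subtype.ext (funext fun σ => ?_)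
      have h1 := (β.1 σ (V σ)).2.1 (f.1 σ) (g.1 σ)
      change (S.star σ).mul ((D₀ V f).1 σ) (g.1 σ) + (S.star σ).mul (f.1 σ) ((D₀ V g).1 σ) +
        (β.1 σ (V σ)).1 ((S.star σ).mul (f.1 σ) (g.1 σ)) =
        (S.star σ).mul ((D₀ V f).1 σ + (β.1 σ (V σ)).1 (f.1 σ)) (g.1 σ) +
        (S.star σ).mul (f.1 σ) ((D₀ V g).1 σ + (β.1 σ (V σ)).1 (g.1 σ))
      rw [h1, map_add, map_add, LinearMap.add_apply]
      abel
  · obtain ⟨⟨A, hA, hnat, hDA⟩, hcomp⟩ := hD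
    have hmem (σ : T) (v : TangentSpace 𝓘(ℝ, F) σ) : A σ v - A₀ σ v ∈ (S.star σ).derivations := by
      refine ⟨fun f g => ?_, (hnat σ v).2.sub (hnat₀ σ v).2⟩
      obtain ⟨V, rfl⟩ := exists_vectorField_eq v
      -- V[·] need not be a derivation of ⋆_σ, as the product varies with σ. It cancels in the
      -- difference, which therefore acts fibrewise and can be tested on constant sections.
      have h (f : Sections E M F T) : (D V f).1 σ - (D₀ V f).1 σ =
          A σ (V σ) (f.1 σ) - A₀ σ (V σ) (f.1 σ) := by
        rw [hDA, hDA₀]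
        exact add_sub_add_left_eq_sub _ _ _
      have h1 := h (S.mul (constSection F T f) (constSection F T g))
      have h2 := h (constSection F T f)
      have h3 := h (constSection F T g)
      rw [hcomp, hcomp₀] at h1
      change (A σ (V σ)) ((S.star σ).mul f g) - (A₀ σ (V σ)) ((S.star σ).mul f g) =
        (S.star σ).mul (A σ (V σ) f - A₀ σ (V σ) f) g + (S.star σ).mul f (A σ (V σ) g - A₀ σ (V σ) g)
      refine h1.symm.trans ?_
      refine Eq.trans ?_ (congrArg₂ (fun a b => (S.star σ).mul a g + (S.star σ).mul f b) h2 h3)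
      simp only [map_sub, LinearMap.sub_apply]
      exact add_sub_add_comm _ _ _ _
    have hβ (σ : T) : ∃ L : TangentSpace 𝓘(ℝ, F) σ →ₗ[ℝ] (S.star σ).derivations,
        ∀ v, (L v).1 = A σ v - A₀ σ v :=
      (S.star σ).exists_linearMap_sub_eq (A σ) (A₀ σ) (hmem σ)
    choose β hβ using hβ
    have hβ' (σ : T) (v : TangentSpace 𝓘(ℝ, F) σ) (f : FormalFn E M) :
        (β σ v).1 f = A σ v f - A₀ σ v f := by
      rw [hβ]
      rfl
    have hsm : β ∈ S.derivationForms := fun V f => by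
      have h := Sections.sub_mem (hA V f) (hA₀ V f)
      simp only [← hβ'] at h
      exact h
    refine ⟨⟨β, hsm⟩, Set.mem_univ _, ?_⟩
    funext V f
    refine Subtype.ext (funext fun σ => ?_)
    have h1 : (D V f).1 σ = (alongDeriv V f).1 σ + A σ (V σ) (f.1 σ) := by
      rw [hDA]
      rfl
    have h0 : (D₀ V f).1 σ = (alongDeriv V f).1 σ + A₀ σ (V σ) (f.1 σ) := by
      rw [hDA₀]
      rfl
    change (D₀ V f).1 σ + (β σ (V σ)).1 (f.1 σ) = (D V f).1 σ
    rw [h1, h0, hβ']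
    abel

end StarFamily

end Torsor

/-! ## Forms with values in formal symplectic vector fields -/

section SymplecticForms

open FormalFn

variable {E : Type*} [NormedAddCommGroup E] [NormedSpace ℝ E] [FiniteDimensional ℝ E]
  {M : Type*} [TopologicalSpace M] [ChartedSpace E M] [T2Space M] [IsManifold 𝓘(ℝ, E) ∞ M]
  {Ω : SymplecticForm E M}

namespace StarProduct

variable (S : StarProduct Ω)

theorem exists_symplecticEquiv : ∃ φ : formalSymplecticFields Ω ≃ₗ[ℂ] S.derivations,
    ∀ Y, S.Corresponds (φ Y).1 Y.1 := by
  choose φ hφ using S.exists_corresponds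
  let φ₁ : formalSymplecticFields Ω →ₗ[ℂ] S.derivations :=
    { toFun := fun Y => ⟨φ Y.1, (hφ Y.1).mem_derivations Y.2⟩
      map_add' := fun Y Z => Subtype.ext ((hφ _).unique ((hφ Y.1).add (hφ Z.1)))
      map_smul' := fun c Y => Subtype.ext ((hφ _).unique ((hφ Y.1).smul c)) }
  refine ⟨LinearEquiv.ofBijective φ₁ ⟨fun Y Z h => ?_, fun B => ?_⟩, fun Y => hφ Y.1⟩
  · have h1 : φ Y.1 = φ Z.1 := congrArg Subtype.val h
    have h2 := (hφ Y.1).sub (hφ Z.1)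
    have h0 : φ Y.1 - φ Z.1 = 0 := by
      ext1 f
      rw [LinearMap.sub_apply, h1, sub_self, LinearMap.zero_apply]
    rw [h0] at h2
    exact Subtype.ext (sub_eq_zero.1 h2.eq_zero)
  · obtain ⟨Y, hY, h⟩ := S.exists_corresponds_of_mem_derivations B.2
    exact ⟨⟨Y, hY⟩, Subtype.ext ((hφ Y).unique h)⟩

/-- The correspondence between formal symplectic vector fields and derivations. -/
def symplecticEquiv : formalSymplecticFields Ω ≃ₗ[ℂ] S.derivations :=
  S.exists_symplecticEquiv.choose

theorem corresponds_symplecticEquiv (Y : formalSymplecticFields Ω) :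
    S.Corresponds (S.symplecticEquiv Y).1 Y.1 :=
  S.exists_symplecticEquiv.choose_spec Y

end StarProduct

variable {F : Type*} [NormedAddCommGroup F] [NormedSpace ℝ F] [FiniteDimensional ℝ F]
  {T : Type*} [TopologicalSpace T] [ChartedSpace F T] [IsManifold 𝓘(ℝ, F) ∞ T]

namespace StarFamily

variable (S : StarFamily F T Ω)

omit [T2Space M] [IsManifold 𝓘(ℝ, E) ∞ M] [FiniteDimensional ℝ F]
  [IsManifold 𝓘(ℝ, F) ∞ T] in
theorem ad_mem_sections {b f : T → FormalFn E M} (hb : b ∈ Sections E M F T)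
    (hf : f ∈ Sections E M F T) : (fun σ => (S.star σ).ad (b σ) (f σ)) ∈ Sections E M F T :=
  Sections.sub_mem (S.smooth ⟨b, hb⟩ ⟨f, hf⟩) (S.smooth ⟨f, hf⟩ ⟨b, hb⟩)

variable {Y : T → ℕ → Ω.symplecticFields} {B : T → FormalOp E M}

/-- The derivations that correspond to a smooth family of formal symplectic vector fields form a
smooth family. -/
theorem mem_sections_of_corresponds (hY : ∀ (f : SmoothFn E M) (k : ℕ),
      ContMDiff (𝓘(ℝ, F).prod 𝓘(ℝ, E)) 𝓘(ℝ, ℂ) ∞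
        (fun p : T × M => ((Y p.1 k).1 p.2).deriv f.1))
    (hB : ∀ σ, (S.star σ).Corresponds (B σ) (Y σ)) {f : T → FormalFn E M}
    (hf : f ∈ Sections E M F T) : (fun σ => B σ (f σ)) ∈ Sections E M F T := by
  rintro k ⟨σ₀, x₀⟩
  obtain ⟨U, hU, hx, b, hb, hbY⟩ := exists_isHamiltonianOn_family hY x₀
  -- Over U the k-th coefficient of B is the (k + 1)-st of the commutator with b, and b is a smooth
  -- family.
  refine (S.ad_mem_sections hb hf (k + 1) (σ₀, x₀)).congr_of_eventuallyEq ?_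
  filter_upwards [(hU.preimage continuous_snd).mem_nhds (show (σ₀, x₀) ∈ Prod.snd ⁻¹' U from hx)]
    with p hp
  have h := StarProduct.corresponds_iff.1 (hB p.1) U (b p.1) hU (hbY p.1) (f p.1) p.2 hp
  have h1 := congrArg (PowerSeries.coeff (R := ℂ) (k + 1)) h
  rwa [coeff_ev, coeff_ev, coeff_succ_X_smul] at h1

/-- The formal symplectic vector fields that correspond to a smooth family of derivations form a
smooth family. -/
theorem contMDiff_of_corresponds (hB : ∀ σ, (S.star σ).Corresponds (B σ) (Y σ))
    (hsm : ∀ f : SmoothFn E M, (fun σ => B σ (PowerSeries.C f)) ∈ Sections E M F T)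
    (f : SmoothFn E M) (k : ℕ) : ContMDiff (𝓘(ℝ, F).prod 𝓘(ℝ, E)) 𝓘(ℝ, ℂ) ∞
      (fun p : T × M => ((Y p.1 k).1 p.2).deriv f.1) := by
  induction k using Nat.strong_induction_on generalizing f with
  | _ k ih =>
    -- The coefficients below k form a smooth family by induction, hence so do their derivations.
    -- After subtracting these, the k-th coefficient is exactly iY_k, recovered by the factor -i
    -- below.
    let Y' : T → ℕ → Ω.symplecticFields := fun σ j => if j < k then Y σ j else 0
    have hY' (f : SmoothFn E M) (j : ℕ) : ContMDiff (𝓘(ℝ, F).prod 𝓘(ℝ, E)) 𝓘(ℝ, ℂ) ∞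
        (fun p : T × M => ((Y' p.1 j).1 p.2).deriv f.1) := by
      by_cases hj : j < k
      · simp only [Y', if_pos hj]
        exact ih j hj f
      · simp only [Y', if_neg hj]
        convert (contMDiff_const (c := (0 : ℂ))) using 1
        funext p
        exact map_zero (LinearMap.liftBaseChange ℂ _)
    choose B' hB' using fun σ => (S.star σ).exists_corresponds (Y' σ)
    have h1 := S.mem_sections_of_corresponds hY' hB' (constSection F T (PowerSeries.C f)).2 k
    have h2 := (contDiff_const_smul (-Complex.I)).comp_contMDiff ((hsm f k).sub h1)
    refine h2.congr fun p => ?_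
    have h3 := (((hB p.1).sub (hB' p.1)).leading_coeff (m := k) (fun j hj => by
      simp only [Pi.sub_apply, Y', if_pos hj, sub_self]) (PowerSeries.C f)).2 p.2
    have h4 : (Y p.1 - Y' p.1) k = Y p.1 k := by
      simp only [Pi.sub_apply, Y', lt_irrefl, if_false, sub_zero]
    rw [h4, PowerSeries.coeff_zero_C, LinearMap.sub_apply, map_sub] at h3
    change _ = -Complex.I * ((PowerSeries.coeff k (B p.1 (PowerSeries.C f)) : SmoothFn E M).1 p.2 -
      (PowerSeries.coeff k (B' p.1 (PowerSeries.C f)) : SmoothFn E M).1 p.2)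
    refine Eq.trans ?_ (congrArg (-Complex.I * ·) h3.symm)
    rw [← mul_assoc]
    simp

end StarFamily

section OneForms

variable {N N' : T → Type*} [∀ σ, AddCommMonoid (N σ)] [∀ σ, Module ℝ (N σ)]
  [∀ σ, Module ℂ (N σ)] [∀ σ, SMulCommClass ℝ ℂ (N σ)]
  [∀ σ, AddCommMonoid (N' σ)] [∀ σ, Module ℝ (N' σ)]
  [∀ σ, Module ℂ (N' σ)] [∀ σ, SMulCommClass ℝ ℂ (N' σ)]
  [∀ σ, LinearMap.CompatibleSMul (N σ) (N' σ) ℝ ℂ] [∀ σ, LinearMap.CompatibleSMul (N' σ) (N σ) ℝ ℂ]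

/-- Linear isomorphisms between the value spaces induce isomorphisms between spaces of `1`-forms. -/
def oneFormEquiv (e : ∀ σ, N σ ≃ₗ[ℂ] N' σ) (P : Submodule ℂ (RawOneForm F T N))
    (P' : Submodule ℂ (RawOneForm F T N'))
    (h : ∀ α ∈ P, (fun σ => ((e σ).toLinearMap.restrictScalars ℝ) ∘ₗ α σ) ∈ P')
    (h' : ∀ α ∈ P', (fun σ => ((e σ).symm.toLinearMap.restrictScalars ℝ) ∘ₗ α σ) ∈ P) :
    P ≃ₗ[ℂ] P' where
  toFun α := ⟨_, h α.1 α.2⟩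
  invFun α := ⟨_, h' α.1 α.2⟩
  map_add' _ _ := Subtype.ext (funext fun σ => LinearMap.ext fun _ => map_add (e σ) _ _)
  map_smul' _ _ := Subtype.ext (funext fun σ => LinearMap.ext fun _ => map_smul (e σ) _ _)
  left_inv _ := Subtype.ext (funext fun σ => LinearMap.ext fun _ => (e σ).symm_apply_apply _)
  right_inv _ := Subtype.ext (funext fun σ => LinearMap.ext fun _ => (e σ).apply_symm_apply _)

end OneForms

namespace StarFamily

variable (S : StarFamily F T Ω)

/-- The correspondence between symplectic forms and forms with values in derivations. -/
theorem exists_symplecticFormsEquiv : ∃ Φ : symplecticForms F T Ω ≃ₗ[ℂ] S.derivationForms,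
    ∀ Y σ v, (Φ Y).1 σ v = (S.star σ).symplecticEquiv (Y.1 σ v) :=
  ⟨oneFormEquiv (fun σ => (S.star σ).symplecticEquiv) _ _
    (fun Y hY V f => S.mem_sections_of_corresponds (Y := fun σ => (Y σ (V σ)).1) (hY V)
      (fun σ => (S.star σ).corresponds_symplecticEquiv _) f.2)
    (fun β hβ V => S.contMDiff_of_corresponds
      (Y := fun σ => ((S.star σ).symplecticEquiv.symm (β σ (V σ))).1) (B := fun σ => (β σ (V σ)).1)
      (fun σ => by
        have h := (S.star σ).corresponds_symplecticEquiv ((S.star σ).symplecticEquiv.symm (β σ (V σ)))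
        rwa [LinearEquiv.apply_symm_apply] at h)
      fun f => hβ V (constSection F T (PowerSeries.C f))),
    fun _ _ _ => rfl⟩

end StarFamily

end SymplecticForms

/-! ## Formal functions modulo constants -/

section FunctionForms

open FormalFn

variable {E : Type*} [NormedAddCommGroup E] [NormedSpace ℝ E] [FiniteDimensional ℝ E]
  {M : Type*} [TopologicalSpace M] [ChartedSpace E M] [IsManifold 𝓘(ℝ, E) ∞ M]
  {Ω : SymplecticForm E M}

omit [IsManifold 𝓘(ℝ, E) ∞ M] in
theorem hamiltonianField_coeff_congr {b c : FormalFn E M}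
    (h : (Submodule.Quotient.mk b : FormalFnModConst E M) = Submodule.Quotient.mk c)
    (k : ℕ) (x : M) : Ω.hamiltonianField (PowerSeries.coeff k b : SmoothFn E M).1 x =
      Ω.hamiltonianField (PowerSeries.coeff k c : SmoothFn E M).1 x := by
  obtain ⟨p, hp⟩ := (Submodule.Quotient.eq _).1 h
  rw [← sub_eq_zero, ← Ω.hamiltonianField_sub, ← map_sub, ← hp]
  have h1 : (PowerSeries.coeff k (Algebra.linearMap ℂ⟦X⟧ (FormalFn E M) p) : SmoothFn E M).1 =
      fun _ => PowerSeries.coeff k p := by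
    funext y
    change (PowerSeries.coeff k (PowerSeries.map (algebraMap ℂ (SmoothFn E M)) p) :
      SmoothFn E M).1 y = _
    rw [PowerSeries.coeff_map]
    rfl
  rw [h1, Ω.hamiltonianField_const]

theorem mk_eq_mk_of_hamiltonianField_eq [PreconnectedSpace M] {b c : FormalFn E M}
    (h : ∀ k x, Ω.hamiltonianField (PowerSeries.coeff k b : SmoothFn E M).1 x =
      Ω.hamiltonianField (PowerSeries.coeff k c : SmoothFn E M).1 x) :
    (Submodule.Quotient.mk b : FormalFnModConst E M) = Submodule.Quotient.mk c := by
  rw [Submodule.Quotient.eq]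
  -- Preconnectedness allows M to be empty. Otherwise the constant is the value at x₁.
  obtain hM | ⟨⟨x₁⟩⟩ := isEmpty_or_nonempty M
  · exact ⟨0, ext_ev fun x => isEmptyElim x⟩
  · refine ⟨ev x₁ (b - c), ext_ev fun x => ?_⟩
    rw [Algebra.linearMap_apply, Algebra.algebraMap_eq_smul_one, map_smul, ev_one, smul_eq_mul,
      mul_one]
    ext k
    rw [coeff_ev, coeff_ev]
    refine Ω.eq_of_hamiltonianField_eq_zero_of_preconnected (fun y => ?_) x₁ x
    rw [map_sub, Ω.hamiltonianField_sub, h, sub_self]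

variable [T2Space M]

namespace StarProduct

variable (S : StarProduct Ω)

-- By the Jacobi identity {f, ·} is a derivation of the bracket. The star product supplies this
-- identity and a bracket with values in smooth functions.
include S in
theorem hamiltonianField_mem_symplecticFields (f : SmoothFn E M) :
    Ω.hamiltonianField f.1 ∈ Ω.symplecticFields := by
  refine Ω.mem_symplecticFields_of_bracket (br := S.bracket) (fun f g x => S.bracket_apply f g x)
    S.bracket_swap S.bracket_bracket (P := S.bracket f) (fun g k => ?_)
    (fun g x => (S.bracket_apply f g x).symm)
  have h := S.bracket_bracket f g k
  rw [S.bracket_swap (S.bracket f g) k, ← h]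
  abel

-- Connectedness gives injectivity, since only constants have zero Hamiltonian field; vanishing of
-- H¹ gives surjectivity.
include S in
theorem exists_hamiltonianEquiv [PreconnectedSpace M] (hH : Subsingleton (DeRhamH1 E M)) :
    ∃ e : hFormalFnModConst E M ≃ₗ[ℂ] formalSymplecticFields Ω,
      ∀ β (b : FormalFn E M), Submodule.Quotient.mk b = β.1 → IsHamiltonianOn (e β).1 b Set.univ := by
  have hrep (β : hFormalFnModConst E M) : ∃ b : FormalFn E M, Submodule.Quotient.mk b = β.1 ∧
      PowerSeries.coeff 0 b = 0 := by
    obtain ⟨γ, hγ⟩ := β.2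
    obtain ⟨c, rfl⟩ := Submodule.Quotient.mk_surjective _ γ
    exact ⟨(PowerSeries.X : ℂ⟦X⟧) • c, hγ, coeff_zero_X_smul c⟩
  choose r hr hr0 using hrep
  let Y (b : FormalFn E M) (k : ℕ) : Ω.symplecticFields :=
    ⟨_, S.hamiltonianField_mem_symplecticFields (PowerSeries.coeff k b)⟩
  have hY {b c : FormalFn E M}
      (h : (Submodule.Quotient.mk b : FormalFnModConst E M) = Submodule.Quotient.mk c) : Y b = Y c :=
    funext fun k => Subtype.ext (funext fun x => hamiltonianField_coeff_congr h k x)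
  let e : hFormalFnModConst E M →ₗ[ℂ] formalSymplecticFields Ω :=
    { toFun := fun β => ⟨Y (r β), Subtype.ext (funext fun x => by
        change Ω.hamiltonianField (PowerSeries.coeff 0 (r β) : SmoothFn E M).1 x = 0
        rw [hr0]
        exact Ω.hamiltonianField_const 0 x)⟩
      map_add' := fun β γ => Subtype.ext ((hY (c := r β + r γ) (by
        rw [Submodule.Quotient.mk_add, hr, hr, hr]
        rfl)).trans (funext fun k => Subtype.ext (funext fun x =>
          (congrArg (fun f : SmoothFn E M => Ω.hamiltonianField f.1 x) (map_add _ _ _)).trans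
            (Ω.hamiltonianField_add _ _ x))))
      map_smul' := fun a β => Subtype.ext ((hY (c := a • r β) (by
        rw [hr]
        exact congrArg (a • ·) (hr β).symm)).trans (funext fun k => Subtype.ext (funext fun x =>
          (congrArg (fun f : SmoothFn E M => Ω.hamiltonianField f.1 x)
            (PowerSeries.coeff_smul _ _ _)).trans (Ω.hamiltonianField_smul _ _ x)))) }
  have he (β) (b : FormalFn E M) (hb : Submodule.Quotient.mk b = β.1) :
      IsHamiltonianOn (e β).1 b Set.univ := fun k x _ =>
    hamiltonianField_coeff_congr ((hr β).trans hb.symm) k x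
  refine ⟨LinearEquiv.ofBijective e ⟨fun β γ h => ?_, fun Z => ?_⟩, he⟩
  · refine Subtype.ext ?_
    rw [← hr β, ← hr γ]
    refine mk_eq_mk_of_hamiltonianField_eq (Ω := Ω) fun k x => ?_
    rw [← he β _ (hr β) k x trivial, h]
    exact he γ _ (hr γ) k x trivial
  · choose b hb using fun k => Ω.exists_hamiltonian_of_subsingleton hH (Z.1 k).2
    -- Since Z_0 = 0, its Hamiltonian b 0 is discarded; the shift by one puts b (k + 1) in degree k
    -- + 1.
    have hβ : (Submodule.Quotient.mk ((PowerSeries.X : ℂ⟦X⟧) •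
        (PowerSeries.mk fun k => b (k + 1) : FormalFn E M)) : FormalFnModConst E M) ∈
        hFormalFnModConst E M := ⟨Submodule.Quotient.mk (PowerSeries.mk fun k => b (k + 1)), rfl⟩
    refine ⟨⟨_, hβ⟩, Subtype.ext (funext fun k => Subtype.ext (funext fun x => ?_))⟩
    rw [he ⟨_, hβ⟩ _ rfl k x trivial]
    cases k with
    | zero =>
      rw [coeff_zero_X_smul, Z.2]
      exact Ω.hamiltonianField_const 0 x
    | succ k => rw [coeff_succ_X_smul, PowerSeries.coeff_mk, hb]

end StarProduct

variable {F : Type*} [NormedAddCommGroup F] [NormedSpace ℝ F] [FiniteDimensional ℝ F]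
  {T : Type*} [TopologicalSpace T] [ChartedSpace F T] [IsManifold 𝓘(ℝ, F) ∞ T]

namespace StarFamily

variable (S : StarFamily F T Ω)

-- The Poisson bracket is -i times the h-coefficient of any of the commutators, so its smoothness in
-- σ is inherited from the family of products.
include S in
omit [T2Space M] [IsManifold 𝓘(ℝ, E) ∞ M] [FiniteDimensional ℝ F] [IsManifold 𝓘(ℝ, F) ∞ T] in
theorem contMDiff_poisson {g : T → FormalFn E M} (hg : g ∈ Sections E M F T) (f : SmoothFn E M)
    (k : ℕ) : ContMDiff (𝓘(ℝ, F).prod 𝓘(ℝ, E)) 𝓘(ℝ, ℂ) ∞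
      (fun p : T × M => Ω.poisson (PowerSeries.coeff k (g p.1) : SmoothFn E M).1 f.1 p.2) := by
  have h1 : (fun σ => PowerSeries.C (PowerSeries.coeff k (g σ))) ∈ Sections E M F T := by
    intro n
    cases n with
    | zero =>
      simp only [PowerSeries.coeff_zero_C]
      exact hg k
    | succ n =>
      simp only [PowerSeries.coeff_succ_C]
      exact contMDiff_const
  refine ((contDiff_const_smul (-Complex.I)).comp_contMDiff
    (S.ad_mem_sections h1 (constSection F T (PowerSeries.C f)).2 1)).congr fun p => ?_
  exact ((S.star p.1).bracket_apply _ f p.2).symm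

include S in
/-- If `H¹(M; ℝ) = 0`, forms with values in formal functions modulo constants correspond to forms
with values in formal symplectic vector fields. -/
theorem exists_functionFormsEquiv [PreconnectedSpace M] (hH : Subsingleton (DeRhamH1 E M))
    (e : T → hFormalFnModConst E M ≃ₗ[ℂ] formalSymplecticFields Ω)
    (he : ∀ σ β (b : FormalFn E M), Submodule.Quotient.mk b = β.1 →
      IsHamiltonianOn (e σ β).1 b Set.univ) :
    ∃ Ψ : functionForms E M F T ≃ₗ[ℂ] symplecticForms F T Ω,
      ∀ β σ v, (Ψ β).1 σ v = e σ (β.1 σ v) := by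
  refine ⟨oneFormEquiv e _ _ (fun β hβ V f k => ?_) (fun Y hY V => ?_), fun _ _ _ => rfl⟩
  · obtain ⟨g, hg⟩ := hβ V
    refine (S.contMDiff_poisson g.2 f k).congr fun p => ?_
    have h := he p.1 (β p.1 (V p.1)) (g.1 p.1) (hg p.1).symm k p.2 trivial
    exact congrArg (fun Z => ComplexTangent.deriv Z f.1) h
  · choose b hb using fun σ k => Ω.exists_hamiltonian_of_subsingleton hH ((Y σ (V σ)).1 k).2
    have hg : ∃ g : Sections E M F T, ∀ σ, IsHamiltonianOn (Y σ (V σ)).1 (g.1 σ) Set.univ := by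
      obtain hM | ⟨⟨x₁⟩⟩ := isEmpty_or_nonempty M
      · exact ⟨⟨0, fun k p => isEmptyElim p.2⟩, fun σ k x => isEmptyElim x⟩
      -- The Hamiltonians were chosen independently for each σ. Normalised to vanish at x₁ they are
      -- trivially smooth in σ there, which forces smoothness everywhere.
      · let c (σ : T) (k : ℕ) : SmoothFn E M := b σ k - algebraMap ℂ (SmoothFn E M) ((b σ k).1 x₁)
        have hc (k : ℕ) (σ : T) (x : M) : ((Y σ (V σ)).1 k).1 x = Ω.hamiltonianField (c σ k).1 x := by
          rw [Ω.hamiltonianField_sub, hb]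
          exact ((congrArg (_ - ·) (Ω.hamiltonianField_const ((b σ k).1 x₁) x)).trans
            (sub_zero _)).symm
        have hc₁ (σ : T) (k : ℕ) : (c σ k).1 x₁ = 0 := sub_self _
        refine ⟨⟨fun σ => PowerSeries.mk (c σ), fun k => ?_⟩, fun σ k x _ => ?_⟩
        · simp only [PowerSeries.coeff_mk]
          refine Ω.contMDiff_hamiltonian_family (fun σ => ((Y σ (V σ)).1 k).2) (fun f => hY V f k)
            (hc k) (x₁ := x₁) ?_
          simp only [hc₁]
          exact contMDiff_const
        · rw [PowerSeries.coeff_mk]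
          exact hc k σ x
    obtain ⟨g, hg⟩ := hg
    refine ⟨g, fun σ => ?_⟩
    obtain ⟨b', hb'⟩ := Submodule.Quotient.mk_surjective _ ((e σ).symm (Y σ (V σ))).1
    have h1 := he σ _ b' hb'
    rw [LinearEquiv.apply_symm_apply] at h1
    refine hb'.symm.trans (mk_eq_mk_of_hamiltonianField_eq (Ω := Ω) fun k x => ?_)
    rw [← h1 k x trivial, hg σ k x trivial]

end StarFamily

end FunctionForms

end FormalConnections

end

set_option maxHeartbeats 1000000 in
theorem mainTheorem3
    {E : Type*} [NormedAddCommGroup E] [NormedSpace ℝ E] [FiniteDimensional ℝ E]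
    {M : Type*} [TopologicalSpace M] [T2Space M] [SecondCountableTopology M]
    [ChartedSpace E M] [IsManifold 𝓘(ℝ, E) ∞ M]
    {F : Type*} [NormedAddCommGroup F] [NormedSpace ℝ F] [FiniteDimensional ℝ F]
    {T : Type*} [TopologicalSpace T] [T2Space T] [SecondCountableTopology T]
    [ChartedSpace F T] [IsManifold 𝓘(ℝ, F) ∞ T]
    (Ω : FormalConnections.SymplecticForm E M) (S : FormalConnections.StarFamily F T Ω) :
    -- `ℱ = D₀ + Ω¹(T, Der₀)`, every element being obtained exactly once
    (∀ D₀ ∈ S.compatibleConnections,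
      Set.BijOn (fun β : S.derivationForms => D₀ + S.toOp β) Set.univ S.compatibleConnections) ∧
    -- `ℱ = D₀ + Ω¹(T, h Γ_sym(M)⟦h⟧)`, through the pointwise correspondence of formal symplectic
    -- vector fields and derivations
    (∃ (φ : ∀ σ, FormalConnections.formalSymplecticFields Ω ≃ₗ[ℂ] (S.star σ).derivations)
        (Φ : FormalConnections.symplecticForms F T Ω ≃ₗ[ℂ] S.derivationForms),
      (∀ σ Y, (S.star σ).Corresponds (φ σ Y).1 Y.1) ∧
      (∀ Y σ v, (Φ Y).1 σ v = φ σ (Y.1 σ v)) ∧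
      ∀ D₀ ∈ S.compatibleConnections,
        Set.BijOn (fun Y => D₀ + S.toOp (Φ Y)) Set.univ S.compatibleConnections) ∧
    -- if `H¹(M; ℝ) = 0`: `ℱ = D₀ + Ω¹(T, h C^∞(M)⟦h⟧ / ℂ⟦h⟧)`, through `b ↦ h⁻¹ (b ⋆ · - · ⋆ b)`
    (PreconnectedSpace M → Subsingleton (FormalConnections.DeRhamH1 E M) →
      ∃ (ψ : ∀ σ, FormalConnections.hFormalFnModConst E M ≃ₗ[ℂ] (S.star σ).derivations)
        (Ψ : FormalConnections.functionForms E M F T ≃ₗ[ℂ] S.derivationForms),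
      (∀ σ (β : FormalConnections.hFormalFnModConst E M) (b f : FormalConnections.FormalFn E M),
        Submodule.Quotient.mk b = β.1 →
          PowerSeries.X * (ψ σ β).1 f = (S.star σ).mul b f - (S.star σ).mul f b) ∧
      (∀ β σ v, (Ψ β).1 σ v = ψ σ (β.1 σ v)) ∧
      ∀ D₀ ∈ S.compatibleConnections,
        Set.BijOn (fun β => D₀ + S.toOp (Ψ β)) Set.univ S.compatibleConnections) := by
  refine ⟨fun D₀ hD₀ => S.bijOn_toOp hD₀, ?_, fun _ hH => ?_⟩
  · obtain ⟨Φ, hΦ⟩ := S.exists_symplecticFormsEquiv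
    refine ⟨fun σ => (S.star σ).symplecticEquiv, Φ, ?_, ?_, ?_⟩
    · exact fun σ Y => (S.star σ).corresponds_symplecticEquiv Y
    · exact hΦ
    · exact fun D₀ hD₀ => (S.bijOn_toOp hD₀).comp (Set.bijOn_univ.2 Φ.bijective)
  · obtain ⟨Φ, hΦ⟩ := S.exists_symplecticFormsEquiv
    choose e he using fun σ => (S.star σ).exists_hamiltonianEquiv hH
    obtain ⟨Ψ, hΨ⟩ := S.exists_functionFormsEquiv hH e he
    refine ⟨fun σ => (e σ).trans (S.star σ).symplecticEquiv, Ψ.trans Φ, ?_, ?_, ?_⟩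
    · intro σ β b f hb
      rw [← FormalConnections.FormalFn.X_smul]
      -- Any representative b is a global Hamiltonian, so the local correspondence applies with the
      -- whole manifold as open set.
      exact FormalConnections.FormalFn.ext_ev fun x => FormalConnections.StarProduct.corresponds_iff.1
        ((S.star σ).corresponds_symplecticEquiv (e σ β)) Set.univ b isOpen_univ (he σ β b hb) f x
        trivial
    · intro β σ v
      rw [LinearEquiv.trans_apply, hΦ, hΨ]
      rfl
    · intro D₀ hD₀
      exact (S.bijOn_toOp hD₀).comp (Set.bijOn_univ.2 (Ψ.trans Φ).bijective)
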